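/- **Setting.** Let $\mathsf{L}_\omega$ be the language of higher-order arithmetic: classical many-sorted predicate logic over the finite types generated from $0$ (natural numbers) by $\sigma,\tau\mapsto(\sigma\to\tau)$, with $1:=0\to0$, constants $0,1,+,\times$, the combinators $\Pi,\Sigma$, recursors $\mathbf R_\sigma$, application, and prime formulas $s=t$, $s<t$ at type $0$; equality at higher types is defined by reduction to equality at type $0$: $x=_{\sigma\to\tau}y$ means $(\forall z^\sigma)(xz=_\tau yz)$. $\mathsf{RCA}_0^\omega$ consists of: the axioms of a (discretely) ordered commutative semi-ring for $0,1,<,+,\times$; the defining equations of $\Pi$ and $\Sigma$; $\mathbf R_0(f,m,0)=m$, $\mathbf R_0(f,m,n+1)=f(n,\mathbf R_0(f,m,n))$; extensionality $x=_\rho y\to\varphi(x)=_\tau\varphi(y)$ for all types $\rho,\tau$; induction for quantifier-free formulas; and $\mathsf{QF\text{-}AC}^{1,0}$, where $\mathsf{QF\text{-}AC}^{\sigma,\tau}$ is the schema $$(\forall x^\sigma)(\exists y^\tau)A(x,y)\to(\exists Y^{\sigma\to\tau})(\forall x^\sigma)A(x,Y(x))\qquad(A\text{ quantifier-free, with parameters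 of any type}).$$ Rationals are signed quotients of natural numbers, coded by natural numbers. A real is (coded by) a sequence $x^1=(q_n)$ of rationals with $|q_n-q_{n+i}|<2^{-n}$ for all $n,i$; for $x=(q_n)$ and $y=(r_n)$, $x=_{\mathbb R}y$ means $(\forall n)(|q_n-r_n|\le2^{-n+1})$ and $x<_{\mathbb R}y$ means $(\exists n)(q_n+2^{-n+1}<r_n)$. A function $\mathbb R\to\mathbb R$ is an object of type $1\to1$ mapping reals to reals and equal reals to equal reals. An *open set* $U\subseteq\mathbb R$ is given by a (possibly discontinuous) function $Y:\mathbb R\to\mathbb R$ via $x\in U\leftrightarrow Y(x)>_{\mathbb R}0$, such that for every $x\in U$ there is a rational $r>0$ with $B(x,r)\subseteq U$. A *closed set* is the complement of an open set. All quantifiers over reals, functions and sets are quantifiers of $\mathsf{L}_\omega$ over these codes. Consider the following sentences of $\mathsf{L}_\omega$. * $\mathsf{WKL}$: every binary tree that contains strings of every length has an infinite path. * $\mathsf{HBC}$: if $C\subseteq[0,1]$ is closed and $(a_n)_{n\in\mathbb N}$, $(b_n)_{n\in\mathbb N}$ are sequences of reals with $C\subseteq\bigcup_{n\in\mathbb N}(a_n,b_n)$,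 then $C\subseteq\bigcup_{n\le n_0}(a_n,b_n)$ for some $n_0\in\mathbb N$. * $\mathsf{HBU}_{\mathrm{closed}}$: if $C\subseteq[0,1]$ is closed and $\Psi:\mathbb R\to\mathbb R$ satisfies $\Psi(x)>0$ for all $x\in\mathbb R$, then there is a finite (possibly empty) sequence $y_1,\dots,y_k\in C$ with $C\subseteq\bigcup_{i\le k}(y_i-\Psi(y_i),y_i+\Psi(y_i))$. **Statement.** 1. $\mathsf{RCA}_0^\omega+\mathsf{QF\text{-}AC}^{0,1}$ proves $\mathsf{WKL}\leftrightarrow\mathsf{HBC}$. 2. $\mathsf{RCA}_0^\omega+\mathsf{WKL}+\mathsf{QF\text{-}AC}^{0,1}$ proves $\mathsf{HBC}$. 3. $\mathsf{RCA}_0^\omega+\mathsf{HBU}_{\mathrm{closed}}$ proves $\mathsf{HBC}$. -/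

import Mathlib

namespace HORM

/-! ### Finite types, terms and formulas of the language of higher-order arithmetic -/

/-- The finite types: `nat` is the type `0`, and `arr σ τ` is the type `σ → τ`. -/
inductive Ty : Type
  | nat : Ty
  | arr : Ty → Ty → Ty

/-- The type `1 = 0 → 0` of number-theoretic functions. -/
abbrev Ty.one : Ty := .arr .nat .nat

/-- A context lists the types of the variables that may occur free. -/
abbrev Ctx : Type := List Ty

/-- Typed de Bruijn variables; `z` is the most recently bound variable. -/
inductive Var : Ctx → Ty → Type
  | z {Γ : Ctx} {σ : Ty} : Var (σ :: Γ) σ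
  | s {Γ : Ctx} {σ τ : Ty} : Var Γ σ → Var (τ :: Γ) σ

/-- The constants: `0`, `1`, `+`, `×`, the combinators `Π` and `Σ`, and the recursors. -/
inductive Cst : Ty → Type
  | zero : Cst .nat
  | one : Cst .nat
  | add : Cst (.arr .nat (.arr .nat .nat))
  | mul : Cst (.arr .nat (.arr .nat .nat))
  | pi (σ τ : Ty) : Cst (.arr σ (.arr τ σ))
  | sig (ρ σ τ : Ty) : Cst (.arr (.arr ρ (.arr σ τ)) (.arr (.arr ρ σ) (.arr ρ τ)))
  | recursor (σ : Ty) : Cst (.arr (.arr .nat (.arr σ σ)) (.arr σ (.arr .nat σ)))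

/-- Terms: variables, constants and application. -/
inductive Tm (Γ : Ctx) : Ty → Type
  | var {σ : Ty} : Var Γ σ → Tm Γ σ
  | cst {σ : Ty} : Cst σ → Tm Γ σ
  | app {σ τ : Ty} : Tm Γ (.arr σ τ) → Tm Γ σ → Tm Γ τ

/-- Formulas with free variables in `Γ`. The prime formulas are `s = t` and `s < t` at type `0`. -/
inductive Fm : Ctx → Type
  | eq {Γ : Ctx} : Tm Γ .nat → Tm Γ .nat → Fm Γ
  | lt {Γ : Ctx} : Tm Γ .nat → Tm Γ .nat → Fm Γ
  | bot {Γ : Ctx} : Fm Γ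
  | imp {Γ : Ctx} : Fm Γ → Fm Γ → Fm Γ
  | all {Γ : Ctx} (σ : Ty) : Fm (σ :: Γ) → Fm Γ

/-- Sentences are formulas without free variables. -/
abbrev Sentence : Type := Fm []

/-! ### Renaming and substitution -/

/-- Renamings of variables. -/
abbrev Ren (Γ Δ : Ctx) : Type := ∀ σ : Ty, Var Γ σ → Var Δ σ

/-- Simultaneous substitutions. -/
abbrev Sub (Γ Δ : Ctx) : Type := ∀ σ : Ty, Var Γ σ → Tm Δ σ

/-- Pass a renaming under a binder. -/
def Ren.up {Γ Δ : Ctx} (r : Ren Γ Δ) (τ : Ty) : Ren (τ :: Γ) (τ :: Δ)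
  | _, .z => .z
  | _, .s v => .s (r _ v)

def Tm.rename {Γ Δ : Ctx} (r : Ren Γ Δ) {σ : Ty} : Tm Γ σ → Tm Δ σ
  | .var v => .var (r _ v)
  | .cst c => .cst c
  | .app f a => .app (f.rename r) (a.rename r)

def Fm.rename {Γ : Ctx} : Fm Γ → {Δ : Ctx} → Ren Γ Δ → Fm Δ
  | .eq s t, _, r => .eq (s.rename r) (t.rename r)
  | .lt s t, _, r => .lt (s.rename r) (t.rename r)
  | .bot, _, _ => .bot
  | .imp φ ψ, _, r => .imp (φ.rename r) (ψ.rename r)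
  | .all σ φ, _, r => .all σ (φ.rename (r.up σ))

/-- Weakening by one fresh variable. -/
def Tm.wk {Γ : Ctx} {σ : Ty} (τ : Ty) (t : Tm Γ σ) : Tm (τ :: Γ) σ :=
  t.rename fun _ v => .s v

def Fm.wk {Γ : Ctx} (τ : Ty) (φ : Fm Γ) : Fm (τ :: Γ) :=
  φ.rename fun _ v => .s v

/-- Pass a substitution under a binder. -/
def Sub.up {Γ Δ : Ctx} (s : Sub Γ Δ) (τ : Ty) : Sub (τ :: Γ) (τ :: Δ)
  | _, .z => .var .z
  | _, .s v => (s _ v).wk τ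

def Tm.subst {Γ Δ : Ctx} (s : Sub Γ Δ) {σ : Ty} : Tm Γ σ → Tm Δ σ
  | .var v => s _ v
  | .cst c => .cst c
  | .app f a => .app (f.subst s) (a.subst s)

def Fm.subst {Γ : Ctx} : Fm Γ → {Δ : Ctx} → Sub Γ Δ → Fm Δ
  | .eq t u, _, s => .eq (t.subst s) (u.subst s)
  | .lt t u, _, s => .lt (t.subst s) (u.subst s)
  | .bot, _, _ => .bot
  | .imp φ ψ, _, s => .imp (φ.subst s) (ψ.subst s)
  | .all σ φ, _, s => .all σ (φ.subst (s.up σ))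

/-- The substitution of `t` for the most recently bound variable. -/
def Sub.one {Γ : Ctx} {σ : Ty} (t : Tm Γ σ) : Sub (σ :: Γ) Γ
  | _, .z => t
  | _, .s v => .var v

/-- The formula `φ[t]`. -/
def Fm.inst {Γ : Ctx} {σ : Ty} (φ : Fm (σ :: Γ)) (t : Tm Γ σ) : Fm Γ :=
  φ.subst (Sub.one t)

/-! ### Defined connectives -/

def Fm.neg {Γ : Ctx} (φ : Fm Γ) : Fm Γ := .imp φ .bot
def Fm.and {Γ : Ctx} (φ ψ : Fm Γ) : Fm Γ := .neg (.imp φ (.neg ψ))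
def Fm.or {Γ : Ctx} (φ ψ : Fm Γ) : Fm Γ := .imp (.neg φ) ψ
def Fm.iff {Γ : Ctx} (φ ψ : Fm Γ) : Fm Γ := .and (.imp φ ψ) (.imp ψ φ)
def Fm.ex {Γ : Ctx} (σ : Ty) (φ : Fm (σ :: Γ)) : Fm Γ := .neg (.all σ (.neg φ))

infixr:30 " ⟹ₕ " => Fm.imp
infixr:35 " ⋏ₕ " => Fm.and
infixr:33 " ⋎ₕ " => Fm.or
infix:28 " ⟺ₕ " => Fm.iff
infix:50 " =ₕ " => Fm.eq
infix:50 " <ₕ " => Fm.lt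

/-- `∀ x^σ, f x`, the bound variable being handed to `f` as a term. -/
def Fm.All {Γ : Ctx} (σ : Ty) (f : Tm (σ :: Γ) σ → Fm (σ :: Γ)) : Fm Γ := .all σ (f (.var .z))

/-- `∃ x^σ, f x`, the bound variable being handed to `f` as a term. -/
def Fm.Ex {Γ : Ctx} (σ : Ty) (f : Tm (σ :: Γ) σ → Fm (σ :: Γ)) : Fm Γ := .ex σ (f (.var .z))

/-- A term may silently be used below further binders. -/
instance {Γ : Ctx} {σ τ : Ty} : Coe (Tm Γ σ) (Tm (τ :: Γ) σ) := ⟨Tm.wk τ⟩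

/-- Quantifier-free formulas; free variables of all finite types are allowed. -/
def Fm.QF : {Γ : Ctx} → Fm Γ → Prop
  | _, .eq _ _ => True
  | _, .lt _ _ => True
  | _, .bot => True
  | _, .imp φ ψ => φ.QF ∧ ψ.QF
  | _, .all _ _ => False

/-! ### Basic terms -/

def Tm.zero {Γ : Ctx} : Tm Γ .nat := .cst .zero
def Tm.one {Γ : Ctx} : Tm Γ .nat := .cst .one
def Tm.add {Γ : Ctx} (s t : Tm Γ .nat) : Tm Γ .nat := .app (.app (.cst .add) s) t
def Tm.mul {Γ : Ctx} (s t : Tm Γ .nat) : Tm Γ .nat := .app (.app (.cst .mul) s) t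

infixl:65 " +ₕ " => Tm.add
infixl:70 " *ₕ " => Tm.mul

/-- The value `f(n)` of a type `1` object. -/
abbrev Tm.at {Γ : Ctx} (f : Tm Γ .one) (n : Tm Γ .nat) : Tm Γ .nat := .app f n
/-- The entry `a_n` of a sequence of type `1` objects. -/
abbrev Tm.nth {Γ : Ctx} (a : Tm Γ (.arr .nat .one)) (n : Tm Γ .nat) : Tm Γ .one := .app a n
/-- The value `Φ(x)` of an object of type `1 → 1`. -/
abbrev Tm.val {Γ : Ctx} (Φ : Tm Γ (.arr .one .one)) (x : Tm Γ .one) : Tm Γ .one := .app Φ x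
/-- `Π t`, i.e. the function with constant value `t`. -/
def Tm.const {Γ : Ctx} {σ : Ty} (τ : Ty) (t : Tm Γ σ) : Tm Γ (.arr τ σ) := .app (.cst (.pi σ τ)) t

/-- The identity `Σ Π Π`. -/
def Tm.idt {Γ : Ctx} (σ : Ty) : Tm Γ (.arr σ σ) :=
  .app (.app (.cst (.sig σ (.arr σ σ) σ)) (.cst (.pi σ (.arr σ σ)))) (.cst (.pi σ σ))

/-- Lambda abstraction of the most recently bound variable, by the combinators. -/
def Tm.lam {Γ : Ctx} {σ τ : Ty} : Tm (σ :: Γ) τ → Tm Γ (.arr σ τ)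
  | .var .z => .idt σ
  | .var (.s v) => .const σ (.var v)
  | .cst c => .const σ (.cst c)
  | .app f a => .app (.app (.cst (.sig _ _ _)) f.lam) a.lam

/-- `λ x^σ, f x`, the bound variable being handed to `f` as a term. -/
def Tm.Lam {Γ : Ctx} (σ : Ty) {τ : Ty} (f : Tm (σ :: Γ) σ → Tm (σ :: Γ) τ) : Tm Γ (.arr σ τ) :=
  (f (.var .z)).lam

/-- `R₀(f, m, n)`. -/
def Tm.rec0 {Γ : Ctx} (f : Tm Γ (.arr .nat .one)) (m n : Tm Γ .nat) : Tm Γ .nat :=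
  .app (.app (.app (.cst (.recursor .nat)) f) m) n

/-- Equality at all finite types, reduced to equality at type `0`. -/
def Fm.eqTy : {Γ : Ctx} → (σ : Ty) → Tm Γ σ → Tm Γ σ → Fm Γ
  | _, .nat, s, t => s =ₕ t
  | _, .arr σ τ, s, t => .all σ (.eqTy τ (.app (s.wk σ) (.var .z)) (.app (t.wk σ) (.var .z)))

/-! ### Provability -/

/-- A theory: a set of axioms, given with free variables, which are read universally. -/
abbrev Theory : Type := (Γ : Ctx) → Set (Fm Γ)

/-- Natural deduction for classical many-sorted predicate logic: `Derives T H φ` says that `φ` is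
derivable from the axioms of `T` and the hypotheses in `H`. -/
inductive Derives (T : Theory) : {Γ : Ctx} → List (Fm Γ) → Fm Γ → Prop
  | ax {Γ : Ctx} {H : List (Fm Γ)} {φ : Fm Γ} : φ ∈ T Γ → Derives T H φ
  | hyp {Γ : Ctx} {H : List (Fm Γ)} {φ : Fm Γ} : φ ∈ H → Derives T H φ
  | impI {Γ : Ctx} {H : List (Fm Γ)} {φ ψ : Fm Γ} :
      Derives T (φ :: H) ψ → Derives T H (φ ⟹ₕ ψ)
  | impE {Γ : Ctx} {H : List (Fm Γ)} {φ ψ : Fm Γ} :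
      Derives T H (φ ⟹ₕ ψ) → Derives T H φ → Derives T H ψ
  | raa {Γ : Ctx} {H : List (Fm Γ)} {φ : Fm Γ} :
      Derives T (φ.neg :: H) .bot → Derives T H φ
  | allI {Γ : Ctx} {H : List (Fm Γ)} {σ : Ty} {φ : Fm (σ :: Γ)} :
      Derives T (H.map (Fm.wk σ)) φ → Derives T H (.all σ φ)
  | allE {Γ : Ctx} {H : List (Fm Γ)} {σ : Ty} {φ : Fm (σ :: Γ)} (t : Tm Γ σ) :
      Derives T H (.all σ φ) → Derives T H (φ.inst t)

/-- The theory `T + S₁ + ⋯ + Sₙ`, for sentences `Sᵢ`, proves the sentence `φ`. -/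
def Proves (T : Theory) (S : List Sentence) (φ : Sentence) : Prop := Derives T S φ

/-! ### The base theory and countable choice -/

/-- `n ↦ n + 1` in the most recently bound variable, which is of type `0`. -/
def Sub.succ {Γ : Ctx} : Sub (.nat :: Γ) (.nat :: Γ)
  | _, .z => .var .z +ₕ .one
  | _, .s v => .var (.s v)

/-- The substitution that turns `A(x, y)` into `A(x, Y(x))`. -/
def Sub.choice {Γ : Ctx} {σ τ : Ty} : Sub (τ :: σ :: Γ) (σ :: .arr σ τ :: Γ)
  | _, .z => .app (.var (.s .z)) (.var .z)
  | _, .s .z => .var .z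
  | _, .s (.s v) => .var (.s (.s v))

/-- `(∀ x^σ)(∃ y^τ) A(x, y) → (∃ Y^{σ → τ})(∀ x^σ) A(x, Y(x))`. -/
def Fm.choiceAx {Γ : Ctx} {σ τ : Ty} (A : Fm (τ :: σ :: Γ)) : Fm Γ :=
  .all σ (.ex τ A) ⟹ₕ .ex (.arr σ τ) (.all σ (A.subst Sub.choice))

/-- `A(0) ∧ (∀ n)(A(n) → A(n + 1)) → (∀ n) A(n)`. -/
def Fm.indAx {Γ : Ctx} (A : Fm (.nat :: Γ)) : Fm Γ :=
  A.inst .zero ⋏ₕ .all .nat (A ⟹ₕ A.subst Sub.succ) ⟹ₕ .all .nat A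

/-- The schema `QF-AC^{σ,τ}`. -/
def QFAC (σ τ : Ty) : Theory := fun Γ => {φ | ∃ A : Fm (τ :: σ :: Γ), A.QF ∧ φ = A.choiceAx}

/-- The axioms of `RCA₀^ω`. -/
inductive RCA0wAx : {Γ : Ctx} → Fm Γ → Prop
  -- equality at type `0`
  | eq_refl {Γ : Ctx} (a : Tm Γ .nat) : RCA0wAx (a =ₕ a)
  | eq_symm {Γ : Ctx} (a b : Tm Γ .nat) : RCA0wAx (a =ₕ b ⟹ₕ b =ₕ a)
  | eq_trans {Γ : Ctx} (a b c : Tm Γ .nat) : RCA0wAx (a =ₕ b ⟹ₕ b =ₕ c ⟹ₕ a =ₕ c)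
  | lt_congr {Γ : Ctx} (a b c d : Tm Γ .nat) :
      RCA0wAx (a =ₕ b ⟹ₕ c =ₕ d ⟹ₕ a <ₕ c ⟹ₕ b <ₕ d)
  -- `0, 1, +, ×` form a commutative semi-ring
  | add_assoc {Γ : Ctx} (a b c : Tm Γ .nat) : RCA0wAx ((a +ₕ b) +ₕ c =ₕ a +ₕ (b +ₕ c))
  | add_comm {Γ : Ctx} (a b : Tm Γ .nat) : RCA0wAx (a +ₕ b =ₕ b +ₕ a)
  | add_zero {Γ : Ctx} (a : Tm Γ .nat) : RCA0wAx (a +ₕ .zero =ₕ a)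
  | mul_assoc {Γ : Ctx} (a b c : Tm Γ .nat) : RCA0wAx ((a *ₕ b) *ₕ c =ₕ a *ₕ (b *ₕ c))
  | mul_comm {Γ : Ctx} (a b : Tm Γ .nat) : RCA0wAx (a *ₕ b =ₕ b *ₕ a)
  | mul_one {Γ : Ctx} (a : Tm Γ .nat) : RCA0wAx (a *ₕ .one =ₕ a)
  | mul_zero {Γ : Ctx} (a : Tm Γ .nat) : RCA0wAx (a *ₕ .zero =ₕ .zero)
  | mul_add {Γ : Ctx} (a b c : Tm Γ .nat) : RCA0wAx (a *ₕ (b +ₕ c) =ₕ a *ₕ b +ₕ a *ₕ c)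
  -- `<` is a discrete linear order with least element `0`, compatible with `+` and `×`
  | lt_irrefl {Γ : Ctx} (a : Tm Γ .nat) : RCA0wAx (a <ₕ a ⟹ₕ .bot)
  | lt_trans {Γ : Ctx} (a b c : Tm Γ .nat) : RCA0wAx (a <ₕ b ⟹ₕ b <ₕ c ⟹ₕ a <ₕ c)
  | lt_total {Γ : Ctx} (a b : Tm Γ .nat) : RCA0wAx (a <ₕ b ⋎ₕ a =ₕ b ⋎ₕ b <ₕ a)
  | add_lt_add {Γ : Ctx} (a b c : Tm Γ .nat) : RCA0wAx (a <ₕ b ⟹ₕ a +ₕ c <ₕ b +ₕ c)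
  | mul_lt_mul {Γ : Ctx} (a b c : Tm Γ .nat) :
      RCA0wAx (.zero <ₕ c ⟹ₕ a <ₕ b ⟹ₕ a *ₕ c <ₕ b *ₕ c)
  | not_lt_zero {Γ : Ctx} (a : Tm Γ .nat) : RCA0wAx (a <ₕ .zero ⟹ₕ .bot)
  | lt_succ {Γ : Ctx} (a b : Tm Γ .nat) :
      RCA0wAx (a <ₕ b +ₕ .one ⟺ₕ a <ₕ b ⋎ₕ a =ₕ b)
  -- the combinators
  | pi {Γ : Ctx} {σ τ : Ty} (x : Tm Γ σ) (y : Tm Γ τ) :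
      RCA0wAx (.eqTy σ (.app (.app (.cst (.pi σ τ)) x) y) x)
  | sig {Γ : Ctx} {ρ σ τ : Ty} (x : Tm Γ (.arr ρ (.arr σ τ))) (y : Tm Γ (.arr ρ σ)) (w : Tm Γ ρ) :
      RCA0wAx (.eqTy τ (.app (.app (.app (.cst (.sig ρ σ τ)) x) y) w)
        (.app (.app x w) (.app y w)))
  -- the recursor of type `0`
  | rec_zero {Γ : Ctx} (f : Tm Γ (.arr .nat .one)) (m : Tm Γ .nat) :
      RCA0wAx (.rec0 f m .zero =ₕ m)
  | rec_succ {Γ : Ctx} (f : Tm Γ (.arr .nat .one)) (m n : Tm Γ .nat) :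
      RCA0wAx (.rec0 f m (n +ₕ .one) =ₕ .app (.app f n) (.rec0 f m n))
  -- extensionality
  | ext {Γ : Ctx} {ρ τ : Ty} (x y : Tm Γ ρ) (f : Tm Γ (.arr ρ τ)) :
      RCA0wAx (.eqTy ρ x y ⟹ₕ .eqTy τ (.app f x) (.app f y))
  -- quantifier-free induction
  | ind {Γ : Ctx} (A : Fm (.nat :: Γ)) : A.QF → RCA0wAx A.indAx
  -- `QF-AC^{1,0}`
  | qfac {Γ : Ctx} (A : Fm (.nat :: .one :: Γ)) : A.QF → RCA0wAx A.choiceAx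

/-- The base theory `RCA₀^ω`. -/
def RCA0w : Theory := fun _ => {φ | RCA0wAx φ}

/-! ### Real numbers -/

def Tm.two {Γ : Ctx} : Tm Γ .nat := .one +ₕ .one

/-- `2^n`, by primitive recursion. -/
def Tm.pow2 {Γ : Ctx} (n : Tm Γ .nat) : Tm Γ .nat :=
  .rec0 (.Lam .nat fun _ => .Lam .nat fun r => r +ₕ r) .one n

/-- Terms `p, n, d` standing for the rational number `(p - n) / d`, where `d` is positive. -/
structure Frac (Γ : Ctx) : Type where
  p : Tm Γ .nat
  n : Tm Γ .nat
  d : Tm Γ .nat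

def Frac.wk {Γ : Ctx} (τ : Ty) (F : Frac Γ) : Frac (τ :: Γ) := ⟨F.p.wk τ, F.n.wk τ, F.d.wk τ⟩

instance {Γ : Ctx} {τ : Ty} : Coe (Frac Γ) (Frac (τ :: Γ)) := ⟨Frac.wk τ⟩

def Frac.add {Γ : Ctx} (F G : Frac Γ) : Frac Γ :=
  ⟨F.p *ₕ G.d +ₕ G.p *ₕ F.d, F.n *ₕ G.d +ₕ G.n *ₕ F.d, F.d *ₕ G.d⟩

def Frac.sub {Γ : Ctx} (F G : Frac Γ) : Frac Γ := F.add ⟨G.n, G.p, G.d⟩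

/-- `F < G`. -/
def Frac.lt {Γ : Ctx} (F G : Frac Γ) : Fm Γ :=
  F.p *ₕ G.d +ₕ G.n *ₕ F.d <ₕ G.p *ₕ F.d +ₕ F.n *ₕ G.d

/-- `|F| < G`. -/
def Frac.absLt {Γ : Ctx} (F G : Frac Γ) : Fm Γ :=
  F.lt G ⋏ₕ Frac.lt ⟨F.n, F.p, F.d⟩ G

/-- `|F| ≤ G`. -/
def Frac.absLe {Γ : Ctx} (F G : Frac Γ) : Fm Γ :=
  (G.lt F).neg ⋏ₕ (G.lt ⟨F.n, F.p, F.d⟩).neg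

/-- `2^{-n}`. -/
def Frac.eps {Γ : Ctx} (n : Tm Γ .nat) : Frac Γ := ⟨.one, .zero, .pow2 n⟩

/-- `2^{-n+1}`. -/
def Frac.eps2 {Γ : Ctx} (n : Tm Γ .nat) : Frac Γ := ⟨.two, .zero, .pow2 n⟩

/-- The natural number `q` codes the rational `F`. The code of a signed quotient is the Cantor pair
`⟨m, k⟩ = ((m + k)² + 3m + k) / 2`; it stands for `(m / 2) / (k + 1)` if `m` is even and for
`-((m + 1) / 2) / (k + 1)` if `m` is odd. -/
def codes {Γ : Ctx} (q : Tm Γ .nat) (F : Frac Γ) : Fm Γ :=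
  .Ex .nat fun m => .Ex .nat fun k =>
    (.two *ₕ q =ₕ (m +ₕ k) *ₕ (m +ₕ k) +ₕ (.two +ₕ .one) *ₕ m +ₕ k) ⋏ₕ
    (F.d =ₕ k +ₕ .one) ⋏ₕ
    (((m =ₕ .two *ₕ F.p) ⋏ₕ (F.n =ₕ .zero)) ⋎ₕ
      ((m +ₕ .one =ₕ .two *ₕ F.n) ⋏ₕ (F.p =ₕ .zero)))

/-- The rational number `F` coded by `q` satisfies `f F`. -/
def withRat {Γ : Ctx} (q : Tm Γ .nat)
    (f : Frac (.nat :: .nat :: .nat :: Γ) → Fm (.nat :: .nat :: .nat :: Γ)) : Fm Γ :=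
  .Ex .nat fun p => .Ex .nat fun n => .Ex .nat fun d => codes q ⟨p, n, d⟩ ⋏ₕ f ⟨p, n, d⟩

/-- `x ∈ ℝ`: the sequence of rationals coded by `x^1` is fast-converging,
i.e. `|q_n - q_{n+i}| < 2^{-n}` for all `n, i`. -/
def isReal {Γ : Ctx} (x : Tm Γ .one) : Fm Γ :=
  .All .nat fun n => .All .nat fun i =>
    withRat (.at x n) fun F => withRat (.at x (n +ₕ i)) fun G =>
      Frac.absLt (Frac.sub F G) (.eps n)

/-- `x =_ℝ y`, i.e. `|q_n - r_n| ≤ 2^{-n+1}` for all `n`. -/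
def realEq {Γ : Ctx} (x y : Tm Γ .one) : Fm Γ :=
  .All .nat fun n =>
    withRat (.at x n) fun F => withRat (.at y n) fun G => Frac.absLe (Frac.sub F G) (.eps2 n)

/-- `x <_ℝ y`, i.e. `q_n + 2^{-n+1} < r_n` for some `n`. -/
def realLt {Γ : Ctx} (x y : Tm Γ .one) : Fm Γ :=
  .Ex .nat fun n =>
    withRat (.at x n) fun F => withRat (.at y n) fun G => Frac.lt (Frac.add F (.eps2 n)) G

/-- `x ≤_ℝ y`. -/
def realLe {Γ : Ctx} (x y : Tm Γ .one) : Fm Γ := (realLt y x).neg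

/-- `|x - y| <_ℝ r`. The `n`-th approximation of `x - y` is `q_{n+1} - r_{n+1}`. -/
def distLt {Γ : Ctx} (x y r : Tm Γ .one) : Fm Γ :=
  .Ex .nat fun n =>
    withRat (.at x (n +ₕ .one)) fun F => withRat (.at y (n +ₕ .one)) fun G =>
      withRat (.at r n) fun E => Frac.absLt (Frac.sub F G) (Frac.sub E (.eps2 n))

/-- The rational with code `q` as a real number. -/
def ratReal {Γ : Ctx} (q : Tm Γ .nat) : Tm Γ .one := .const .nat q

/-- The real number `0`; the rational `0` has code `0`. -/
def real0 {Γ : Ctx} : Tm Γ .one := ratReal .zero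

/-- The real number `1`; the rational `1 = (2 / 2) / (0 + 1)` has code `⟨2, 0⟩ = 5`. -/
def real1 {Γ : Ctx} : Tm Γ .one := ratReal (.two +ₕ .two +ₕ .one)

/-- `(∀ x ∈ ℝ) f x`. -/
def AllReal {Γ : Ctx} (f : Tm (.one :: Γ) .one → Fm (.one :: Γ)) : Fm Γ :=
  .All .one fun x => isReal x ⟹ₕ f x

/-- `Φ : ℝ → ℝ`: the object `Φ` of type `1 → 1` maps reals to reals and respects `=_ℝ`. -/
def isRealFun {Γ : Ctx} (Φ : Tm Γ (.arr .one .one)) : Fm Γ :=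
  (AllReal fun x => isReal (.val Φ x)) ⋏ₕ
  (AllReal fun x => AllReal fun y => realEq x y ⟹ₕ realEq (.val Φ x) (.val Φ y))

/-! ### Open and closed sets, and the principles -/

/-- `x ∈ Y`, i.e. `Y(x) >_ℝ 0`, for a set represented by `Y : ℝ → ℝ`. -/
def memSet {Γ : Ctx} (x : Tm Γ .one) (Y : Tm Γ (.arr .one .one)) : Fm Γ := realLt real0 (.val Y x)

/-- `Y` represents an open set: for every `x ∈ Y` there is a rational `r > 0` with `B(x, r) ⊆ Y`. -/
def isOpenSet {Γ : Ctx} (Y : Tm Γ (.arr .one .one)) : Fm Γ :=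
  isRealFun Y ⋏ₕ
  AllReal fun x => memSet x Y ⟹ₕ
    .Ex .nat fun r => realLt real0 (ratReal r) ⋏ₕ
      AllReal fun y => distLt x y (ratReal r) ⟹ₕ memSet y Y

/-- `x ∈ C` for the closed set `C` whose complement is represented by `Y`. -/
def memCompl {Γ : Ctx} (x : Tm Γ .one) (Y : Tm Γ (.arr .one .one)) : Fm Γ := (memSet x Y).neg

/-- `Y` represents the complement of a closed set `C ⊆ [0, 1]`. -/
def closedInUnit {Γ : Ctx} (Y : Tm Γ (.arr .one .one)) : Fm Γ :=
  isOpenSet Y ⋏ₕ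
  AllReal fun x => memCompl x Y ⟹ₕ realLe real0 x ⋏ₕ realLe x real1

/-- `x ∈ (a_n, b_n)`. -/
def inInterval {Γ : Ctx} (x : Tm Γ .one) (a b : Tm Γ (.arr .nat .one)) (n : Tm Γ .nat) : Fm Γ :=
  realLt (.nth a n) x ⋏ₕ realLt x (.nth b n)

/-- `HBC`: every covering of a closed set `C ⊆ [0, 1]` by a sequence of open intervals
`(a_n, b_n)` has a finite sub-covering. -/
def HBC : Sentence :=
  .All (.arr .one .one) fun Y => .All (.arr .nat .one) fun a => .All (.arr .nat .one) fun b =>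
    closedInUnit Y ⟹ₕ
    (.All .nat fun n => isReal (.nth a n) ⋏ₕ isReal (.nth b n)) ⟹ₕ
    (AllReal fun x => memCompl x Y ⟹ₕ .Ex .nat fun n => inInterval x a b n) ⟹ₕ
    .Ex .nat fun N => AllReal fun x => memCompl x Y ⟹ₕ
      .Ex .nat fun n => (n <ₕ N +ₕ .one) ⋏ₕ inInterval x a b n

/-- `HBU_closed`: for every closed `C ⊆ [0, 1]` and `Ψ : ℝ → ℝ⁺`, there is a finite sequence
`y_0, …, y_{k-1}` in `C` such that the intervals `(y_i - Ψ(y_i), y_i + Ψ(y_i))` cover `C`. -/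
def HBUclosed : Sentence :=
  .All (.arr .one .one) fun Y => .All (.arr .one .one) fun Ψ =>
    closedInUnit Y ⟹ₕ
    isRealFun Ψ ⟹ₕ
    (AllReal fun x => realLt real0 (.val Ψ x)) ⟹ₕ
    .Ex (.arr .nat .one) fun y => .Ex .nat fun k =>
      (.All .nat fun i => i <ₕ k ⟹ₕ isReal (.nth y i) ⋏ₕ memCompl (.nth y i) Y) ⋏ₕ
      AllReal fun x => memCompl x Y ⟹ₕ
        .Ex .nat fun i => (i <ₕ k) ⋏ₕ distLt x (.nth y i) (.val Ψ (.nth y i))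

/-- `f ≤_1 1`, i.e. `f` is a binary sequence. -/
def isBinary {Γ : Ctx} (f : Tm Γ .one) : Fm Γ :=
  .All .nat fun n => .at f n <ₕ .two

/-- The code of the binary string `⟨f(0), …, f(n-1)⟩`: the number with binary digits
`1, f(0), …, f(n-1)`, so that the empty string has code `1` and `s * ⟨i⟩` has code `2 s + i`. -/
def Tm.initSeg {Γ : Ctx} (f : Tm Γ .one) (n : Tm Γ .nat) : Tm Γ .nat :=
  .rec0 (.Lam .nat fun k => .Lam .nat fun s => s +ₕ s +ₕ .at f k) .one n

/-- `T` represents a binary tree: the binary strings `s` with `T(s) = 0` are closed under initial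
segments. -/
def isTree {Γ : Ctx} (T : Tm Γ .one) : Fm Γ :=
  .All .one fun c => isBinary c ⟹ₕ .All .nat fun n =>
    .at T (.initSeg c (n +ₕ .one)) =ₕ .zero ⟹ₕ .at T (.initSeg c n) =ₕ .zero

/-- `WKL`: every binary tree with strings of every length has an infinite path. -/
def WKL : Sentence :=
  .All .one fun T =>
    isTree T ⟹ₕ
    (.All .nat fun n => .Ex .one fun c => isBinary c ⋏ₕ (.at T (.initSeg c n) =ₕ .zero)) ⟹ₕ
    .Ex .one fun f => isBinary f ⋏ₕ .All .nat fun n => .at T (.initSeg f n) =ₕ .zero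

end HORM

/-!
The three derivability claims are reduced to statements about models. The logic is complete:
`exists_countermodel` is the Henkin construction for the de Bruijn syntax, carried out along a chain
of contexts that grow by one Henkin variable at each step. The axiom of extensionality permits
passing to the quotient by hereditarily extensional equality, so that (`derives_of_sat`) it is
enough to argue in a structure `M` in which equality at every type is equality of objects.

In such a model, `M.D .nat` is an ordered semiring, usually nonstandard, whose elements play the role
of the natural numbers. Definable maps, the predicate `Dfn`, take the place of the functions of the
theory: by combinatory completeness each of them is represented by an object (`lam`), the decidable
properties are the definable maps to `Prop`, and the axioms yield induction, recursion, bounded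
search and collection for them. The rationals of the model are `FracField (M.D .nat)`, and the
three principles become the properties `Str.SatWKL`, `Str.SatHBC` and `Str.SatHBU` of the model.

`HBU_closed` implies `HBC` (`Str.SatHBU.satHBC`): if the intervals `(a_n, b_n)` cover the closed set
`C` given by `Y`, the covering theorem is applied to the `gauge`, the maximum of `Y` and of the
numbers `2⁻ⁿ · min 1 (x - a_n) (b_n - x)`. It is positive everywhere, by `Y` off `C` and by the
covering on `C`. At a point `y` of `C` a distance less than the gauge is due to the second part, so a
ball around `y` lies in the union of finitely many of the intervals. Their number is bounded in terms
of `y` and finitely many centres suffice.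

`HBC` implies `WKL` (`Str.SatHBC.satWKL`): here `C` is the whole unit interval. If the tree had no
path, every real number in it would lie in an interval with dyadic end points such that all strings
of length `n` that start an expansion of one of its points are off the tree (`OffTree`). At a dyadic
number, which has two expansions, such an interval comes from both. A finite subcover contradicts the
existence of long strings in the tree.

`WKL` and `QF-AC^{0,1}` imply `HBC` (`Str.SatWKL.satHBC`): the difficulty is that membership in `C`
is not decidable. If no finite subcover exists, there are binary sequences `g_s` with `Y(g_s) ≤ 3 · 2⁻ˢ`
that are not covered by the first `s` intervals, up to precision `s` (`Uncovered`), and countable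
choice yields them as a sequence. A path of the tree of uncovered strings lies in no interval, hence
not in `C`, and `Y` is positive there. So `Y` separates the `g_s` from the paths of a tree on which
they lie further and further, a `Discontinuity`. `WKL` for a product of such trees then decides `Σ₁`
properties (`Discontinuity.dfn_exists`): the path through the component that belongs to a property
either is `g_s`, with `s` the first witness, or it is uncovered, and the value of `Y` tells how far one
has to search. Consequently sequences in Cantor space have accumulation points
(`exists_accumulation`). Where the `g_s` accumulate, `Y` is effectively discontinuous, and Grilliot's
trick makes quantification over numbers decidable uniformly in all parameters
(`Discontinuity.dfn_forall_eq_zero`). Now membership in `C` is decidable, so that the choice can be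
repeated with points that belong to `C`. An accumulation point of these lies in `C`, as `C` is
closed, and in none of the intervals, which is a contradiction.
-/


namespace HORM

section

/-! ### Renaming and substitution -/

theorem Tm.subst_rename {Γ Δ Θ : Ctx} (r : Ren Γ Δ) (s : Sub Δ Θ) {σ : Ty} (t : Tm Γ σ) :
    (t.rename r).subst s = t.subst fun σ v => s σ (r σ v) := by
  induction t with
  | var v => rfl
  | cst c => rfl
  | app f a hf ha => simp only [Tm.rename, Tm.subst, hf, ha]

theorem Tm.rename_subst {Γ Δ Θ : Ctx} (s : Sub Γ Δ) (r : Ren Δ Θ) {σ : Ty} (t : Tm Γ σ) :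
    (t.subst s).rename r = t.subst fun σ v => (s σ v).rename r := by
  induction t with
  | var v => rfl
  | cst c => rfl
  | app f a hf ha => simp only [Tm.rename, Tm.subst, hf, ha]

theorem Tm.subst_subst {Γ Δ Θ : Ctx} (s : Sub Γ Δ) (u : Sub Δ Θ) {σ : Ty} (t : Tm Γ σ) :
    (t.subst s).subst u = t.subst fun σ v => (s σ v).subst u := by
  induction t with
  | var v => rfl
  | cst c => rfl
  | app f a hf ha => simp only [Tm.subst, hf, ha]

theorem Sub.up_subst {Γ Δ Θ : Ctx} (s : Sub Γ Δ) (u : Sub Δ Θ) (τ : Ty) :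
    (fun σ v => (s.up τ σ v).subst (u.up τ)) = Sub.up (fun σ v => (s σ v).subst u) τ := by
  funext σ v
  cases v with
  | z => rfl
  | s v => simp only [Sub.up, Tm.wk, Tm.subst_rename, Tm.rename_subst]

theorem Fm.subst_subst {Γ Δ Θ : Ctx} (s : Sub Γ Δ) (u : Sub Δ Θ) (φ : Fm Γ) :
    (φ.subst s).subst u = φ.subst fun σ v => (s σ v).subst u := by
  induction φ generalizing Δ Θ with
  | eq t u => simp only [Fm.subst, Tm.subst_subst]
  | lt t u => simp only [Fm.subst, Tm.subst_subst]
  | bot => rfl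
  | imp φ ψ hφ hψ => simp only [Fm.subst, hφ, hψ]
  | all σ φ h => simp only [Fm.subst, h, Sub.up_subst]

theorem Tm.rename_eq_subst {Γ Δ : Ctx} (r : Ren Γ Δ) {σ : Ty} (t : Tm Γ σ) :
    t.rename r = t.subst fun σ v => .var (r σ v) := by
  induction t with
  | var v => rfl
  | cst c => rfl
  | app f a hf ha => simp only [Tm.rename, Tm.subst, hf, ha]

theorem Fm.rename_eq_subst {Γ Δ : Ctx} (r : Ren Γ Δ) (φ : Fm Γ) :
    φ.rename r = φ.subst fun σ v => .var (r σ v) := by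
  induction φ generalizing Δ with
  | eq t u => simp only [Fm.rename, Fm.subst, Tm.rename_eq_subst]
  | lt t u => simp only [Fm.rename, Fm.subst, Tm.rename_eq_subst]
  | bot => rfl
  | imp φ ψ hφ hψ => simp only [Fm.rename, Fm.subst, hφ, hψ]
  | all σ φ h =>
    simp only [Fm.rename, Fm.subst, h]
    congr 2
    funext τ v; cases v <;> rfl

theorem Tm.subst_var {Γ : Ctx} {σ : Ty} (t : Tm Γ σ) : t.subst (fun _ v => .var v) = t := by
  induction t with
  | var v => rfl
  | cst c => rfl
  | app f a hf ha => simp only [Tm.subst, hf, ha]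

theorem Fm.subst_var {Γ : Ctx} (φ : Fm Γ) : φ.subst (fun _ v => .var v) = φ := by
  induction φ with
  | eq t u => simp only [Fm.subst, Tm.subst_var]
  | lt t u => simp only [Fm.subst, Tm.subst_var]
  | bot => rfl
  | imp φ ψ hφ hψ => simp only [Fm.subst, hφ, hψ]
  | @all Γ σ φ h =>
    have : Sub.up (fun _ v => Tm.var v : Sub Γ Γ) σ = fun _ v => .var v := by
      funext τ v; cases v <;> rfl
    simp only [Fm.subst, this, h]

theorem Tm.wk_subst_up {Γ Δ : Ctx} (s : Sub Γ Δ) (τ : Ty) {σ : Ty} (t : Tm Γ σ) :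
    (t.wk τ).subst (s.up τ) = (t.subst s).wk τ := by
  simp only [Tm.wk, Tm.subst_rename, Tm.rename_subst]; rfl

theorem Fm.wk_eq_subst {Γ : Ctx} (τ : Ty) (φ : Fm Γ) :
    φ.wk τ = φ.subst fun _ v => .var (.s v) := Fm.rename_eq_subst _ _

/-- Extension of a substitution by a term for the most recently bound variable. -/
def Sub.cons {Γ Δ : Ctx} {σ : Ty} (s : Sub Γ Δ) (t : Tm Δ σ) : Sub (σ :: Γ) Δ
  | _, .z => t
  | _, .s v => s _ v

theorem Tm.wk_subst_one {Γ : Ctx} {σ τ : Ty} (t : Tm Γ σ) (u : Tm Γ τ) :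
    (t.wk τ).subst (Sub.one u) = t := by
  simp only [Tm.wk, Tm.subst_rename, Sub.one, Tm.subst_var]

theorem Fm.inst_subst_up {Γ Δ : Ctx} {σ : Ty} (s : Sub Γ Δ) (φ : Fm (σ :: Γ)) (t : Tm Δ σ) :
    (φ.subst (s.up σ)).inst t = φ.subst (s.cons t) := by
  simp only [Fm.inst, Fm.subst_subst]
  congr 1
  funext τ v
  cases v with
  | z => rfl
  | s v => exact Tm.wk_subst_one _ _

theorem Fm.inst_subst {Γ Δ : Ctx} {σ : Ty} (s : Sub Γ Δ) (φ : Fm (σ :: Γ)) (t : Tm Γ σ) :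
    (φ.inst t).subst s = (φ.subst (s.up σ)).inst (t.subst s) := by
  rw [Fm.inst_subst_up, Fm.inst, Fm.subst_subst]
  congr 1
  funext τ v
  cases v <;> rfl

theorem Fm.inst_rename {Γ Δ : Ctx} {σ : Ty} (r : Ren Γ Δ) (φ : Fm (σ :: Γ)) (t : Tm Γ σ) :
    (φ.inst t).rename r = (φ.rename (r.up σ)).inst (t.rename r) := by
  simp only [Fm.inst, Fm.rename_eq_subst, Fm.subst_subst, Tm.rename_eq_subst]
  congr 1
  funext τ v
  cases v <;> rfl

theorem Fm.wk_rename_up {Γ Δ : Ctx} (r : Ren Γ Δ) (τ : Ty) (φ : Fm Γ) :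
    (φ.wk τ).rename (r.up τ) = (φ.rename r).wk τ := by
  simp only [Fm.wk, Fm.rename_eq_subst, Fm.subst_subst]; rfl

/-! ### Weakening of derivations -/

/-- A theory is closed under substitution if its axioms are. -/
def Theory.Closed (T : Theory) : Prop :=
  ∀ {Γ Δ : Ctx} (s : Sub Γ Δ) {φ : Fm Γ}, φ ∈ T Γ → φ.subst s ∈ T Δ

variable {T : Theory}

theorem Derives.mono {Γ : Ctx} {H K : List (Fm Γ)} {φ : Fm Γ} (h : Derives T H φ)
    (hs : H ⊆ K) : Derives T K φ := by
  induction h with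
  | ax h => exact .ax h
  | hyp h => exact .hyp (hs h)
  | impI _ ih => exact .impI (ih (List.cons_subset_cons _ hs))
  | impE _ _ ih₁ ih₂ => exact .impE (ih₁ hs) (ih₂ hs)
  | raa _ ih => exact .raa (ih (List.cons_subset_cons _ hs))
  | allI _ ih => exact .allI (ih (List.map_subset _ hs))
  | allE t _ ih => exact .allE t (ih hs)

theorem Derives.rename (hT : T.Closed) {Γ Δ : Ctx} {H : List (Fm Γ)} {φ : Fm Γ}
    (h : Derives T H φ) (r : Ren Γ Δ) : Derives T (H.map fun ψ => ψ.rename r) (φ.rename r) := by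
  induction h generalizing Δ with
  | ax h => exact .ax (Fm.rename_eq_subst r _ ▸ hT _ h)
  | hyp h => exact .hyp (List.mem_map_of_mem h)
  | impI _ ih => exact .impI (ih r)
  | impE _ _ ih₁ ih₂ => exact .impE (ih₁ r) (ih₂ r)
  | raa _ ih => exact .raa (ih r)
  | @allI Γ H σ φ _ ih =>
    refine .allI ?_
    have := ih (r.up σ)
    simpa only [List.map_map, Function.comp_def, Fm.wk_rename_up] using this
  | allE t _ ih => rw [Fm.inst_rename]; exact .allE _ (ih r)

theorem Derives.wk (hT : T.Closed) {Γ : Ctx} {H : List (Fm Γ)} {φ : Fm Γ}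
    (h : Derives T H φ) (τ : Ty) : Derives T (H.map (Fm.wk τ)) (φ.wk τ) :=
  h.rename hT _

theorem Derives.cut {Γ : Ctx} {H : List (Fm Γ)} {φ ψ : Fm Γ} (h : Derives T H φ)
    (h' : Derives T (φ :: H) ψ) : Derives T H ψ := .impE (.impI h') h

theorem Derives.botE {Γ : Ctx} {H : List (Fm Γ)} {φ : Fm Γ} (h : Derives T H .bot) :
    Derives T H φ := .raa (h.mono (List.subset_cons_self _ _))

theorem Fm.wk_inst {Γ : Ctx} {σ : Ty} (φ : Fm Γ) (t : Tm Γ σ) : (φ.wk σ).inst t = φ := by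
  rw [Fm.inst, Fm.wk_eq_subst, Fm.subst_subst]; exact Fm.subst_var φ

/-- Every type is inhabited by a closed term. -/
def Tm.default {Γ : Ctx} : (σ : Ty) → Tm Γ σ
  | .nat => .zero
  | .arr _ τ => .const _ (Tm.default τ)

theorem Derives.of_wk {Γ : Ctx} {H : List (Fm Γ)} {σ : Ty} {φ : Fm Γ}
    (h : Derives T (H.map (Fm.wk σ)) (φ.wk σ)) : Derives T H φ := by
  have := Derives.allE (Tm.default σ) (Derives.allI h)
  rwa [Fm.wk_inst] at this

end

/-! ### Structures and satisfaction -/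

/-- A structure for the language, with an arbitrary relation interpreting equality at type `0`. -/
structure Str where
  D : Ty → Type
  app : {σ τ : Ty} → D (.arr σ τ) → D σ → D τ
  cst : {σ : Ty} → Cst σ → D σ
  eq : D .nat → D .nat → Prop
  lt : D .nat → D .nat → Prop

/-- Assignments of objects to the variables of a context. -/
abbrev Env (D : Ty → Type) (Γ : Ctx) : Type := ∀ σ : Ty, Var Γ σ → D σ

/-- Extension of an assignment by a value for the most recently bound variable. -/
def Env.cons {D : Ty → Type} {Γ : Ctx} {σ : Ty} (x : D σ) (ρ : Env D Γ) : Env D (σ :: Γ)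
  | _, .z => x
  | _, .s v => ρ _ v

/-- The empty assignment. -/
def Env.nil {D : Ty → Type} : Env D [] := fun _ v => nomatch v

/-- The value of a term under an assignment. -/
def Tm.eval (M : Str) {Γ : Ctx} (ρ : Env M.D Γ) {σ : Ty} : Tm Γ σ → M.D σ
  | .var v => ρ _ v
  | .cst c => M.cst c
  | .app f a => M.app (f.eval M ρ) (a.eval M ρ)

/-- Satisfaction of a formula under an assignment. -/
def Fm.sat (M : Str) : {Γ : Ctx} → Fm Γ → Env M.D Γ → Prop
  | _, .eq s t, ρ => M.eq (s.eval M ρ) (t.eval M ρ)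
  | _, .lt s t, ρ => M.lt (s.eval M ρ) (t.eval M ρ)
  | _, .bot, _ => False
  | _, .imp φ ψ, ρ => φ.sat M ρ → ψ.sat M ρ
  | _, .all _ φ, ρ => ∀ x, φ.sat M (ρ.cons x)

/-- All axioms of the theory hold in the structure. -/
def Str.Models (M : Str) (T : Theory) : Prop :=
  ∀ (Γ : Ctx) (φ : Fm Γ), φ ∈ T Γ → ∀ ρ : Env M.D Γ, φ.sat M ρ

/-! ### Countability of the language -/

/-- A numerical code of a type. -/
def Ty.code : Ty → ℕ
  | .nat => 0
  | .arr σ τ => Nat.pair σ.code τ.code + 1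

theorem Ty.code_injective : Function.Injective Ty.code := by
  intro σ
  induction σ with
  | nat => intro τ h; cases τ <;> simp_all [Ty.code]
  | arr a b ha hb =>
    intro τ h
    cases τ with
    | nat => simp [Ty.code] at h
    | arr c d =>
      simp only [Ty.code, Nat.add_right_cancel_iff, Nat.pair_eq_pair] at h
      rw [ha h.1, hb h.2]

instance : Nonempty Ty := ⟨.nat⟩

instance : Countable Ty := Ty.code_injective.countable

instance : Countable (Σ σ, Cst σ) := by
  let g : Fin 4 ⊕ (Ty × Ty) ⊕ (Ty × Ty × Ty) ⊕ Ty → Σ σ, Cst σ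
    | .inl 0 => ⟨_, .zero⟩
    | .inl 1 => ⟨_, .one⟩
    | .inl 2 => ⟨_, .add⟩
    | .inl 3 => ⟨_, .mul⟩
    | .inr (.inl (σ, τ)) => ⟨_, .pi σ τ⟩
    | .inr (.inr (.inl (ρ, σ, τ))) => ⟨_, .sig ρ σ τ⟩
    | .inr (.inr (.inr σ)) => ⟨_, .recursor σ⟩
  refine Function.Surjective.countable (f := g) ?_
  rintro ⟨_, c⟩
  cases c with
  | zero => exact ⟨.inl 0, rfl⟩
  | one => exact ⟨.inl 1, rfl⟩
  | add => exact ⟨.inl 2, rfl⟩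
  | mul => exact ⟨.inl 3, rfl⟩
  | pi σ τ => exact ⟨.inr (.inl (σ, τ)), rfl⟩
  | sig ρ σ τ => exact ⟨.inr (.inr (.inl (ρ, σ, τ))), rfl⟩
  | recursor σ => exact ⟨.inr (.inr (.inr σ)), rfl⟩

/-- A numerical code of a constant. -/
noncomputable def Cst.code {σ : Ty} (c : Cst σ) : ℕ :=
  (exists_injective_nat (Σ σ, Cst σ)).choose ⟨σ, c⟩

theorem Cst.code_inj {σ : Ty} {c d : Cst σ} (h : c.code = d.code) : c = d := by
  simpa using (exists_injective_nat (Σ σ, Cst σ)).choose_spec h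

/-- The de Bruijn index of a variable. -/
def Var.index {Γ : Ctx} {σ : Ty} : Var Γ σ → ℕ
  | .z => 0
  | .s v => v.index + 1

theorem Var.index_inj {Γ : Ctx} {σ : Ty} {v w : Var Γ σ} (h : v.index = w.index) : v = w := by
  induction v with
  | z => cases w with
    | z => rfl
    | s w => simp [Var.index] at h
  | s v ih => cases w with
    | z => simp [Var.index] at h
    | s w => rw [ih (by simpa [Var.index] using h)]

/-- A numerical code of a term. -/
noncomputable def Tm.code {Γ : Ctx} {σ : Ty} : Tm Γ σ → ℕ
  | .var v => Nat.pair 0 v.index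
  | .cst c => Nat.pair 1 c.code
  | .app (σ := σ) f a => Nat.pair 2 (Nat.pair σ.code (Nat.pair f.code a.code))

theorem Tm.code_inj {Γ : Ctx} {σ : Ty} {t u : Tm Γ σ} (h : t.code = u.code) : t = u := by
  induction t with
  | var v => cases u <;> simp [Tm.code] at h; rw [Var.index_inj h]
  | cst c => cases u <;> simp [Tm.code] at h; rw [Cst.code_inj h]
  | app f a hf ha =>
    cases u with
    | var v => simp [Tm.code] at h
    | cst c => simp [Tm.code] at h
    | app g b =>
      simp only [Tm.code, Nat.pair_eq_pair, true_and] at h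
      obtain ⟨h₁, h₂, h₃⟩ := h
      obtain rfl := Ty.code_injective h₁
      rw [hf h₂, ha h₃]

/-- A numerical code of a formula. -/
noncomputable def Fm.code {Γ : Ctx} : Fm Γ → ℕ
  | .eq s t => Nat.pair 0 (Nat.pair s.code t.code)
  | .lt s t => Nat.pair 1 (Nat.pair s.code t.code)
  | .bot => Nat.pair 2 0
  | .imp φ ψ => Nat.pair 3 (Nat.pair φ.code ψ.code)
  | .all σ φ => Nat.pair 4 (Nat.pair σ.code φ.code)

theorem Fm.code_injective {Γ : Ctx} : Function.Injective (Fm.code (Γ := Γ)) := by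
  intro φ
  induction φ with
  | eq s t => intro ψ h; cases ψ <;> simp [Fm.code] at h; rw [Tm.code_inj h.1, Tm.code_inj h.2]
  | lt s t => intro ψ h; cases ψ <;> simp [Fm.code] at h; rw [Tm.code_inj h.1, Tm.code_inj h.2]
  | bot => intro ψ h; cases ψ <;> simp [Fm.code] at h; rfl
  | imp φ φ' h₁ h₂ => intro ψ h; cases ψ <;> simp [Fm.code] at h; rw [h₁ h.1, h₂ h.2]
  | all σ φ ih =>
    intro ψ h
    cases ψ <;> simp [Fm.code] at h
    obtain rfl := Ty.code_injective h.1
    rw [ih h.2]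

instance {Γ : Ctx} : Countable (Fm Γ) := Fm.code_injective.countable

/-! ### The Henkin construction -/

/-- The hypotheses do not derive falsity. -/
def Consistent (T : Theory) {Γ : Ctx} (H : List (Fm Γ)) : Prop := ¬ Derives T H .bot

variable {T : Theory}

/-- One step of the Henkin construction: a formula is decided and, if it is a refuted universal
formula, the fresh variable becomes a counterexample. -/
theorem Consistent.step {Γ : Ctx} {H : List (Fm Γ)} (hH : Consistent T H) (φ : Fm Γ) (σ : Ty) :
    ∃ K : List (Fm (σ :: Γ)), Consistent T K ∧ H.map (Fm.wk σ) ⊆ K ∧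
      (φ.wk σ ∈ K ∨ φ.neg.wk σ ∈ K ∧ ∀ ψ, φ = .all σ ψ → ψ.neg ∈ K) := by
  by_cases h : Consistent T (φ :: H)
  · refine ⟨(φ :: H).map (Fm.wk σ), fun hK => h (.of_wk hK), ?_, .inl (by simp)⟩
    exact List.map_subset _ (List.subset_cons_self _ _)
  · have h' : Consistent T (φ.neg :: H) := fun hK => hH ((Derives.impI (not_not.1 h)).cut hK)
    by_cases hψ : ∃ ψ, φ = .all σ ψ
    · obtain ⟨ψ, rfl⟩ := hψ
      refine ⟨ψ.neg :: ((Fm.all σ ψ).neg :: H).map (Fm.wk σ), fun hK => ?_, fun χ hχ => ?_,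
        .inr ⟨by simp, fun χ hχ => ?_⟩⟩
      · exact h' (.impE (.hyp (List.mem_cons_self ..)) (.allI (.raa hK)))
      · exact List.mem_cons_of_mem _ (List.map_subset _ (List.subset_cons_self _ _) hχ)
      · cases hχ; simp
    · refine ⟨(φ.neg :: H).map (Fm.wk σ), fun hK => h' (.of_wk hK), ?_, .inr ⟨by simp, ?_⟩⟩
      · exact List.map_subset _ (List.subset_cons_self _ _)
      · exact fun ψ h => (hψ ⟨ψ, h⟩).elim

/-- The sequence that has the entry `a` at place `n`, and is continued from there by `up`. -/
def startAt {A : ℕ → Type} (up : ∀ n, A n → A (n + 1)) (d : A 0) {n : ℕ} (a : A n) : ∀ k, A k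
  | 0 => if h : n = 0 then h ▸ a else d
  | k + 1 => if h : n = k + 1 then h ▸ a else up k (startAt up d a k)

theorem startAt_self {A : ℕ → Type} (up : ∀ n, A n → A (n + 1)) (d : A 0) {n : ℕ} (a : A n) :
    startAt up d a n = a := by
  cases n <;> simp [startAt]

theorem startAt_succ {A : ℕ → Type} (up : ∀ n, A n → A (n + 1)) (d : A 0) {n k : ℕ} (a : A n)
    (h : n ≤ k) : startAt up d a (k + 1) = up k (startAt up d a k) := by
  rw [startAt, dif_neg (by omega)]

/-- An enumeration of the types. -/
noncomputable def tyEnum : ℕ → Ty := (exists_surjective_nat Ty).choose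

theorem tyEnum_surjective : Function.Surjective tyEnum := (exists_surjective_nat Ty).choose_spec

/-- The types of the variables that are added one by one: each type occurs infinitely often. -/
noncomputable def chainTy (n : ℕ) : Ty :=
  tyEnum n.unpair.1

/-- The increasing sequence of contexts of the Henkin construction. -/
noncomputable def chain : ℕ → Ctx
  | 0 => []
  | n + 1 => chainTy n :: chain n

/-- A formula in the `n`-th context, seen as a formula in all later contexts. -/
noncomputable def Fm.later {n : ℕ} (φ : Fm (chain n)) : ∀ k, Fm (chain k) :=
  startAt (A := fun k => Fm (chain k)) (fun k ψ => ψ.wk (chainTy k)) .bot φ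

instance : Nonempty (Σ k, Fm (chain k)) := ⟨⟨0, .bot⟩⟩

/-- An enumeration of the formulas in the contexts of the construction. -/
noncomputable def fmEnum : ℕ → Σ k, Fm (chain k) := (exists_surjective_nat _).choose

theorem fmEnum_surjective : Function.Surjective fmEnum := (exists_surjective_nat _).choose_spec

/-- The formula that is decided in the `n`-th step. -/
noncomputable def stepFm (n : ℕ) : Fm (chain n) :=
  Fm.later (fmEnum n.unpair.2.unpair.1).2 n

/-- The formulas `F n` in the contexts `chain n` are eventually weakenings of one another. -/
def Coherent (F : ∀ n, Fm (chain n)) : Prop :=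
  ∀ᶠ n in Filter.atTop, F (n + 1) = (F n).wk (chainTy n)

/-- Every formula is decided at arbitrarily late steps that add a variable of a given type. -/
theorem Coherent.exists_stepFm {F : ∀ n, Fm (chain n)} (hF : Coherent F) (σ : Ty) (N : ℕ) :
    ∃ m ≥ N, chainTy m = σ ∧ stepFm m = F m := by
  obtain ⟨N₀, hN₀⟩ := Filter.eventually_atTop.1 hF
  obtain ⟨i, hi⟩ := tyEnum_surjective σ
  obtain ⟨k, hk⟩ := fmEnum_surjective ⟨max N₀ N, F (max N₀ N)⟩
  have hle : max N₀ N ≤ Nat.pair i (Nat.pair k (max N₀ N)) :=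
    (Nat.right_le_pair k _).trans (Nat.right_le_pair i _)
  refine ⟨Nat.pair i (Nat.pair k (max N₀ N)), (le_max_right _ _).trans hle, ?_, ?_⟩
  · simp [chainTy, hi]
  · have : ∀ m ≥ max N₀ N, Fm.later (F (max N₀ N)) m = F m := by
      intro m hm
      induction m, hm using Nat.le_induction with
      | base => exact startAt_self _ _ _
      | succ m hm ih =>
        rw [hN₀ m ((le_max_left _ _).trans hm), ← ih]
        exact startAt_succ _ _ _ hm
    have hst : ∀ m : ℕ, m.unpair.2.unpair.1 = k → stepFm m = Fm.later (F (max N₀ N)) m := by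
      intro m hm
      rw [stepFm, hm, hk]
    exact (hst _ (by simp)).trans (this _ hle)

/-- The hypotheses accepted up to the `n`-th step. -/
noncomputable def henkin {H : List Sentence} (hH : Consistent T H) :
    ∀ n, {K : List (Fm (chain n)) // Consistent T K}
  | 0 => ⟨H, hH⟩
  | n + 1 => ⟨((henkin hH n).2.step (stepFm n) (chainTy n)).choose,
      ((henkin hH n).2.step (stepFm n) (chainTy n)).choose_spec.1⟩

section

variable {H : List Sentence} (hH : Consistent T H)

theorem henkin_succ (n : ℕ) : (henkin hH n).1.map (Fm.wk (chainTy n)) ⊆ (henkin hH (n + 1)).1 ∧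
    ((stepFm n).wk _ ∈ (henkin hH (n + 1)).1 ∨ (stepFm n).neg.wk _ ∈ (henkin hH (n + 1)).1 ∧
      ∀ ψ, stepFm n = .all (chainTy n) ψ → ψ.neg ∈ (henkin hH (n + 1)).1) :=
  ((henkin hH n).2.step (stepFm n) (chainTy n)).choose_spec.2

/-- The formulas `F n` are eventually derivable. -/
def Holds (F : ∀ n, Fm (chain n)) : Prop :=
  ∀ᶠ n in Filter.atTop, Derives T (henkin hH n).1 (F n)

variable {hH}

theorem Holds.of_derives (hT : T.Closed) {F : ∀ n, Fm (chain n)} {m : ℕ}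
    (hF : ∀ n ≥ m, F (n + 1) = (F n).wk (chainTy n)) (h : Derives T (henkin hH m).1 (F m)) :
    Holds hH F := by
  refine Filter.eventually_atTop.2 ⟨m, fun k hk => ?_⟩
  induction k, hk using Nat.le_induction with
  | base => exact h
  | succ k hk ih =>
    rw [hF k hk]
    exact (ih.wk hT _).mono (henkin_succ hH k).1

theorem Holds.or_neg (hT : T.Closed) {F : ∀ n, Fm (chain n)} (hF : Coherent F) :
    Holds hH F ∨ Holds hH fun n => (F n).neg := by
  obtain ⟨N, hN⟩ := Filter.eventually_atTop.1 hF
  obtain ⟨m, hm, -, he⟩ := hF.exists_stepFm .nat N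
  have hN' : ∀ n ≥ m + 1, F (n + 1) = (F n).wk (chainTy n) :=
    fun n hn => hN n (hm.trans ((Nat.le_succ m).trans hn))
  rcases (henkin_succ hH m).2 with h | h
  · exact .inl (.of_derives hT hN' (by rw [hN m hm, ← he]; exact .hyp h))
  · refine .inr (.of_derives hT (fun _ hn => congrArg Fm.neg (hN' _ hn)) (m := m + 1) ?_)
    rw [hN m hm, ← he]; exact .hyp h.1

theorem Holds.not_neg {F : ∀ n, Fm (chain n)} (h : Holds hH F) :
    ¬ Holds hH fun n => (F n).neg := fun h' => by
  obtain ⟨n, h₁, h₂⟩ := (h.and h').exists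
  exact (henkin hH n).2 (.impE h₂ h₁)

end

/-! ### The term model -/

/-- Objects of the term model: sequences of terms in the contexts `chain n` which are eventually
weakenings of one another. -/
def TermSeq (σ : Ty) : Type :=
  {t : ∀ n, Tm (chain n) σ // ∀ᶠ n in Filter.atTop, t (n + 1) = (t n).wk (chainTy n)}

/-- The term model. -/
noncomputable def termModel {H : List Sentence} (hH : Consistent T H) : Str where
  D := TermSeq
  app f a := ⟨fun n => .app (f.1 n) (a.1 n), by
    filter_upwards [f.2, a.2] with n h₁ h₂
    rw [h₁, h₂]; rfl⟩
  cst c := ⟨fun _ => .cst c, .of_forall fun _ => rfl⟩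
  eq s t := Holds hH fun n => s.1 n =ₕ t.1 n
  lt s t := Holds hH fun n => s.1 n <ₕ t.1 n

/-- The substitution given by an assignment in the term model at place `n`. -/
def Env.sub {Γ : Ctx} (ρ : Env TermSeq Γ) (n : ℕ) : Sub Γ (chain n) := fun σ v => (ρ σ v).1 n

theorem eventually_forall_var {Γ : Ctx} {P : ∀ σ, Var Γ σ → ℕ → Prop}
    (h : ∀ σ v, ∀ᶠ n in Filter.atTop, P σ v n) : ∀ᶠ n in Filter.atTop, ∀ σ v, P σ v n := by
  induction Γ with
  | nil => exact .of_forall fun n σ v => nomatch v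
  | cons τ Γ ih =>
    filter_upwards [h τ .z, ih (P := fun σ v => P σ (.s v)) fun σ v => h σ (.s v)] with n h₁ h₂
    intro σ v
    cases v with
    | z => exact h₁
    | s v => exact h₂ σ v

theorem Env.subst_succ {Γ : Ctx} (ρ : Env TermSeq Γ) (φ : Fm Γ) {n : ℕ}
    (h : ∀ σ v, (ρ σ v).1 (n + 1) = ((ρ σ v).1 n).wk (chainTy n)) :
    φ.subst (ρ.sub (n + 1)) = (φ.subst (ρ.sub n)).wk (chainTy n) := by
  rw [Fm.wk_eq_subst, Fm.subst_subst]
  congr 1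
  funext σ v
  exact (h σ v).trans (Tm.rename_eq_subst _ _)

theorem Env.eventually_succ {Γ : Ctx} (ρ : Env TermSeq Γ) :
    ∀ᶠ n in Filter.atTop, ∀ σ v, (ρ σ v).1 (n + 1) = ((ρ σ v).1 n).wk (chainTy n) :=
  eventually_forall_var fun σ v => (ρ σ v).2

theorem Env.coherent {Γ : Ctx} (ρ : Env TermSeq Γ) (φ : Fm Γ) :
    Coherent fun n => φ.subst (ρ.sub n) := by
  filter_upwards [ρ.eventually_succ] with n hn using ρ.subst_succ φ hn

theorem Env.sub_cons {Γ : Ctx} {σ : Ty} (ρ : Env TermSeq Γ) (x : TermSeq σ) (n : ℕ) :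
    (ρ.cons x).sub n = (ρ.sub n).cons (x.1 n) := by
  funext τ v; cases v <;> rfl

section

variable {H : List Sentence} (hH : Consistent T H)

theorem Tm.eval_termModel {Γ : Ctx} (ρ : Env TermSeq Γ) {σ : Ty} (t : Tm Γ σ) (n : ℕ) :
    (t.eval (termModel hH) ρ).1 n = t.subst (ρ.sub n) := by
  induction t with
  | var v => rfl
  | cst c => rfl
  | app f a hf ha => rw [Tm.subst, ← hf, ← ha]; rfl

theorem Fm.sat_termModel (hT : T.Closed) {Γ : Ctx} (φ : Fm Γ) (ρ : Env TermSeq Γ) :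
    φ.sat (termModel hH) ρ ↔ Holds hH fun n => φ.subst (ρ.sub n) := by
  induction φ with
  | eq s t =>
    change Holds hH _ ↔ _
    simp only [Tm.eval_termModel]; rfl
  | lt s t =>
    change Holds hH _ ↔ _
    simp only [Tm.eval_termModel]; rfl
  | bot =>
    refine iff_of_false id fun h => ?_
    obtain ⟨n, h⟩ := h.exists
    exact (henkin hH n).2 h
  | imp φ ψ hφ hψ =>
    simp only [Fm.sat, hφ, hψ, Fm.subst]
    constructor
    · intro h
      rcases Holds.or_neg hT (ρ.coherent φ) (hH := hH) with h' | h'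
      · exact (h h').mono fun n hn => .impI (hn.mono (List.subset_cons_self _ _))
      · refine h'.mono fun n hn => .impI (.botE (.impE (hn.mono (List.subset_cons_self _ _)) ?_))
        exact .hyp (List.mem_cons_self ..)
    · intro h h'
      filter_upwards [h, h'] with n h₁ h₂ using .impE h₁ h₂
  | @all Γ σ φ ih =>
    simp only [Fm.sat]
    constructor
    · intro h
      by_contra hn
      obtain ⟨N, hN⟩ := Filter.eventually_atTop.1 ρ.eventually_succ
      obtain ⟨m, hm, rfl, he⟩ := (ρ.coherent (Fm.all σ φ)).exists_stepFm σ N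
      have hle : ∀ k ≥ m + 1, N ≤ k := fun k hk => hm.trans ((Nat.le_succ m).trans hk)
      rcases (henkin_succ hH m).2 with h' | ⟨-, h'⟩
      · refine hn (.of_derives hT (m := m + 1) (fun k hk => ρ.subst_succ _ (hN k (hle k hk))) ?_)
        have : (Fm.all (chainTy m) φ).subst (ρ.sub (m + 1)) = (stepFm m).wk _ :=
          (ρ.subst_succ _ (hN m hm)).trans (congrArg _ he.symm)
        exact this ▸ .hyp h'
      · specialize h' _ he
        let t : ∀ k, Tm (chain k) (chainTy m) := startAt (A := fun k => Tm (chain k) (chainTy m))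
          (fun k u => u.wk (chainTy k)) (Tm.default _)
          (n := m + 1) (Tm.var (Γ := chainTy m :: chain m) .z)
        have ht' : ∀ k ≥ m + 1, t (k + 1) = (t k).wk (chainTy k) :=
          fun k hk => startAt_succ _ _ _ hk
        have ht : ∀ᶠ k in Filter.atTop, t (k + 1) = (t k).wk (chainTy k) :=
          Filter.eventually_atTop.2 ⟨m + 1, ht'⟩
        have htm : t (m + 1) = Tm.var (Γ := chainTy m :: chain m) .z := startAt_self _ _ _
        refine ((ih _).1 (h ⟨t, ht⟩)).not_neg (.of_derives hT (m := m + 1) (fun k hk => ?_) ?_)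
        · refine congrArg Fm.neg (Env.subst_succ (ρ.cons ⟨t, ht⟩) φ ?_)
          intro σ v
          cases v with
          | z => exact ht' k hk
          | s v => exact hN k (hle k hk) σ v
        · refine .hyp ?_
          refine Eq.mp (congrArg (· ∈ (henkin hH (m + 1)).1) ?_) h'
          have : (ρ.cons ⟨t, ht⟩).sub (m + 1) = (ρ.sub m).up (chainTy m) := by
            funext σ v
            cases v with
            | z => exact htm
            | s v => exact hN m hm σ v
          exact congrArg (fun s => (φ.subst s).neg) this.symm
    · intro h x
      refine (ih _).2 (h.mono fun n hn => ?_)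
      have := hn.allE (x.1 n)
      rw [Fm.inst_subst_up] at this
      exact (congrArg (fun s => Derives T _ (φ.subst s)) (Env.sub_cons ρ x n)).mpr this

end

/-- The completeness theorem, for countable theories closed under substitution: an underivable
sentence has a countermodel. -/
theorem exists_countermodel (hT : T.Closed) {S : List Sentence} {φ : Sentence}
    (h : ¬ Derives T S φ) :
    ∃ M : Str, M.Models T ∧ (∀ ψ ∈ S, ψ.sat M Env.nil) ∧ ¬ φ.sat M Env.nil := by
  have hH : Consistent T (φ.neg :: S) := fun h' => h (.raa h')
  have hS : ∀ ψ ∈ φ.neg :: S, ψ.sat (termModel hH) Env.nil := by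
    intro ψ hψ
    refine (Fm.sat_termModel hH hT ψ _).2 (.of_derives hT (m := 0) (fun n _ => ?_) (.hyp ?_))
    · exact Env.subst_succ _ _ fun σ v => nomatch v
    · have : ∀ s : Sub [] [], ψ.subst s = ψ := fun s => by
        have : s = fun _ v => .var v := by funext σ v; exact nomatch v
        rw [this, Fm.subst_var]
      exact Eq.mp (congrArg (· ∈ φ.neg :: S) (this _).symm) hψ
  refine ⟨termModel hH, fun Γ ψ hψ ρ => ?_, fun ψ hψ => hS ψ (List.mem_cons_of_mem _ hψ), ?_⟩
  · exact (Fm.sat_termModel hH hT ψ ρ).2 (.of_forall fun n => .ax (hT _ hψ))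
  · exact hS _ (List.mem_cons_self ..)

/-! ### Evaluation and substitution -/

section

variable (M : Str)

theorem Tm.eval_rename {Γ Δ : Ctx} (r : Ren Γ Δ) (ρ : Env M.D Δ) {σ : Ty} (t : Tm Γ σ) :
    (t.rename r).eval M ρ = t.eval M fun σ v => ρ σ (r σ v) := by
  induction t with
  | var v => rfl
  | cst c => rfl
  | app f a hf ha => simp only [Tm.rename, Tm.eval, hf, ha]

@[simp] theorem Tm.eval_wk {Γ : Ctx} {σ τ : Ty} (t : Tm Γ σ) (ρ : Env M.D Γ) (x : M.D τ) :
    (t.wk τ).eval M (ρ.cons x) = t.eval M ρ := Tm.eval_rename M _ _ _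

theorem Tm.eval_subst {Γ Δ : Ctx} (s : Sub Γ Δ) (ρ : Env M.D Δ) {σ : Ty} (t : Tm Γ σ) :
    (t.subst s).eval M ρ = t.eval M fun σ v => (s σ v).eval M ρ := by
  induction t with
  | var v => rfl
  | cst c => rfl
  | app f a hf ha => simp only [Tm.subst, Tm.eval, hf, ha]

theorem Fm.sat_subst {Γ Δ : Ctx} (s : Sub Γ Δ) (ρ : Env M.D Δ) (φ : Fm Γ) :
    (φ.subst s).sat M ρ ↔ φ.sat M fun σ v => (s σ v).eval M ρ := by
  induction φ generalizing Δ with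
  | eq t u => simp only [Fm.subst, Fm.sat, Tm.eval_subst]
  | lt t u => simp only [Fm.subst, Fm.sat, Tm.eval_subst]
  | bot => rfl
  | imp φ ψ hφ hψ => simp only [Fm.subst, Fm.sat, hφ, hψ]
  | all σ φ ih =>
    simp only [Fm.subst, Fm.sat, ih]
    refine forall_congr' fun x => iff_of_eq (congrArg _ ?_)
    funext τ v
    cases v with
    | z => rfl
    | s v => exact Tm.eval_wk M _ _ _

/-! ### The extensional quotient -/

/-- Hereditarily extensional equality, the interpretation of the defined equality. -/
def Str.eqv (M : Str) : (σ : Ty) → M.D σ → M.D σ → Prop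
  | .nat, x, y => M.eq x y
  | .arr σ τ, x, y => ∀ z : M.D σ, Str.eqv M τ (M.app x z) (M.app y z)

theorem Fm.sat_eqTy {Γ : Ctx} (σ : Ty) (s t : Tm Γ σ) (ρ : Env M.D Γ) :
    (Fm.eqTy σ s t).sat M ρ ↔ M.eqv σ (s.eval M ρ) (t.eval M ρ) := by
  induction σ generalizing Γ with
  | nat => rfl
  | arr σ τ _ ih =>
    simp only [Fm.eqTy, Fm.sat, ih, Str.eqv, Tm.eval, Tm.eval_wk]; rfl

end

/-- A structure in which equality at all types is equality of objects. -/
structure Str.Extensional (M : Str) : Prop where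
  eq_iff : ∀ {a b : M.D .nat}, M.eq a b ↔ a = b
  ext : ∀ {σ τ : Ty} {f g : M.D (.arr σ τ)}, (∀ x, M.app f x = M.app g x) → f = g

theorem Str.Extensional.eqv_iff {M : Str} (h : M.Extensional) {σ : Ty} {x y : M.D σ} :
    M.eqv σ x y ↔ x = y := by
  induction σ with
  | nat => exact h.eq_iff
  | arr σ τ _ ih =>
    simp only [Str.eqv, ih]
    exact ⟨h.ext, fun e z => by rw [e]⟩

/-- Every model of the base theory has an extensional quotient satisfying the same sentences. -/
theorem Str.Models.exists_extensional {M : Str} (h : M.Models RCA0w) :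
    ∃ N : Str, N.Extensional ∧ (∀ T : Theory, M.Models T → N.Models T) ∧
      ∀ φ : Sentence, φ.sat N Env.nil ↔ φ.sat M Env.nil := by
  have hrefl : ∀ σ x, M.eqv σ x x := by
    intro σ
    induction σ with
    | nat => exact fun x => h [.nat] _ (.eq_refl (.var .z)) (Env.nil.cons x)
    | arr σ τ _ ih => exact fun x z => ih _
  have hsymm : ∀ σ x y, M.eqv σ x y → M.eqv σ y x := by
    intro σ
    induction σ with
    | nat =>
      exact fun x y => h [.nat, .nat] _ (.eq_symm (.var .z) (.var (.s .z)))
        ((Env.nil.cons y).cons x)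
    | arr σ τ _ ih => exact fun x y hxy z => ih _ _ (hxy z)
  have htrans : ∀ σ x y z, M.eqv σ x y → M.eqv σ y z → M.eqv σ x z := by
    intro σ
    induction σ with
    | nat =>
      exact fun x y z => h [.nat, .nat, .nat] _
        (.eq_trans (.var .z) (.var (.s .z)) (.var (.s (.s .z))))
        (((Env.nil.cons z).cons y).cons x)
    | arr σ τ _ ih => exact fun x y z hxy hyz w => ih _ _ _ (hxy w) (hyz w)
  have hext : ∀ {σ τ} (f : M.D (.arr σ τ)) (x y : M.D σ), M.eqv σ x y →
      M.eqv τ (M.app f x) (M.app f y) := by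
    intro σ τ f x y hxy
    have := h [σ, σ, .arr σ τ] _ (.ext (.var .z) (.var (.s .z)) (.var (.s (.s .z))))
      (((Env.nil.cons f).cons y).cons x)
    simp only [Fm.sat, Fm.sat_eqTy] at this
    exact this hxy
  have hlt : ∀ {a b c d : M.D .nat}, M.eq a b → M.eq c d → M.lt a c → M.lt b d := by
    intro a b c d
    exact h [.nat, .nat, .nat, .nat] _
      (.lt_congr (.var .z) (.var (.s .z)) (.var (.s (.s .z))) (.var (.s (.s (.s .z)))))
      ((((Env.nil.cons d).cons c).cons b).cons a)
  let S : ∀ σ, Setoid (M.D σ) := fun σ =>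
    ⟨M.eqv σ, hrefl σ, fun {x y} => hsymm σ x y, fun {x y z} => htrans σ x y z⟩
  let N : Str :=
    { D := fun σ => Quotient (S σ)
      app := fun {σ τ} => Quotient.map₂ M.app fun f g hfg x y hxy =>
        htrans τ _ _ _ (hfg x) (hext g x y hxy)
      cst := fun c => Quotient.mk _ (M.cst c)
      eq := fun a b => a = b
      lt := Quotient.lift₂ M.lt fun a b c d hac hbd =>
        propext ⟨hlt hac hbd, hlt (hsymm .nat _ _ hac) (hsymm .nat _ _ hbd)⟩ }
  have heval : ∀ {Γ : Ctx} (ρ : Env M.D Γ) {σ : Ty} (t : Tm Γ σ),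
      t.eval N (fun σ v => Quotient.mk (S σ) (ρ σ v)) = Quotient.mk (S σ) (t.eval M ρ) := by
    intro Γ ρ σ t
    induction t with
    | var v => rfl
    | cst c => rfl
    | app f a hf ha => simp only [Tm.eval, hf, ha]; rfl
  have hsat : ∀ {Γ : Ctx} (φ : Fm Γ) (ρ : Env M.D Γ),
      φ.sat N (fun σ v => Quotient.mk (S σ) (ρ σ v)) ↔ φ.sat M ρ := by
    intro Γ φ
    induction φ with
    | eq s t => intro ρ; simp only [Fm.sat, heval]; exact Quotient.eq (r := S .nat)
    | lt s t => intro ρ; simp only [Fm.sat, heval]; rfl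
    | bot => intro ρ; rfl
    | imp φ ψ hφ hψ => intro ρ; simp only [Fm.sat, hφ, hψ]
    | @all Γ σ φ ih =>
      intro ρ
      have hcons : ∀ x : M.D σ, (Env.cons (Quotient.mk (S σ) x) fun σ v => Quotient.mk (S σ) (ρ σ v) :
          Env N.D (σ :: Γ)) = fun τ v => Quotient.mk (S τ) (ρ.cons x τ v) := by
        intro x; funext τ v; cases v <;> rfl
      constructor
      · intro hx x
        have := hx (Quotient.mk _ x)
        rwa [hcons, ih] at this
      · intro hx x
        induction x using Quotient.inductionOn with
        | h x => rw [hcons, ih]; exact hx x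
  refine ⟨N, ⟨Iff.rfl, ?_⟩, ?_, ?_⟩
  · intro σ τ f g
    induction f using Quotient.inductionOn with
    | h f =>
      induction g using Quotient.inductionOn with
      | h g => exact fun hfg => Quotient.sound fun x => Quotient.exact (hfg (Quotient.mk _ x))
  · intro T hT Γ φ hφ ρ
    have : ρ = fun σ v => Quotient.mk (S σ) (ρ σ v).out := by
      funext σ v; exact (Quotient.out_eq _).symm
    rw [this, hsat]
    exact hT Γ φ hφ _
  · intro φ
    rw [← hsat]
    refine iff_of_eq (congrArg _ ?_)
    funext σ v; exact nomatch v

/-! ### The theories are closed under substitution -/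

theorem Fm.eqTy_subst {Γ Δ : Ctx} (s : Sub Γ Δ) (σ : Ty) (t u : Tm Γ σ) :
    (Fm.eqTy σ t u).subst s = Fm.eqTy σ (t.subst s) (u.subst s) := by
  induction σ generalizing Γ Δ with
  | nat => rfl
  | arr σ τ _ ih => simp only [Fm.eqTy, Fm.subst, ih, Tm.subst, Tm.wk_subst_up]; rfl

theorem Fm.QF.subst {Γ Δ : Ctx} (s : Sub Γ Δ) {φ : Fm Γ} (h : φ.QF) : (φ.subst s).QF := by
  induction φ generalizing Δ with
  | imp φ ψ hφ hψ => exact ⟨hφ s h.1, hψ s h.2⟩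
  | all σ φ _ => exact h.elim
  | _ => exact h

theorem Fm.indAx_subst {Γ Δ : Ctx} (s : Sub Γ Δ) (A : Fm (.nat :: Γ)) :
    A.indAx.subst s = (A.subst (s.up .nat)).indAx := by
  have h : (A.subst Sub.succ).subst (s.up .nat) = (A.subst (s.up .nat)).subst Sub.succ := by
    simp only [Fm.subst_subst]
    congr 1
    funext τ v
    cases v with
    | z => rfl
    | s v =>
      change (s τ v).wk .nat = ((s τ v).wk .nat).subst Sub.succ
      simp only [Tm.wk, Tm.rename_eq_subst, Tm.subst_subst]
      rfl
  simp only [Fm.indAx, Fm.subst, Fm.and, Fm.neg, Fm.inst_subst, h]; rfl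

theorem Fm.choiceAx_subst {Γ Δ : Ctx} (s : Sub Γ Δ) {σ τ : Ty} (A : Fm (τ :: σ :: Γ)) :
    A.choiceAx.subst s = (A.subst ((s.up σ).up τ)).choiceAx := by
  have h : (A.subst Sub.choice).subst ((s.up (.arr σ τ)).up σ)
      = (A.subst ((s.up σ).up τ)).subst Sub.choice := by
    simp only [Fm.subst_subst]
    congr 1
    funext τ v
    rcases v with _ | _ | v
    · rfl
    · rfl
    · simp only [Sub.up, Sub.choice, Tm.subst, Tm.wk, Tm.rename_eq_subst, Tm.subst_subst]
  simp only [Fm.choiceAx, Fm.subst, Fm.ex, Fm.neg, h]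

theorem RCA0w_closed : RCA0w.Closed := by
  intro Γ Δ s φ h
  change RCA0wAx φ at h
  change RCA0wAx (φ.subst s)
  cases h with
  | pi x y => rw [Fm.eqTy_subst]; exact .pi _ _
  | sig x y w => rw [Fm.eqTy_subst]; exact .sig _ _ _
  | ext x y f =>
    simp only [Fm.subst, Fm.eqTy_subst]; exact .ext _ _ _
  | ind A hA => rw [Fm.indAx_subst]; exact .ind _ (hA.subst _)
  | qfac A hA => rw [Fm.choiceAx_subst]; exact .qfac _ (hA.subst _)
  | eq_refl => exact .eq_refl _
  | eq_symm => exact .eq_symm _ _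
  | eq_trans => exact .eq_trans _ _ _
  | lt_congr => exact .lt_congr _ _ _ _
  | add_assoc => exact .add_assoc _ _ _
  | add_comm => exact .add_comm _ _
  | add_zero => exact .add_zero _
  | mul_assoc => exact .mul_assoc _ _ _
  | mul_comm => exact .mul_comm _ _
  | mul_one => exact .mul_one _
  | mul_zero => exact .mul_zero _
  | mul_add => exact .mul_add _ _ _
  | lt_irrefl => exact .lt_irrefl _
  | lt_trans => exact .lt_trans _ _ _
  | lt_total => exact .lt_total _ _
  | add_lt_add => exact .add_lt_add _ _ _
  | mul_lt_mul => exact .mul_lt_mul _ _ _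
  | not_lt_zero => exact .not_lt_zero _
  | lt_succ => exact .lt_succ _ _
  | rec_zero => exact .rec_zero _ _
  | rec_succ => exact .rec_succ _ _ _

theorem QFAC_closed (σ τ : Ty) : (QFAC σ τ).Closed := by
  rintro Γ Δ s _ ⟨A, hA, rfl⟩
  exact ⟨_, hA.subst _, Fm.choiceAx_subst s A⟩

theorem Theory.Closed.sup {T U : Theory} (hT : T.Closed) (hU : U.Closed) : (T ⊔ U).Closed := by
  intro Γ Δ s φ h
  rcases h with h | h
  · exact .inl (hT s h)
  · exact .inr (hU s h)

/-- To derive a sentence it suffices to verify it in all extensional models. -/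
theorem derives_of_sat {T : Theory} (hT : T.Closed) (hR : RCA0w ≤ T) {S : List Sentence}
    {φ : Sentence}
    (h : ∀ M : Str, M.Extensional → M.Models T → (∀ ψ ∈ S, ψ.sat M Env.nil) → φ.sat M Env.nil) :
    Derives T S φ := by
  by_contra hd
  obtain ⟨M, hM, hS, hφ⟩ := exists_countermodel hT hd
  obtain ⟨N, hN, hNT, hsat⟩ :=
    Str.Models.exists_extensional fun Γ ψ hψ => hM Γ ψ (hR Γ hψ)
  exact hφ ((hsat φ).1 (h N hN (hNT T hM) fun ψ hψ => (hsat ψ).2 (hS ψ hψ)))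

/-! ### Satisfaction of the defined connectives -/

section

variable (M : Str) {Γ : Ctx} (ρ : Env M.D Γ)

@[simp] theorem Fm.sat_neg (φ : Fm Γ) : φ.neg.sat M ρ ↔ ¬ φ.sat M ρ := Iff.rfl

@[simp] theorem Fm.sat_imp (φ ψ : Fm Γ) : (φ ⟹ₕ ψ).sat M ρ ↔ (φ.sat M ρ → ψ.sat M ρ) := Iff.rfl

@[simp] theorem Fm.sat_bot : (Fm.bot : Fm Γ).sat M ρ ↔ False := Iff.rfl

@[simp] theorem Fm.sat_lt (s t : Tm Γ .nat) :
    (s <ₕ t).sat M ρ ↔ M.lt (s.eval M ρ) (t.eval M ρ) := Iff.rfl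

@[simp] theorem Fm.sat_and (φ ψ : Fm Γ) : (φ ⋏ₕ ψ).sat M ρ ↔ φ.sat M ρ ∧ ψ.sat M ρ := by
  simp only [Fm.and, Fm.sat_neg, Fm.sat_imp]; tauto

@[simp] theorem Fm.sat_or (φ ψ : Fm Γ) : (φ ⋎ₕ ψ).sat M ρ ↔ φ.sat M ρ ∨ ψ.sat M ρ := by
  simp only [Fm.or, Fm.sat_neg, Fm.sat_imp]; tauto

@[simp] theorem Fm.sat_iff (φ ψ : Fm Γ) : (φ ⟺ₕ ψ).sat M ρ ↔ (φ.sat M ρ ↔ ψ.sat M ρ) := by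
  simp only [Fm.iff, Fm.sat_and, Fm.sat_imp]; tauto

@[simp] theorem Fm.sat_all (σ : Ty) (φ : Fm (σ :: Γ)) :
    (Fm.all σ φ).sat M ρ ↔ ∀ x, φ.sat M (ρ.cons x) := Iff.rfl

@[simp] theorem Fm.sat_ex (σ : Ty) (φ : Fm (σ :: Γ)) :
    (Fm.ex σ φ).sat M ρ ↔ ∃ x, φ.sat M (ρ.cons x) := by
  simp only [Fm.ex, Fm.sat_neg, Fm.sat_all, not_forall, not_not]

@[simp] theorem Fm.sat_All (σ : Ty) (f : Tm (σ :: Γ) σ → Fm (σ :: Γ)) :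
    (Fm.All σ f).sat M ρ ↔ ∀ x, (f (.var .z)).sat M (ρ.cons x) := Iff.rfl

@[simp] theorem Fm.sat_Ex (σ : Ty) (f : Tm (σ :: Γ) σ → Fm (σ :: Γ)) :
    (Fm.Ex σ f).sat M ρ ↔ ∃ x, (f (.var .z)).sat M (ρ.cons x) := Fm.sat_ex ..

@[simp] theorem Tm.eval_app {σ τ : Ty} (f : Tm Γ (.arr σ τ)) (a : Tm Γ σ) :
    (Tm.app f a).eval M ρ = M.app (f.eval M ρ) (a.eval M ρ) := rfl

@[simp] theorem Tm.eval_cst {σ : Ty} (c : Cst σ) :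
    (Tm.cst c : Tm Γ σ).eval M ρ = M.cst c := rfl

@[simp] theorem Tm.eval_var_z {σ : Ty} (x : M.D σ) :
    (Tm.var .z : Tm (σ :: Γ) σ).eval M (ρ.cons x) = x := rfl

@[simp] theorem Tm.eval_var_s {σ τ : Ty} (v : Var Γ τ) (x : M.D σ) :
    (Tm.var (.s v) : Tm (σ :: Γ) τ).eval M (ρ.cons x) = (Tm.var v).eval M ρ := rfl

end

section

/-! ### Arithmetic in a model -/

/-- Extensional models of the base theory. -/
class Str.IsModel (M : Str) : Prop where
  ext : M.Extensional
  models : M.Models RCA0w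

variable {M : Str}

instance {σ τ : Ty} : CoeFun (M.D (.arr σ τ)) fun _ => M.D σ → M.D τ := ⟨M.app⟩

instance : Zero (M.D .nat) := ⟨M.cst .zero⟩
instance : One (M.D .nat) := ⟨M.cst .one⟩
instance : Add (M.D .nat) := ⟨fun a b => M.cst .add a b⟩
instance : Mul (M.D .nat) := ⟨fun a b => M.cst .mul a b⟩

section

variable {Γ : Ctx} (ρ : Env M.D Γ)

@[simp] theorem Tm.eval_zero : (Tm.zero : Tm Γ .nat).eval M ρ = 0 := rfl
@[simp] theorem Tm.eval_one : (Tm.one : Tm Γ .nat).eval M ρ = 1 := rfl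
@[simp] theorem Tm.eval_add (s t : Tm Γ .nat) :
    (s +ₕ t).eval M ρ = s.eval M ρ + t.eval M ρ := rfl
@[simp] theorem Tm.eval_mul (s t : Tm Γ .nat) :
    (s *ₕ t).eval M ρ = s.eval M ρ * t.eval M ρ := rfl

end

variable [hM : M.IsModel]

@[simp] theorem Fm.sat_eq {Γ : Ctx} (s t : Tm Γ .nat) (ρ : Env M.D Γ) :
    (s =ₕ t).sat M ρ ↔ s.eval M ρ = t.eval M ρ := hM.ext.eq_iff

theorem RCA0wAx.sat {Γ : Ctx} {φ : Fm Γ} (h : RCA0wAx φ) (ρ : Env M.D Γ) : φ.sat M ρ :=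
  hM.models Γ φ h ρ

theorem Str.funext {σ τ : Ty} {f g : M.D (.arr σ τ)} (h : ∀ x, f x = g x) : f = g := hM.ext.ext h

theorem Str.pi_app {σ τ : Ty} (x : M.D σ) (y : M.D τ) : (M.cst (.pi σ τ)) x y = x := by
  have := (RCA0wAx.pi (.var .z) (.var (.s .z))).sat ((Env.nil.cons y).cons x)
  rwa [Fm.sat_eqTy, hM.ext.eqv_iff] at this

theorem Str.sig_app {ρ σ τ : Ty} (x : M.D (.arr ρ (.arr σ τ))) (y : M.D (.arr ρ σ))
    (w : M.D ρ) : (M.cst (.sig ρ σ τ)) x y w = x w (y w) := by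
  have := (RCA0wAx.sig (.var .z) (.var (.s .z)) (.var (.s (.s .z)))).sat
    (((Env.nil.cons w).cons y).cons x)
  rwa [Fm.sat_eqTy, hM.ext.eqv_iff] at this

/-- The combinatory interpretation of `λ`-abstraction is correct. -/
@[simp] theorem Tm.eval_lam {Γ : Ctx} {σ τ : Ty} (t : Tm (σ :: Γ) τ) (ρ : Env M.D Γ) (x : M.D σ) :
    M.app (t.lam.eval M ρ) x = t.eval M (ρ.cons x) := by
  induction t using Tm.lam.induct with
  | case1 => exact (Str.sig_app _ _ _).trans (Str.pi_app _ _)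
  | case2 => exact Str.pi_app _ _
  | case3 => exact Str.pi_app _ _
  | case4 =>
    rename_i f a hf ha
    change (M.cst (.sig _ _ _)) (f.lam.eval M ρ) (a.lam.eval M ρ) x = _
    rw [Str.sig_app, hf, ha]; rfl

@[simp] theorem Tm.eval_Lam {Γ : Ctx} {σ τ : Ty} (f : Tm (σ :: Γ) σ → Tm (σ :: Γ) τ)
    (ρ : Env M.D Γ) (x : M.D σ) :
    M.app ((Tm.Lam σ f).eval M ρ) x = (f (.var .z)).eval M (ρ.cons x) := Tm.eval_lam _ _ _

@[simp] theorem Tm.eval_const {Γ : Ctx} {σ τ : Ty} (t : Tm Γ σ) (ρ : Env M.D Γ) (x : M.D τ) :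
    M.app ((Tm.const τ t).eval M ρ) x = t.eval M ρ := Str.pi_app _ _

/-- The assignment of four values. -/
abbrev env4 {σ : Ty} (a b c d : M.D σ) : Env M.D [σ, σ, σ, σ] :=
  (((Env.nil.cons d).cons c).cons b).cons a

/-- Variables for stating instances of the axioms. -/
abbrev v₀ {Γ : Ctx} {σ : Ty} : Tm (σ :: Γ) σ := .var .z
abbrev v₁ {Γ : Ctx} {σ τ : Ty} : Tm (τ :: σ :: Γ) σ := .var (.s .z)
abbrev v₂ {Γ : Ctx} {σ τ υ : Ty} : Tm (τ :: υ :: σ :: Γ) σ := .var (.s (.s .z))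

instance : CommSemiring (M.D .nat) :=
  have hadd_comm : ∀ a b : M.D .nat, a + b = b + a := fun a b => by
    simpa using (RCA0wAx.add_comm v₀ v₁).sat (env4 a b 0 0)
  have hmul_comm : ∀ a b : M.D .nat, a * b = b * a := fun a b => by
    simpa using (RCA0wAx.mul_comm v₀ v₁).sat (env4 a b 0 0)
  have hadd_zero : ∀ a : M.D .nat, a + 0 = a := fun a => by
    simpa using (RCA0wAx.add_zero v₀).sat (env4 a 0 0 0)
  have hmul_one : ∀ a : M.D .nat, a * 1 = a := fun a => by
    simpa using (RCA0wAx.mul_one v₀).sat (env4 a 0 0 0)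
  have hmul_zero : ∀ a : M.D .nat, a * 0 = 0 := fun a => by
    simpa using (RCA0wAx.mul_zero v₀).sat (env4 a 0 0 0)
  have hmul_add : ∀ a b c : M.D .nat, a * (b + c) = a * b + a * c := fun a b c => by
    simpa using (RCA0wAx.mul_add v₀ v₁ v₂).sat (env4 a b c 0)
  { add_assoc := fun a b c => by
      simpa using (RCA0wAx.add_assoc v₀ v₁ v₂).sat (env4 a b c 0)
    add_comm := hadd_comm
    add_zero := hadd_zero
    zero_add := fun a => by rw [hadd_comm, hadd_zero]
    mul_assoc := fun a b c => by
      simpa using (RCA0wAx.mul_assoc v₀ v₁ v₂).sat (env4 a b c 0)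
    mul_comm := hmul_comm
    mul_one := hmul_one
    one_mul := fun a => by rw [hmul_comm, hmul_one]
    mul_zero := hmul_zero
    zero_mul := fun a => by rw [hmul_comm, hmul_zero]
    left_distrib := hmul_add
    right_distrib := fun a b c => by rw [hmul_comm, hmul_add, hmul_comm c a, hmul_comm c b]
    nsmul := nsmulRec }

open Classical in
noncomputable instance : LinearOrder (M.D .nat) :=
  have hirrefl : ∀ a : M.D .nat, ¬ M.lt a a := fun a => by
    simpa using (RCA0wAx.lt_irrefl v₀).sat (env4 a 0 0 0)
  have htrans : ∀ a b c : M.D .nat, M.lt a b → M.lt b c → M.lt a c := fun a b c => by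
    simpa using (RCA0wAx.lt_trans v₀ v₁ v₂).sat (env4 a b c 0)
  have htotal : ∀ a b : M.D .nat, M.lt a b ∨ a = b ∨ M.lt b a := fun a b => by
    simpa using (RCA0wAx.lt_total v₀ v₁).sat (env4 a b 0 0)
  { le := fun a b => M.lt a b ∨ a = b
    lt := M.lt
    le_refl := fun a => .inr rfl
    le_trans := by
      rintro a b c (h | rfl) (h' | rfl)
      exacts [.inl (htrans _ _ _ h h'), .inl h, .inl h', .inr rfl]
    lt_iff_le_not_ge := by
      intro a b
      constructor
      · refine fun h => ⟨.inl h, ?_⟩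
        rintro (h' | rfl)
        exacts [hirrefl _ (htrans _ _ _ h h'), hirrefl _ h]
      · rintro ⟨h | rfl, h'⟩
        exacts [h, (h' (.inr rfl)).elim]
    le_antisymm := by
      rintro a b (h | rfl) (h' | h')
      exacts [(hirrefl _ (htrans _ _ _ h h')).elim, h'.symm, rfl, rfl]
    le_total := fun a b => by
      rcases htotal a b with h | rfl | h
      exacts [.inl (.inl h), .inl (.inr rfl), .inr (.inl h)]
    toDecidableLE := Classical.decRel _ }

@[simp] theorem Str.lt_def {a b : M.D .nat} : M.lt a b ↔ a < b := Iff.rfl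

theorem Str.lt_add_one_iff {a b : M.D .nat} : a < b + 1 ↔ a ≤ b := by
  rw [le_iff_lt_or_eq]
  simpa using (RCA0wAx.lt_succ v₀ v₁).sat (env4 a b 0 0)

theorem Str.not_lt_zero (a : M.D .nat) : ¬ a < 0 := by
  simpa using (RCA0wAx.not_lt_zero v₀).sat (env4 a 0 0 0)

theorem Str.zero_le (a : M.D .nat) : 0 ≤ a := not_lt.1 (Str.not_lt_zero a)

instance : IsStrictOrderedRing (M.D .nat) :=
  have hadd : ∀ a b c : M.D .nat, a < b → a + c < b + c := fun a b c => by
    simpa using (RCA0wAx.add_lt_add v₀ v₁ v₂).sat (env4 a b c 0)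
  have hmul : ∀ a b c : M.D .nat, 0 < c → a < b → a * c < b * c := fun a b c => by
    simpa using (RCA0wAx.mul_lt_mul v₀ v₁ v₂).sat (env4 a b c 0)
  have hadd' : ∀ a b : M.D .nat, a ≤ b → ∀ c, a + c ≤ b + c := fun a b h c =>
    h.lt_or_eq.elim (fun h => (hadd a b c h).le) fun h => by rw [h]
  have h01 : (0 : M.D .nat) < 1 := by
    have : (0 : M.D .nat) < 0 + 1 := Str.lt_add_one_iff.2 le_rfl
    rwa [zero_add] at this
  { add_le_add_left := hadd'
    add_le_add_right := fun a b h c => by rw [add_comm c, add_comm c]; exact hadd' a b h c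
    le_of_add_le_add_left := fun a b c h => by
      by_contra hn
      have := hadd c b a (not_le.1 hn)
      rw [add_comm c, add_comm b] at this
      exact (this.trans_le h).false
    le_of_add_le_add_right := fun a b c h => by
      by_contra hn
      exact ((hadd c b a (not_le.1 hn)).trans_le h).false
    zero_le_one := h01.le
    exists_pair_ne := ⟨0, 1, h01.ne⟩
    mul_lt_mul_of_pos_left := fun a ha b c h => by
      rw [mul_comm a, mul_comm a]; exact hmul b c a ha h
    mul_lt_mul_of_pos_right := fun a ha b c h => hmul b c a ha h }

end

section

variable {M : Str}

/-! ### Primitive recursion and truncated subtraction -/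

section

variable [hM : M.IsModel]

theorem Str.rec_zero (f : M.D (.arr .nat .one)) (m : M.D .nat) :
    (M.cst (.recursor .nat)) f m 0 = m := by
  simpa [Tm.rec0] using (RCA0wAx.rec_zero v₀ v₁).sat ((Env.nil.cons m).cons f)

theorem Str.rec_succ (f : M.D (.arr .nat .one)) (m n : M.D .nat) :
    (M.cst (.recursor .nat)) f m (n + 1) = f n ((M.cst (.recursor .nat)) f m n) := by
  simpa [Tm.rec0] using (RCA0wAx.rec_succ v₀ v₁ v₂).sat (((Env.nil.cons n).cons m).cons f)

/-- Quantifier-free induction, for formulas. -/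
theorem Str.fmInduction {Γ : Ctx} {A : Fm (.nat :: Γ)} (hA : A.QF) (ρ : Env M.D Γ)
    (h0 : A.sat M (ρ.cons 0)) (hs : ∀ n, A.sat M (ρ.cons n) → A.sat M (ρ.cons (n + 1)))
    (n : M.D .nat) : A.sat M (ρ.cons n) := by
  have h := (RCA0wAx.ind A hA).sat ρ
  simp only [Fm.indAx, Fm.sat_imp, Fm.sat_and, Fm.sat_all, Fm.inst, Fm.sat_subst] at h
  have e0 : (fun σ v => (Sub.one Tm.zero σ v).eval M ρ) = ρ.cons (0 : M.D .nat) := by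
    funext σ v; cases v <;> rfl
  have es : ∀ n : M.D .nat, (fun σ v => (Sub.succ σ v).eval M (ρ.cons n)) = ρ.cons (n + 1) := by
    intro n; funext σ v; cases v <;> rfl
  rw [e0] at h
  simp only [es] at h
  exact h ⟨h0, hs⟩ n

/-- The predecessor function. -/
def Str.predElt (M : Str) : M.D .one :=
  (M.cst (.recursor .nat)) (M.cst (.pi .nat .nat)) (M.cst .zero)

theorem Str.predElt_zero : M.predElt 0 = 0 := Str.rec_zero _ _

theorem Str.predElt_succ (n : M.D .nat) : M.predElt (n + 1) = n :=
  (Str.rec_succ _ _ _).trans (Str.pi_app _ _)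

/-- Truncated subtraction from a fixed number, as a function. -/
def Str.subElt (M : Str) (a : M.D .nat) : M.D .one :=
  (M.cst (.recursor .nat)) ((M.cst (.pi .one .nat)) M.predElt) a

/-- Truncated subtraction. -/
instance : _root_.Sub (M.D .nat) := ⟨fun a b => M.subElt a b⟩

theorem Str.sub_zero' (a : M.D .nat) : a - 0 = a := Str.rec_zero _ _

theorem Str.sub_succ' (a b : M.D .nat) : a - (b + 1) = M.predElt (a - b) := by
  have := Str.rec_succ ((M.cst (.pi .one .nat)) M.predElt) a b
  rwa [Str.pi_app] at this

theorem Str.pred_spec (n : M.D .nat) : n = 0 ∨ M.predElt n + 1 = n := by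
  have := Str.fmInduction (M := M) (Γ := [.one])
    (A := (v₀ =ₕ .zero) ⋎ₕ (Tm.app v₁ v₀ +ₕ .one =ₕ v₀)) ⟨⟨trivial, trivial⟩, trivial⟩
    (Env.nil.cons M.predElt) (by simp) (fun n _ => by simp [Str.predElt_succ]) n
  simpa using this

theorem Str.sub_spec (a b : M.D .nat) : a ≤ b ∧ a - b = 0 ∨ b ≤ a ∧ a - b + b = a := by
  have := Str.fmInduction (M := M) (Γ := [.nat, .one])
    (A := ((v₀ <ₕ v₁).neg ⋏ₕ (Tm.app v₂ v₀ =ₕ .zero)) ⋎ₕ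
      ((v₁ <ₕ v₀).neg ⋏ₕ (Tm.app v₂ v₀ +ₕ v₀ =ₕ v₁)))
    (by simp [Fm.or, Fm.and, Fm.neg, Fm.QF])
    ((Env.nil.cons (M.subElt a)).cons a) ?_ ?_ b
  · simp only [Fm.sat_or, Fm.sat_and, Fm.sat_neg, Fm.sat_lt, Fm.sat_eq, Tm.eval_app, Tm.eval_var_z,
      Tm.eval_var_s, Tm.eval_zero, Tm.eval_add, Str.lt_def, not_lt] at this
    exact this
  · have h : M.subElt a 0 = a := Str.sub_zero' a
    simp [h, Str.zero_le]
  · intro n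
    have h : M.subElt a (n + 1) = M.predElt (M.subElt a n) := Str.sub_succ' a n
    simp only [Fm.sat_or, Fm.sat_and, Fm.sat_neg, Fm.sat_lt, Fm.sat_eq, Tm.eval_app, Tm.eval_var_z,
      Tm.eval_var_s, Tm.eval_zero, Tm.eval_add, Str.lt_def, not_lt, h]
    rintro (⟨h₁, h₂⟩ | ⟨h₁, h₂⟩)
    · rw [h₂, Str.predElt_zero]
      exact .inl ⟨h₁.trans (le_add_of_nonneg_right (Str.zero_le 1)), rfl⟩
    · rcases Str.pred_spec (M.subElt a n) with h' | h'
      · rw [h', zero_add] at h₂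
        rw [h', Str.predElt_zero, ← h₂]
        exact .inl ⟨le_add_of_nonneg_right (Str.zero_le 1), rfl⟩
      · have e : M.predElt (M.subElt a n) + (n + 1) = a := by
          rw [add_comm n 1, ← add_assoc, h', h₂]
        exact .inr ⟨e ▸ le_add_of_nonneg_left (Str.zero_le _), e⟩

instance : CanonicallyOrderedAdd (M.D .nat) where
  exists_add_of_le {a b} h := by
    rcases Str.sub_spec b a with h' | h'
    · exact ⟨0, by rw [add_zero]; exact h'.1.antisymm h⟩
    · exact ⟨b - a, by rw [add_comm]; exact h'.2.symm⟩
  le_add_self a b := le_add_of_nonneg_left (Str.zero_le b)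
  le_self_add a b := le_add_of_nonneg_right (Str.zero_le b)

instance : OrderedSub (M.D .nat) where
  tsub_le_iff_right a b c := by
    rcases Str.sub_spec a b with h | h
    · have := Str.zero_le c
      grind
    · grind

theorem Str.add_one_le_iff {a b : M.D .nat} : a + 1 ≤ b ↔ a < b := by
  rw [← not_lt, Str.lt_add_one_iff, not_le]

theorem Str.lt_one_iff {a : M.D .nat} : a < 1 ↔ a = 0 := by
  rw [← zero_add (1 : M.D .nat), Str.lt_add_one_iff, nonpos_iff_eq_zero]

end

/-! ### Definable maps -/

/-- Maps from assignments to objects that are given by terms with parameters. -/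
inductive Plot (M : Str) : {Γ : Ctx} → {τ : Ty} → (Env M.D Γ → M.D τ) → Prop
  | var {Γ : Ctx} {τ : Ty} (v : Var Γ τ) : Plot M fun ρ => ρ τ v
  | const {Γ : Ctx} {τ : Ty} (d : M.D τ) : Plot M fun _ : Env M.D Γ => d
  | app {Γ : Ctx} {σ τ : Ty} {f : Env M.D Γ → M.D (.arr σ τ)} {a : Env M.D Γ → M.D σ} :
      Plot M f → Plot M a → Plot M fun ρ => M.app (f ρ) (a ρ)

theorem Plot.wk {Γ : Ctx} {τ : Ty} {f : Env M.D Γ → M.D τ} (hf : Plot M f) (σ : Ty) :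
    Plot M fun ρ : Env M.D (σ :: Γ) => f fun τ v => ρ τ (.s v) := by
  induction hf with
  | var v => exact .var _
  | const d => exact .const d
  | app _ _ hf ha => exact .app hf ha

theorem Plot.exists_lam_of_eq [hM : M.IsModel] {Δ : Ctx} {τ : Ty} {f : Env M.D Δ → M.D τ}
    (hf : Plot M f) : ∀ {Γ : Ctx} {σ : Ty} (e : σ :: Γ = Δ),
      ∃ g : Env M.D Γ → M.D (.arr σ τ), Plot M g ∧ ∀ ρ x, g ρ x = f (e ▸ ρ.cons x) := by
  induction hf with
  | @var τ v =>
    rintro Γ σ rfl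
    cases v with
    | z =>
      exact ⟨_, .app (.app (.const (M.cst (.sig τ (.arr τ τ) τ))) (.const (M.cst (.pi _ _))))
        (.const (M.cst (.pi _ _))), fun ρ x => (Str.sig_app _ _ _).trans (Str.pi_app _ _)⟩
    | s v => exact ⟨_, .app (.const (M.cst (.pi _ _))) (.var v), fun ρ x => Str.pi_app _ _⟩
  | const d =>
    rintro Γ σ rfl
    exact ⟨_, .app (.const (M.cst (.pi _ _))) (.const d), fun ρ x => Str.pi_app _ _⟩
  | app _ _ hf ha =>
    rintro Γ σ rfl
    obtain ⟨f, hf, hf'⟩ := hf rfl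
    obtain ⟨a, ha, ha'⟩ := ha rfl
    exact ⟨_, .app (.app (.const (M.cst (.sig _ _ _))) hf) ha, fun ρ x => by
      rw [Str.sig_app, hf', ha']⟩

theorem Plot.exists_lam [hM : M.IsModel] {Γ : Ctx} {σ τ : Ty} {f : Env M.D (σ :: Γ) → M.D τ}
    (hf : Plot M f) :
    ∃ g : Env M.D Γ → M.D (.arr σ τ), Plot M g ∧ ∀ ρ x, g ρ x = f (ρ.cons x) :=
  hf.exists_lam_of_eq rfl

/-- A type of mathematical objects which are represented in the model: the structure consists of
the maps from assignments that count as definable. -/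
class Obj (M : Str) (X : Type) where
  plot : ∀ {Γ : Ctx}, (Env M.D Γ → X) → Prop
  const : ∀ {Γ : Ctx} (x : X), plot fun _ : Env M.D Γ => x
  wk : ∀ {Γ : Ctx} {σ : Ty} {p : Env M.D Γ → X}, plot p →
    plot fun ρ : Env M.D (σ :: Γ) => p fun τ v => ρ τ (.s v)

/-- The objects of a type: the definable maps are those given by terms with parameters. -/
instance {τ : Ty} : Obj M (M.D τ) where
  plot p := Plot M p
  const := .const
  wk h := h.wk _

instance {X Y : Type} [Obj M X] [Obj M Y] : Obj M (X × Y) where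
  plot p := Obj.plot (fun ρ => (p ρ).1) ∧ Obj.plot (fun ρ => (p ρ).2)
  const _ := ⟨Obj.const _, Obj.const _⟩
  wk h := ⟨Obj.wk h.1, Obj.wk h.2⟩

/-- Decidable properties: those with a definable characteristic function. -/
instance [hM : M.IsModel] : Obj M Prop where
  plot p := ∃ g, Plot M g ∧ ∀ ρ, p ρ ↔ g ρ = (0 : M.D .nat)
  const p := by
    by_cases h : p
    · exact ⟨_, .const 0, fun ρ => by simp [h]⟩
    · exact ⟨_, .const 1, fun ρ => by simp [h]⟩
  wk := fun ⟨g, hg, h⟩ => ⟨_, hg.wk _, fun ρ => h _⟩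

/-- A map is definable (with parameters in the model) if it preserves definability of maps from
assignments. For predicates, this means decidability in the sense of the model. -/
@[fun_prop]
structure Dfn (M : Str) {X Y : Type} [Obj M X] [Obj M Y] (f : X → Y) : Prop where
  plot : ∀ {Γ : Ctx} {p : Env M.D Γ → X}, Obj.plot p → Obj.plot fun ρ => f (p ρ)

section

variable {X Y Z : Type} [Obj M X] [Obj M Y] [Obj M Z] {σ τ : Ty}

@[fun_prop] theorem Dfn.id : Dfn M fun x : X => x := ⟨fun h => h⟩

@[fun_prop] theorem Dfn.const (y : Y) : Dfn M fun _ : X => y := ⟨fun _ => Obj.const y⟩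

@[fun_prop] theorem Dfn.comp {g : Y → Z} {f : X → Y} (hg : Dfn M g) (hf : Dfn M f) :
    Dfn M fun x => g (f x) := ⟨fun h => hg.plot (hf.plot h)⟩

@[fun_prop] theorem Dfn.prodMk {f : X → Y} {g : X → Z} (hf : Dfn M f) (hg : Dfn M g) :
    Dfn M fun x => (f x, g x) := ⟨fun h => ⟨hf.plot h, hg.plot h⟩⟩

@[fun_prop] theorem Dfn.fst {f : X → Y × Z} (hf : Dfn M f) : Dfn M fun x => (f x).1 :=
  ⟨fun h => (hf.plot h).1⟩

@[fun_prop] theorem Dfn.snd {f : X → Y × Z} (hf : Dfn M f) : Dfn M fun x => (f x).2 :=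
  ⟨fun h => (hf.plot h).2⟩

@[fun_prop] theorem Dfn.app {f : X → M.D (.arr σ τ)} {a : X → M.D σ} (hf : Dfn M f)
    (ha : Dfn M a) : Dfn M fun x => M.app (f x) (a x) := ⟨fun h => .app (hf.plot h) (ha.plot h)⟩

theorem Dfn.congr {f g : X → Y} (hf : Dfn M f) (h : ∀ x, g x = f x) : Dfn M g :=
  (_root_.funext h : g = f) ▸ hf

@[fun_prop] theorem Dfn.add {f g : X → M.D .nat} (hf : Dfn M f) (hg : Dfn M g) :
    Dfn M fun x => f x + g x := ((Dfn.const (M.cst .add)).app hf).app hg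

@[fun_prop] theorem Dfn.mul {f g : X → M.D .nat} (hf : Dfn M f) (hg : Dfn M g) :
    Dfn M fun x => f x * g x := ((Dfn.const (M.cst .mul)).app hf).app hg

@[fun_prop] theorem Dfn.sub {f g : X → M.D .nat} (hf : Dfn M f) (hg : Dfn M g) :
    Dfn M fun x => f x - g x :=
  ((Dfn.const ((M.cst (.recursor .nat)) ((M.cst (.pi .one .nat)) M.predElt))).app hf).app hg

theorem Str.nonempty (M : Str) (τ : Ty) : Nonempty (M.D τ) := ⟨(Tm.default τ).eval M Env.nil⟩

open Classical in
/-- The object of function type representing a definable map. -/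
noncomputable def lam (f : M.D σ → M.D τ) : M.D (.arr σ τ) :=
  if h : ∃ e : M.D (.arr σ τ), ∀ x, e x = f x then h.choose else (M.nonempty _).some

variable [hM : M.IsModel]

theorem lam_eq {f : M.D σ → M.D τ} {e : M.D (.arr σ τ)} (h : ∀ x, e x = f x) : lam f = e := by
  have h' : ∃ e : M.D (.arr σ τ), ∀ x, e x = f x := ⟨e, h⟩
  rw [lam, dif_pos h']
  exact Str.funext fun x => (h'.choose_spec x).trans (h x).symm

theorem lam_app {f : M.D σ → M.D τ} (hf : Dfn M f) (x : M.D σ) : M.app (lam f) x = f x := by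
  obtain ⟨g, -, h⟩ := Plot.exists_lam (Γ := []) (f := fun ρ => f (ρ σ .z)) (hf.plot (Plot.var .z))
  have e : lam f = g Env.nil := lam_eq (h Env.nil)
  rw [e]
  exact h Env.nil x

@[fun_prop] theorem Dfn.lam {f : X → M.D σ → M.D τ}
    (hf : Dfn M fun p : X × M.D σ => f p.1 p.2) : Dfn M fun x => lam (f x) := by
  refine ⟨fun {Γ p} hp => ?_⟩
  obtain ⟨g, hg, h⟩ := Plot.exists_lam
    (hf.plot (p := fun ρ : Env M.D (σ :: Γ) => (p (fun τ v => ρ τ (.s v)), ρ σ .z))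
      ⟨Obj.wk hp, Plot.var .z⟩)
  have : g = fun ρ => HORM.lam (f (p ρ)) := by
    funext ρ
    exact (lam_eq (h ρ)).symm
  exact this ▸ hg

/-! ### Decidable predicates -/

theorem Str.one_sub_eq_zero {a : M.D .nat} : 1 - a = 0 ↔ a ≠ 0 := by
  rw [tsub_eq_zero_iff_le, ← not_lt, Str.lt_one_iff]

theorem Dfn.eq_zero {f : X → M.D .nat} (hf : Dfn M f) : Dfn M fun x => f x = 0 :=
  ⟨fun h => ⟨_, hf.plot h, fun _ => Iff.rfl⟩⟩

@[fun_prop] theorem Dfn.le {f g : X → M.D .nat} (hf : Dfn M f) (hg : Dfn M g) :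
    Dfn M fun x => f x ≤ g x :=
  (hf.sub hg).eq_zero.congr fun x => by rw [tsub_eq_zero_iff_le]

@[fun_prop] theorem Dfn.not {P : X → Prop} (hP : Dfn M P) : Dfn M fun x => ¬ P x :=
  ⟨fun h => by
    obtain ⟨g, hg, h⟩ := hP.plot h
    refine ⟨_, .app (.const (M.subElt 1)) hg, fun ρ => ?_⟩
    exact (h ρ).not.trans Str.one_sub_eq_zero.symm⟩

@[fun_prop] theorem Dfn.and {P Q : X → Prop} (hP : Dfn M P) (hQ : Dfn M Q) :
    Dfn M fun x => P x ∧ Q x :=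
  ⟨fun h => by
    obtain ⟨g, hg, h₁⟩ := hP.plot h
    obtain ⟨k, hk, h₂⟩ := hQ.plot h
    refine ⟨_, .app (.app (.const (M.cst .add)) hg) hk, fun ρ => ?_⟩
    exact (and_congr (h₁ ρ) (h₂ ρ)).trans
      (add_eq_zero_iff_of_nonneg (Str.zero_le _) (Str.zero_le _)).symm⟩

@[fun_prop] theorem Dfn.or {P Q : X → Prop} (hP : Dfn M P) (hQ : Dfn M Q) :
    Dfn M fun x => P x ∨ Q x :=
  (hP.not.and hQ.not).not.congr fun x => by simp only [not_and_or, not_not]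

@[fun_prop] theorem Dfn.imp {P Q : X → Prop} (hP : Dfn M P) (hQ : Dfn M Q) :
    Dfn M fun x => P x → Q x :=
  (hP.not.or hQ).congr fun x => by rw [imp_iff_not_or]

@[fun_prop] theorem Dfn.eq {f g : X → M.D .nat} (hf : Dfn M f) (hg : Dfn M g) :
    Dfn M fun x => f x = g x :=
  ((hf.le hg).and (hg.le hf)).congr fun _ => propext le_antisymm_iff

@[fun_prop] theorem Dfn.lt {f g : X → M.D .nat} (hf : Dfn M f) (hg : Dfn M g) :
    Dfn M fun x => f x < g x :=
  (hg.le hf).not.congr fun x => by rw [not_le]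

open Classical in
/-- Definition by cases, on an arbitrary property. -/
noncomputable def sel {X : Type} (P : Prop) (a b : X) : X := if P then a else b

theorem sel_pos {X : Type} {P : Prop} (h : P) (a b : X) : sel P a b = a := if_pos h

theorem sel_neg {X : Type} {P : Prop} (h : ¬ P) (a b : X) : sel P a b = b := if_neg h

@[fun_prop] theorem Dfn.sel {P : X → Prop} {f g : X → M.D .nat} (hP : Dfn M P) (hf : Dfn M f)
    (hg : Dfn M g) : Dfn M fun x => sel (P x) (f x) (g x) :=
  ⟨fun {Γ p} h => by
    obtain ⟨k, hk, h'⟩ := hP.plot h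
    have : Plot M _ := .app (.app (.const (M.cst .add))
      (.app (.app (.const (M.cst .mul)) (hf.plot h)) (.app (.const (M.subElt 1)) hk)))
      (.app (.app (.const (M.cst .mul)) (hg.plot h))
        (.app (.const (M.subElt 1)) (.app (.const (M.subElt 1)) hk)))
    refine (_root_.funext fun ρ => ?_ : (fun ρ => HORM.sel (P (p ρ)) (f (p ρ)) (g (p ρ))) = _) ▸ this
    change HORM.sel (P (p ρ)) (f (p ρ)) (g (p ρ)) =
      f (p ρ) * (1 - k ρ) + g (p ρ) * (1 - (1 - k ρ))
    by_cases h0 : k ρ = 0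
    · rw [sel_pos ((h' ρ).2 h0)]; simp [h0]
    · rw [sel_neg fun h => h0 ((h' ρ).1 h)]; simp [Str.one_sub_eq_zero.2 h0]⟩

end

end

section

variable {M : Str} [hM : M.IsModel] {X : Type} [Obj M X]

/-! ### Induction, recursion and bounded search -/

/-- Induction for decidable predicates. -/
theorem Str.induction {P : M.D .nat → Prop} (hP : Dfn M P) (h0 : P 0)
    (hs : ∀ n, P n → P (n + 1)) (n : M.D .nat) : P n := by
  obtain ⟨g, hg, h⟩ := hP.plot (p := fun ρ : Env M.D [.nat] => ρ .nat .z) (Plot.var .z)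
  obtain ⟨e, -, he⟩ := hg.exists_lam
  have key : ∀ n, P n ↔ (Tm.app v₁ v₀ =ₕ .zero : Fm [.nat, .one]).sat M
      ((Env.nil.cons (e Env.nil)).cons n) := fun n => by
    rw [Fm.sat_eq]
    exact (h _).trans (Eq.congr_left (he Env.nil n).symm)
  exact (key n).2 (Str.fmInduction (A := Tm.app v₁ v₀ =ₕ .zero) (by simp [Fm.QF]) (Env.nil.cons (e Env.nil)) ((key 0).1 h0)
    (fun n hn => (key _).1 (hs n ((key n).2 hn))) n)

/-- Iteration: `nrec f m n` is obtained from `m` by applying `f 0, …, f (n - 1)` in this order. -/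
noncomputable def nrec (f : M.D .nat → M.D .nat → M.D .nat) (m n : M.D .nat) : M.D .nat :=
  (M.cst (.recursor .nat)) (lam fun k => lam fun r => f k r) m n

@[fun_prop] theorem Dfn.nrec {f : X → M.D .nat → M.D .nat → M.D .nat} {m n : X → M.D .nat}
    (hf : Dfn M fun p : (X × M.D .nat) × M.D .nat => f p.1.1 p.1.2 p.2) (hm : Dfn M m)
    (hn : Dfn M n) : Dfn M fun x => nrec (f x) (m x) (n x) := by
  unfold HORM.nrec
  have : Dfn M fun x => (HORM.lam fun k => HORM.lam fun r => f x k r : M.D (.arr .nat .one)) :=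
    Dfn.lam (Dfn.lam (f := fun p : X × M.D .nat => f p.1 p.2) hf)
  fun_prop

theorem nrec_zero (f : M.D .nat → M.D .nat → M.D .nat) (m : M.D .nat) : nrec f m 0 = m :=
  Str.rec_zero _ _

theorem nrec_succ {f : M.D .nat → M.D .nat → M.D .nat}
    (hf : Dfn M fun p : M.D .nat × M.D .nat => f p.1 p.2) (m n : M.D .nat) :
    nrec f m (n + 1) = f n (nrec f m n) := by
  rw [nrec, Str.rec_succ, lam_app (by fun_prop), lam_app (by fun_prop)]; rfl

/-- Bounded universal quantification. -/
def BAll (b : M.D .nat) (P : M.D .nat → Prop) : Prop := ∀ y < b, P y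

/-- Bounded existential quantification. -/
def BEx (b : M.D .nat) (P : M.D .nat → Prop) : Prop := ∃ y < b, P y

open Str in
@[fun_prop] theorem Dfn.ball {b : X → M.D .nat} {P : X → M.D .nat → Prop} (hb : Dfn M b)
    (hP : Dfn M fun p : X × M.D .nat => P p.1 p.2) : Dfn M fun x => BAll (b x) (P x) := by
  -- the least counterexample below the bound, or the bound, is found by recursion
  have hd : Dfn M fun x => HORM.nrec (fun k r => HORM.sel (r = k ∧ P x k) (k + 1) r) 0 (b x) = b x := by
    have : Dfn M fun p : (X × M.D .nat) × M.D .nat => P p.1.1 p.1.2 :=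
      hP.comp (f := fun p : (X × M.D .nat) × M.D .nat => p.1) (by fun_prop)
    fun_prop
  refine hd.congr fun x => propext ?_
  have hPx : Dfn M (P x) := hP.comp (f := fun y : M.D .nat => (x, y)) (by fun_prop)
  have hf : Dfn M fun p : M.D .nat × M.D .nat => HORM.sel (p.2 = p.1 ∧ P x p.1) (p.1 + 1) p.2 := by
    fun_prop
  set w : M.D .nat → M.D .nat := HORM.nrec (fun k r => HORM.sel (r = k ∧ P x k) (k + 1) r) 0 with hw
  have hwd : Dfn M w := by fun_prop
  have h0 : w 0 = 0 := nrec_zero _ _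
  have hs : ∀ n, w (n + 1) = HORM.sel (w n = n ∧ P x n) (n + 1) (w n) := nrec_succ hf 0
  have h1 : ∀ n, w n = n ∨ w n < n ∧ ¬ P x (w n) := by
    refine Str.induction (by fun_prop) (.inl h0) fun n hn => ?_
    rw [hs]
    by_cases hc : w n = n ∧ P x n
    · rw [sel_pos hc]; exact .inl rfl
    · rw [sel_neg hc]
      rcases hn with hn | hn
      · exact .inr ⟨by rw [hn]; exact lt_add_one_iff.2 le_rfl, by rw [hn]; exact fun h => hc ⟨hn, h⟩⟩
      · exact .inr ⟨lt_add_one_iff.2 hn.1.le, hn.2⟩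
  have h2 : ∀ n, ∀ y, ¬ P x y → y < n → w n ≤ y := by
    intro n y hy
    refine Str.induction (P := fun n => y < n → w n ≤ y) (by fun_prop)
      (fun h => (not_lt_zero _ h).elim) (fun n hn hyn => ?_) n
    rw [hs]
    rcases (lt_add_one_iff.1 hyn).lt_or_eq with h | rfl
    · have := hn h
      rw [sel_neg fun hc : w n = n ∧ P x n => (this.trans_lt h).ne hc.1]
      exact this
    · rw [sel_neg fun hc : w y = y ∧ P x y => hy hc.2]
      rcases h1 y with h | h
      exacts [h.le, h.1.le]
  constructor
  · intro h
    rcases h1 (b x) with h' | h'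
    exacts [h', (h'.2 (h _ h'.1)).elim]
  · intro h y hy
    by_contra hn
    exact (hy.trans_le (h ▸ h2 _ y hn hy)).false

@[fun_prop] theorem Dfn.bex {b : X → M.D .nat} {P : X → M.D .nat → Prop} (hb : Dfn M b)
    (hP : Dfn M fun p : X × M.D .nat => P p.1 p.2) : Dfn M fun x => BEx (b x) (P x) := by
  have : Dfn M fun x => ¬ BAll (b x) fun y => ¬ P x y := by fun_prop
  exact this.congr fun x => by simp [BAll, BEx]

theorem Str.strongInduction {P : M.D .nat → Prop} (hP : Dfn M P)
    (h : ∀ n, (∀ k < n, P k) → P n) (n : M.D .nat) : P n := by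
  refine h n (Str.induction (P := fun n => BAll n P) (by fun_prop)
    (fun k hk => (Str.not_lt_zero k hk).elim) (fun n hn k hk => ?_) n)
  rcases (Str.lt_add_one_iff.1 hk).lt_or_eq with hk | rfl
  exacts [hn k hk, h k hn]

theorem Str.exists_least {P : M.D .nat → Prop} (hP : Dfn M P) {n : M.D .nat} (hn : P n) :
    ∃ m ≤ n, P m ∧ ∀ k < m, ¬ P k := by
  by_contra hc
  push Not at hc
  have : ∀ m, m ≤ n → ¬ P m := Str.strongInduction (by fun_prop) fun m hm hmn hP => by
    obtain ⟨k, hk, hPk⟩ := hc m hmn hP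
    exact hm k hk (hk.le.trans hmn) hPk
  exact this n le_rfl hn

/-- The least number below the bound with the given property, or the bound if there is none. -/
noncomputable def bmin (b : M.D .nat) (P : M.D .nat → Prop) : M.D .nat :=
  nrec (fun k r => sel (BAll (k + 1) fun y => ¬ P y) (k + 1) r) 0 b

@[fun_prop] theorem Dfn.bmin {b : X → M.D .nat} {P : X → M.D .nat → Prop} (hb : Dfn M b)
    (hP : Dfn M fun p : X × M.D .nat => P p.1 p.2) : Dfn M fun x => bmin (b x) (P x) := by
  unfold HORM.bmin
  have : Dfn M fun p : ((X × M.D .nat) × M.D .nat) × M.D .nat => P p.1.1.1 p.2 :=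
      hP.comp (f := fun p : ((X × M.D .nat) × M.D .nat) × M.D .nat => (p.1.1.1, p.2)) (by fun_prop)
  fun_prop

theorem bmin_spec {P : M.D .nat → Prop} (hP : Dfn M P) (b : M.D .nat) :
    bmin b P ≤ b ∧ (∀ k < bmin b P, ¬ P k) ∧ (bmin b P < b → P (bmin b P)) := by
  have hs : ∀ n, bmin (n + 1) P = sel (BAll (n + 1) fun y => ¬ P y) (n + 1) (bmin n P) :=
    nrec_succ (by fun_prop) 0
  refine Str.induction (P := fun b => bmin b P ≤ b ∧ (BAll (bmin b P) fun k => ¬ P k) ∧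
    (bmin b P < b → P (bmin b P))) (by fun_prop) ?_ ?_ b
  · have : bmin 0 P = 0 := nrec_zero _ _
    rw [this]
    exact ⟨le_rfl, fun k hk => (Str.not_lt_zero k hk).elim, fun h => h.false.elim⟩
  · rintro n ⟨h₁, h₂, h₃⟩
    rw [hs]
    by_cases hc : BAll (n + 1) fun y => ¬ P y
    · rw [sel_pos hc]
      exact ⟨le_rfl, hc, fun h => h.false.elim⟩
    · rw [sel_neg hc]
      refine ⟨h₁.trans (le_add_of_nonneg_right (Str.zero_le 1)), h₂, fun _ => ?_⟩
      rcases h₁.lt_or_eq with h | h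
      · exact h₃ h
      · simp only [BAll, not_forall, not_not] at hc
        obtain ⟨y, hy, hPy⟩ := hc
        rcases (Str.lt_add_one_iff.1 hy).lt_or_eq with h' | rfl
        · exact (h₂ y (h.symm ▸ h') hPy).elim
        · rwa [h]

theorem bmin_of_lt {P : M.D .nat → Prop} (hP : Dfn M P) {b y : M.D .nat} (hy : y < b)
    (h : P y) : bmin b P ≤ y ∧ P (bmin b P) := by
  obtain ⟨-, h₂, h₃⟩ := bmin_spec hP b
  have : bmin b P ≤ y := not_lt.1 fun hlt => h₂ y hlt h
  exact ⟨this, h₃ (this.trans_lt hy)⟩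

/-! ### Choice -/

theorem Str.choice_of_sat {σ τ : Ty}
    (h : (Fm.choiceAx (σ := σ) (τ := τ) (Tm.app (Tm.app v₂ v₁) v₀ =ₕ .zero :
      Fm [τ, σ, .arr σ (.arr τ .nat)])).sat M = fun _ => True)
    {P : M.D σ → M.D τ → Prop} (hP : Dfn M fun p : M.D σ × M.D τ => P p.1 p.2)
    (hex : ∀ x, ∃ y, P x y) : ∃ Y : M.D (.arr σ τ), ∀ x, P x (Y x) := by
  obtain ⟨g, hg, hgP⟩ := hP.plot
    (p := fun ρ : Env M.D [τ, σ] => (ρ σ (.s .z), ρ τ .z)) ⟨Plot.var (.s .z), Plot.var .z⟩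
  obtain ⟨g₁, hg₁, h₁⟩ := hg.exists_lam
  obtain ⟨g₂, -, h₂⟩ := hg₁.exists_lam
  have key : ∀ x y, P x y ↔ g₂ Env.nil x y = (0 : M.D .nat) := fun x y => by
    rw [h₂ Env.nil x, h₁, ← hgP]; rfl
  have hc := (congrFun h (Env.nil.cons (g₂ Env.nil))).mpr trivial
  simp only [Fm.choiceAx, Fm.sat_imp, Fm.sat_all, Fm.sat_ex, Fm.sat_subst, Fm.sat_eq, Tm.eval_app,
    Tm.eval_var_s, Tm.eval_var_z, Tm.eval_zero] at hc
  obtain ⟨Y, hY⟩ := hc fun x => (hex x).imp fun y hy => (key x y).1 hy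
  exact ⟨Y, fun x => (key x _).2 (hY x)⟩

/-- Choice from objects of type `1` to numbers, for decidable predicates. -/
theorem Str.choice_one_nat {P : M.D .one → M.D .nat → Prop}
    (hP : Dfn M fun p : M.D .one × M.D .nat => P p.1 p.2) (hex : ∀ x, ∃ y, P x y) :
    ∃ Y : M.D (.arr .one .nat), ∀ x, P x (Y x) :=
  Str.choice_of_sat (_root_.funext fun ρ => eq_true
    (RCA0wAx.sat (.qfac _ (by exact trivial)) ρ)) hP hex

/-- Choice from numbers to numbers, with two arguments. -/
theorem Str.choice_nat₂ {P : M.D .nat → M.D .nat → M.D .nat → Prop}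
    (hP : Dfn M fun p : (M.D .nat × M.D .nat) × M.D .nat => P p.1.1 p.1.2 p.2)
    (hex : ∀ a b, ∃ y, P a b y) : ∃ Y : M.D .nat → M.D .nat → M.D .nat,
      (Dfn M fun p : M.D .nat × M.D .nat => Y p.1 p.2) ∧ ∀ a b, P a b (Y a b) := by
  obtain ⟨Y, hY⟩ := Str.choice_one_nat (M := M) (P := fun x y => P (x 0) (x 1) y)
    (hP.comp (f := fun p : M.D .one × M.D .nat => ((p.1 0, p.1 1), p.2)) (by fun_prop))
    fun x => hex _ _
  refine ⟨fun a b => Y (lam fun n => sel (n = 0) a b), by fun_prop, fun a b => ?_⟩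
  have := hY (lam fun n => sel (n = 0) a b)
  rw [lam_app (by fun_prop), lam_app (by fun_prop), sel_pos rfl, sel_neg one_ne_zero] at this
  exact this

/-- Choice from numbers to numbers. -/
theorem Str.choice_nat {P : M.D .nat → M.D .nat → Prop}
    (hP : Dfn M fun p : M.D .nat × M.D .nat => P p.1 p.2) (hex : ∀ a, ∃ y, P a y) :
    ∃ Y : M.D .one, ∀ a, P a (Y a) := by
  obtain ⟨Y, hYd, hY⟩ := Str.choice_nat₂ (M := M) (P := fun a _ y => P a y)
    (hP.comp (f := fun p : (M.D .nat × M.D .nat) × M.D .nat => (p.1.1, p.2)) (by fun_prop))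
    fun a _ => hex a
  refine ⟨lam fun a => Y a 0, fun a => ?_⟩
  rw [lam_app (hYd.comp (f := fun a : M.D .nat => (a, (0 : M.D .nat))) (by fun_prop))]
  exact hY a 0

/-- The collection principle: finitely many witnesses have a common bound. -/
theorem Str.exists_bound {P : M.D .nat → M.D .nat → Prop}
    (hP : Dfn M fun p : M.D .nat × M.D .nat => P p.1 p.2) (k : M.D .nat)
    (hex : ∀ i < k, ∃ y, P i y) : ∃ b, ∀ i < k, ∃ y ≤ b, P i y := by
  obtain ⟨Y, hY⟩ := Str.choice_nat (M := M) (P := fun i y => i < k → P i y) (by fun_prop)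
    fun i => by
      by_cases h : i < k
      · exact (hex i h).imp fun y hy _ => hy
      · exact ⟨0, fun h' => (h h').elim⟩
  have hf : Dfn M fun p : M.D .nat × M.D .nat => p.2 + Y p.1 := by fun_prop
  refine ⟨nrec (fun i r => r + Y i) 0 k, fun i hi => ⟨Y i, ?_, hY i hi⟩⟩
  refine Str.induction (P := fun k => i < k → Y i ≤ nrec (fun i r => r + Y i) 0 k) (by fun_prop)
    (fun h => (Str.not_lt_zero _ h).elim) (fun n hn hin => ?_) k hi
  rw [nrec_succ hf]
  rcases (Str.lt_add_one_iff.1 hin).lt_or_eq with h | rfl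
  · exact (hn h).trans (le_add_of_nonneg_right (Str.zero_le _))
  · exact le_add_of_nonneg_left (Str.zero_le _)

/-! ### The ordered field of fractions of an ordered semiring -/

section

variable (N : Type) [CommSemiring N] [LinearOrder N] [IsStrictOrderedRing N]
  [CanonicallyOrderedAdd N]

/-- Representations `(p - n) / d` of fractions. -/
structure SignedFrac : Type where
  p : N
  n : N
  d : N
  pos : 0 < d

variable {N}

/-- Equality of the represented fractions. -/
instance SignedFrac.setoid : Setoid (SignedFrac N) where
  r a b := a.p * b.d + b.n * a.d = b.p * a.d + a.n * b.d
  iseqv :=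
    { refl := fun a => rfl
      symm := fun {a b} h => by grind
      trans := fun {a b c} h₁ h₂ => by
        refine mul_left_cancel₀ b.pos.ne' ?_
        grind }

theorem SignedFrac.equiv_def {a b : SignedFrac N} :
    a ≈ b ↔ a.p * b.d + b.n * a.d = b.p * a.d + a.n * b.d := Iff.rfl

variable (N)

/-- The field of fractions `(p - n) / d`. -/
def FracField : Type := Quotient (SignedFrac.setoid (N := N))

variable {N}

namespace FracField

/-- The fraction `(p - n) / d`, for positive `d`. -/
def mk (p n d : N) (h : 0 < d) : FracField N := Quotient.mk _ ⟨p, n, d, h⟩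

theorem mk_eq_mk {p n d p' n' d' : N} {h : 0 < d} {h' : 0 < d'} :
    mk p n d h = mk p' n' d' h' ↔ p * d' + n' * d = p' * d + n * d' :=
  Quotient.eq

theorem ind {P : FracField N → Prop} (h : ∀ p n d hd, P (mk p n d hd)) (q : FracField N) : P q :=
  Quotient.inductionOn q fun ⟨p, n, d, hd⟩ => h p n d hd

instance : Add (FracField N) := ⟨Quotient.map₂
  (fun a b => ⟨a.p * b.d + b.p * a.d, a.n * b.d + b.n * a.d, a.d * b.d, mul_pos a.pos b.pos⟩)
  fun a a' h b b' h' => by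
    rw [SignedFrac.equiv_def] at *
    grind⟩

instance : Mul (FracField N) := ⟨Quotient.map₂
  (fun a b => ⟨a.p * b.p + a.n * b.n, a.p * b.n + a.n * b.p, a.d * b.d, mul_pos a.pos b.pos⟩)
  fun a a' h b b' h' => by
    refine Setoid.trans (b := ⟨a'.p * b.p + a'.n * b.n, a'.p * b.n + a'.n * b.p, a'.d * b.d,
      mul_pos a'.pos b.pos⟩) ?_ ?_
    · rw [SignedFrac.equiv_def] at *
      grind
    · rw [SignedFrac.equiv_def] at *
      grind⟩

instance : Neg (FracField N) := ⟨Quotient.map (fun a => ⟨a.n, a.p, a.d, a.pos⟩)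
  fun a a' h => by
    rw [SignedFrac.equiv_def] at *
    grind⟩

instance : Zero (FracField N) := ⟨mk 0 0 1 zero_lt_one⟩
instance : One (FracField N) := ⟨mk 1 0 1 zero_lt_one⟩

theorem mk_add (p n d p' n' d' : N) (h : 0 < d) (h' : 0 < d') :
    mk p n d h + mk p' n' d' h' = mk (p * d' + p' * d) (n * d' + n' * d) (d * d') (mul_pos h h') :=
  rfl

theorem mk_mul (p n d p' n' d' : N) (h : 0 < d) (h' : 0 < d') :
    mk p n d h * mk p' n' d' h' = mk (p * p' + n * n') (p * n' + n * p') (d * d') (mul_pos h h') :=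
  rfl

theorem neg_mk (p n d : N) (h : 0 < d) : - mk p n d h = mk n p d h := rfl

theorem zero_def : (0 : FracField N) = mk 0 0 1 zero_lt_one := rfl

theorem one_def : (1 : FracField N) = mk 1 0 1 zero_lt_one := rfl

instance : CommRing (FracField N) where
  add_assoc a b c := by
    induction a using ind; induction b using ind; induction c using ind
    simp only [mk_add, mk_eq_mk]; ring
  zero_add a := by
    induction a using ind
    simp only [zero_def, mk_add, mk_eq_mk]; ring
  add_zero a := by
    induction a using ind
    simp only [zero_def, mk_add, mk_eq_mk]; ring
  add_comm a b := by
    induction a using ind; induction b using ind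
    simp only [mk_add, mk_eq_mk]; ring
  neg_add_cancel a := by
    induction a using ind
    simp only [zero_def, neg_mk, mk_add, mk_eq_mk]; ring
  mul_assoc a b c := by
    induction a using ind; induction b using ind; induction c using ind
    simp only [mk_mul, mk_eq_mk]; ring
  one_mul a := by
    induction a using ind
    simp only [one_def, mk_mul, mk_eq_mk]; ring
  mul_one a := by
    induction a using ind
    simp only [one_def, mk_mul, mk_eq_mk]; ring
  mul_comm a b := by
    induction a using ind; induction b using ind
    simp only [mk_mul, mk_eq_mk]; ring
  zero_mul a := by
    induction a using ind
    simp only [zero_def, mk_mul, mk_eq_mk]; ring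
  mul_zero a := by
    induction a using ind
    simp only [zero_def, mk_mul, mk_eq_mk]; ring
  left_distrib a b c := by
    induction a using ind; induction b using ind; induction c using ind
    simp only [mk_add, mk_mul, mk_eq_mk]; ring
  right_distrib a b c := by
    induction a using ind; induction b using ind; induction c using ind
    simp only [mk_add, mk_mul, mk_eq_mk]; ring
  nsmul := nsmulRec
  zsmul := zsmulRec

theorem mk_eq_zero {p n d : N} {h : 0 < d} : mk p n d h = 0 ↔ p = n := by
  rw [zero_def, mk_eq_mk]; simp

theorem exists_inv (a : FracField N) (ha : a ≠ 0) : ∃ b, a * b = 1 := by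
  induction a using ind with
  | h p n d hd =>
    rw [Ne, mk_eq_zero] at ha
    rcases lt_or_gt_of_ne ha with h | h
    · obtain ⟨e, rfl⟩ := exists_add_of_le h.le
      refine ⟨mk 0 d e (pos_of_lt_add_right h), ?_⟩
      rw [mk_mul, one_def, mk_eq_mk]
      ring
    · obtain ⟨e, rfl⟩ := exists_add_of_le h.le
      refine ⟨mk d 0 e (pos_of_lt_add_right h), ?_⟩
      rw [mk_mul, one_def, mk_eq_mk]
      ring

instance : Nontrivial (FracField N) := ⟨0, 1, fun h => by
  rw [eq_comm, one_def, mk_eq_zero] at h; exact one_ne_zero h⟩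

open Classical in
noncomputable instance : Field (FracField N) where
  inv a := if h : a = 0 then 0 else (exists_inv a h).choose
  mul_inv_cancel a h := by
    change a * (if h : a = 0 then 0 else (exists_inv a h).choose) = 1
    rw [dif_neg h]
    exact (exists_inv a h).choose_spec
  inv_zero := dif_pos rfl
  nnqsmul := _
  nnqsmul_def := fun _ _ => rfl
  qsmul := _
  qsmul_def := fun _ _ => rfl

/-- The cone of the nonnegative fractions. -/
def cone : RingCone (FracField N) where
  carrier := {a | Quotient.liftOn a (fun a => a.n ≤ a.p) fun a b h => propext (by
    rw [SignedFrac.equiv_def] at h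
    constructor
    · intro h'
      by_contra hc
      have h₁ := mul_le_mul_of_nonneg_right h' b.pos.le
      have h₂ := mul_lt_mul_of_pos_right (not_le.1 hc) a.pos
      exact (add_lt_add_of_le_of_lt h₁ h₂).ne (by rw [h]; exact add_comm _ _)
    · intro h'
      by_contra hc
      have h₁ := mul_le_mul_of_nonneg_right h' a.pos.le
      have h₂ := mul_lt_mul_of_pos_right (not_le.1 hc) b.pos
      exact (add_lt_add_of_le_of_lt h₁ h₂).ne (by rw [← h]; exact add_comm _ _))}
  mul_mem' := fun {a b} => by
    induction a using ind with
    | h p n d hd =>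
      induction b using ind with
      | h p' n' d' hd' =>
        intro (h : n ≤ p) (h' : n' ≤ p')
        change p * n' + n * p' ≤ p * p' + n * n'
        obtain ⟨c, rfl⟩ := exists_add_of_le h
        obtain ⟨c', rfl⟩ := exists_add_of_le h'
        exact le_of_le_of_eq (le_add_of_nonneg_right (zero_le (a := c * c'))) (by ring)
  one_mem' := show (0 : N) ≤ 1 from zero_le_one
  add_mem' := fun {a b} => by
    induction a using ind with
    | h p n d hd =>
      induction b using ind with
      | h p' n' d' hd' =>
        intro (h : n ≤ p) (h' : n' ≤ p')
        exact add_le_add (mul_le_mul_of_nonneg_right h hd'.le) (mul_le_mul_of_nonneg_right h' hd.le)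
  zero_mem' := show (0 : N) ≤ 0 from le_rfl
  eq_zero_of_mem_of_neg_mem' := fun {a} => by
    induction a using ind with
    | h p n d hd =>
      intro (h : n ≤ p) (h' : p ≤ n)
      exact mk_eq_zero.2 (h'.antisymm h)

theorem mk_mem_cone {p n d : N} {h : 0 < d} : mk p n d h ∈ (cone : RingCone (FracField N)) ↔ n ≤ p :=
  Iff.rfl

instance : HasMemOrNegMem (cone : RingCone (FracField N)) :=
  ⟨fun a => by
    induction a using ind with
    | h p n d hd => exact le_total n p⟩

open Classical in
noncomputable instance : LinearOrder (FracField N) := .mkOfAddGroupCone cone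

instance : IsOrderedRing (FracField N) := .mkOfCone cone

instance : IsStrictOrderedRing (FracField N) := IsOrderedRing.toIsStrictOrderedRing _

theorem mk_nonneg {p n d : N} {h : 0 < d} : 0 ≤ mk p n d h ↔ n ≤ p := by
  have : 0 ≤ mk p n d h ↔ mk p n d h - 0 ∈ (cone : RingCone (FracField N)) := Iff.rfl
  rw [this, sub_zero, mk_mem_cone]

/-- The embedding of the semiring. -/
def cast : N →+* FracField N where
  toFun a := mk a 0 1 zero_lt_one
  map_one' := rfl
  map_zero' := rfl
  map_add' a b := by rw [mk_add, mk_eq_mk]; ring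
  map_mul' a b := by rw [mk_mul, mk_eq_mk]; ring

theorem cast_strictMono : StrictMono (cast : N → FracField N) := by
  refine Monotone.strictMono_of_injective (fun a b h => ?_) fun a b h => ?_
  · obtain ⟨c, rfl⟩ := exists_add_of_le h
    rw [map_add]
    exact le_add_of_nonneg_right (mk_nonneg.2 (zero_le (a := c)))
  · simpa using mk_eq_mk.1 h

@[simp] theorem cast_lt {a b : N} : cast a < cast b ↔ a < b := cast_strictMono.lt_iff_lt
@[simp] theorem cast_le {a b : N} : cast a ≤ cast b ↔ a ≤ b := cast_strictMono.le_iff_le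
theorem cast_nonneg (a : N) : 0 ≤ cast a := mk_nonneg.2 zero_le

theorem cast_pos {a : N} : 0 < cast a ↔ 0 < a := by rw [← map_zero cast, cast_lt]

theorem mk_eq_div (p n d : N) (h : 0 < d) : mk p n d h = (cast p - cast n) / cast d := by
  rw [eq_div_iff (cast_pos.2 h).ne', sub_eq_add_neg]
  change mk p n d h * mk d 0 1 _ = mk p 0 1 _ + - mk n 0 1 _
  rw [neg_mk, mk_add, mk_mul, mk_eq_mk]
  ring

theorem exists_eq_div (q : FracField N) : ∃ p n d : N, 0 < d ∧ q = (cast p - cast n) / cast d := by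
  induction q using ind with
  | h p n d hd => exact ⟨p, n, d, hd, mk_eq_div _ _ _ hd⟩

end FracField

end

/-! ### Pairing and parity -/

theorem Str.lt_of_cast {a b : M.D .nat} (h : FracField.cast a < FracField.cast b) : a < b :=
  FracField.cast_lt.1 h

theorem Str.le_of_cast {a b : M.D .nat} (h : FracField.cast a ≤ FracField.cast b) : a ≤ b :=
  FracField.cast_le.1 h

theorem Str.exists_half (m : M.D .nat) :
    (∃ p < m + 1, m = 2 * p) ∨ ∃ n < m + 2, m + 1 = 2 * n := by
  refine Str.induction (P := fun m => (BEx (m + 1) fun p => m = 2 * p) ∨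
    BEx (m + 2) fun n => m + 1 = 2 * n) (by fun_prop) (.inl ⟨0, by simp, by simp⟩) ?_ m
  rintro m (⟨p, hp, h⟩ | ⟨n, hn, h⟩)
  · refine .inr ⟨p + 1, Str.lt_of_cast ?_, by rw [h]; ring⟩
    have := FracField.cast_lt.2 hp
    simp only [map_add, map_one, map_ofNat] at this ⊢
    linarith
  · refine .inl ⟨n, Str.lt_of_cast ?_, h⟩
    have h₁ := congrArg FracField.cast h
    have h₂ := FracField.cast_nonneg m
    simp only [map_add, map_one, map_mul, map_ofNat] at h₁ ⊢
    linarith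

theorem Str.two_mul_inj {a b : M.D .nat} (h : 2 * a = 2 * b) : a = b :=
  mul_left_cancel₀ two_ne_zero h

theorem Str.two_mul_ne {a b : M.D .nat} : 2 * a + 1 ≠ 2 * b := by
  intro h
  rcases le_or_gt b a with hab | hab
  · have := mul_le_mul_of_nonneg_left hab (zero_le_two (α := M.D .nat))
    rw [← h] at this
    exact (Str.lt_add_one_iff.2 le_rfl).not_ge this
  · have := mul_le_mul_of_nonneg_left (Str.add_one_le_iff.2 hab) (zero_le_two (α := M.D .nat))
    rw [← h, mul_add, mul_one] at this
    have h2 : (1 : M.D .nat) < 2 := one_lt_two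
    grind

/-- The equation defining the Cantor pairing function. -/
def IsPair (c m k : M.D .nat) : Prop := 2 * c = (m + k) * (m + k) + 3 * m + k

theorem Str.le_mul_self (s : M.D .nat) : s ≤ s * s := by
  rcases eq_or_ne s 0 with rfl | h
  · simp
  · exact le_mul_of_one_le_left (Str.zero_le s)
      (not_lt.1 fun h' => h (Str.lt_one_iff.1 h'))

theorem IsPair.le {c m k : M.D .nat} (h : IsPair c m k) : m ≤ c ∧ k ≤ c := by
  have h₁ := FracField.cast_le.2 (Str.le_mul_self (m + k))
  have h₂ := FracField.cast_nonneg m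
  have h₃ := FracField.cast_nonneg k
  have h₄ := congrArg FracField.cast h
  simp only [map_add, map_mul, map_ofNat] at h₁ h₄
  constructor <;> refine Str.le_of_cast ?_ <;> linarith

theorem exists_isPair (c : M.D .nat) : ∃ m < c + 1, ∃ k < c + 1, IsPair c m k := by
  refine Str.induction (P := fun c => BEx (c + 1) fun m => BEx (c + 1) fun k =>
    2 * c = (m + k) * (m + k) + 3 * m + k) (by fun_prop) ⟨0, by simp, 0, by simp, by simp⟩ ?_ c
  rintro c ⟨m, -, k, -, h⟩
  suffices ∃ m k, IsPair (c + 1) m k by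
    obtain ⟨m, k, h⟩ := this
    exact ⟨m, Str.lt_add_one_iff.2 h.le.1, k, Str.lt_add_one_iff.2 h.le.2, h⟩
  rcases Str.pred_spec k with rfl | h'
  · exact ⟨0, m + 1, by unfold IsPair; grind⟩
  · exact ⟨m + 1, M.predElt k, by unfold IsPair; rw [← h'] at h; grind⟩

theorem IsPair.unique {c m k m' k' : M.D .nat} (h : IsPair c m k) (h' : IsPair c m' k') :
    m = m' ∧ k = k' := by
  have key : ∀ {m k m' k' : M.D .nat}, IsPair c m k → IsPair c m' k' → ¬ m + k < m' + k' := by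
    intro m k m' k' h h' hlt
    have e := h.symm.trans h'
    obtain ⟨d, hd⟩ := exists_add_of_le (Str.add_one_le_iff.2 hlt)
    have e' : (m + k) * (m + k) + (m + k) + 2 * m
        = (m' + k') * (m' + k') + (m' + k') + 2 * m' := by grind
    rw [hd] at e'
    have h1 : (m + k + 1 + d) * (m + k + 1 + d) + (m + k + 1 + d) + 2 * m' =
        ((m + k) * (m + k) + (m + k) + 2 * m) + (2 * k + 2 + 3 * d + d * d + 2 * (m + k) * d + 2 * m')
      := by ring
    rw [h1] at e'
    have : 0 < 2 * k + 2 + 3 * d + d * d + 2 * (m + k) * d + 2 * m' := by positivity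
    exact (lt_add_of_pos_right _ this).ne e'
  have hs : m + k = m' + k' :=
    (not_lt.1 (key h' h)).antisymm (not_lt.1 (key h h'))
  have e := h.symm.trans h'
  rw [hs] at e
  have hm : m = m' := Str.two_mul_inj (by grind)
  subst hm
  exact ⟨rfl, add_left_cancel hs⟩

/-- First component of the Cantor pair. -/
noncomputable def Str.fst (c : M.D .nat) : M.D .nat :=
  bmin (c + 1) fun m => BEx (c + 1) fun k => 2 * c = (m + k) * (m + k) + 3 * m + k

/-- Second component of the Cantor pair. -/
noncomputable def Str.snd (c : M.D .nat) : M.D .nat :=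
  bmin (c + 1) fun k => 2 * c = (Str.fst c + k) * (Str.fst c + k) + 3 * Str.fst c + k

@[fun_prop] theorem Dfn.natFst {f : X → M.D .nat} (hf : Dfn M f) : Dfn M fun x => Str.fst (f x) := by
  unfold Str.fst; fun_prop

@[fun_prop] theorem Dfn.natSnd {f : X → M.D .nat} (hf : Dfn M f) : Dfn M fun x => Str.snd (f x) := by
  unfold Str.snd; fun_prop

theorem isPair_fst_snd (c : M.D .nat) : IsPair c (Str.fst c) (Str.snd c) := by
  obtain ⟨m, hm, k, hk, h⟩ := exists_isPair c
  obtain ⟨k', hk', h'⟩ := (bmin_of_lt (P := fun m => BEx (c + 1) fun k =>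
    2 * c = (m + k) * (m + k) + 3 * m + k) (by fun_prop) hm ⟨k, hk, h⟩).2
  exact (bmin_of_lt (P := fun k => 2 * c = (Str.fst c + k) * (Str.fst c + k) + 3 * Str.fst c + k)
    (by fun_prop) hk' h').2

/-- The Cantor pairing function. -/
noncomputable def Str.pair (m k : M.D .nat) : M.D .nat :=
  bmin ((m + k) * (m + k) + 3 * m + k + 2) fun c => 2 * c = (m + k) * (m + k) + 3 * m + k

@[fun_prop] theorem Dfn.natPair {f g : X → M.D .nat} (hf : Dfn M f) (hg : Dfn M g) :
    Dfn M fun x => Str.pair (f x) (g x) := by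
  unfold Str.pair; fun_prop

theorem isPair_pair (m k : M.D .nat) : IsPair (Str.pair m k) m k := by
  obtain ⟨c, hc⟩ : ∃ c, 2 * c = (m + k) * (m + k) + 3 * m + k := by
    rcases Str.exists_half (m + k) with ⟨p, -, h⟩ | ⟨n, -, h⟩
    · exact ⟨p * (m + k + 1) + m, by grind⟩
    · exact ⟨n * (m + k) + m, by grind⟩
  refine (bmin_of_lt (P := fun c => 2 * c = (m + k) * (m + k) + 3 * m + k) (by fun_prop)
    (y := c) ?_ hc).2
  rw [← hc]
  exact (le_mul_of_one_le_left (Str.zero_le c) one_le_two).trans_lt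
    (lt_add_of_pos_right _ zero_lt_two)

@[simp] theorem Str.fst_pair (m k : M.D .nat) : Str.fst (Str.pair m k) = m :=
  ((isPair_fst_snd _).unique (isPair_pair m k)).1

@[simp] theorem Str.snd_pair (m k : M.D .nat) : Str.snd (Str.pair m k) = k :=
  ((isPair_fst_snd _).unique (isPair_pair m k)).2

theorem Str.fst_le (c : M.D .nat) : Str.fst c ≤ c := (isPair_fst_snd c).le.1

/-! ### Codes of rational numbers -/

/-- The number `c` codes the rational number `(p - n) / d`. -/
def Codes (c p n d : M.D .nat) : Prop :=
  ∃ m k, IsPair c m k ∧ d = k + 1 ∧ (m = 2 * p ∧ n = 0 ∨ m + 1 = 2 * n ∧ p = 0)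

theorem Codes.unique {c p n d p' n' d' : M.D .nat} (h : Codes c p n d) (h' : Codes c p' n' d') :
    p = p' ∧ n = n' ∧ d = d' := by
  obtain ⟨m, k, hp, rfl, h⟩ := h
  obtain ⟨m', k', hp', rfl, h'⟩ := h'
  obtain ⟨rfl, rfl⟩ := hp.unique hp'
  rcases h with ⟨h₁, rfl⟩ | ⟨h₁, rfl⟩ <;> rcases h' with ⟨h₂, rfl⟩ | ⟨h₂, rfl⟩
  · exact ⟨Str.two_mul_inj (h₁.symm.trans h₂), rfl, rfl⟩
  · rw [h₁] at h₂; exact (Str.two_mul_ne h₂).elim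
  · rw [h₂] at h₁; exact (Str.two_mul_ne h₁).elim
  · exact ⟨rfl, Str.two_mul_inj (h₁.symm.trans h₂), rfl⟩

/-- Positive part of the numerator of a coded rational. -/
noncomputable def numP (c : M.D .nat) : M.D .nat :=
  sel (BEx (Str.fst c + 1) fun p => Str.fst c = 2 * p)
    (bmin (Str.fst c + 1) fun p => Str.fst c = 2 * p) 0

/-- Negative part of the numerator of a coded rational. -/
noncomputable def numN (c : M.D .nat) : M.D .nat :=
  sel (BEx (Str.fst c + 1) fun p => Str.fst c = 2 * p) 0
    (bmin (Str.fst c + 2) fun n => Str.fst c + 1 = 2 * n)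

/-- Denominator of a coded rational. -/
noncomputable def den (c : M.D .nat) : M.D .nat := Str.snd c + 1

@[fun_prop] theorem Dfn.numP {f : X → M.D .nat} (hf : Dfn M f) : Dfn M fun x => numP (f x) := by
  unfold HORM.numP; fun_prop

@[fun_prop] theorem Dfn.numN {f : X → M.D .nat} (hf : Dfn M f) : Dfn M fun x => numN (f x) := by
  unfold HORM.numN; fun_prop

@[fun_prop] theorem Dfn.den {f : X → M.D .nat} (hf : Dfn M f) : Dfn M fun x => den (f x) := by
  unfold HORM.den; fun_prop

theorem codes_num_den (c : M.D .nat) : Codes c (numP c) (numN c) (den c) := by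
  refine ⟨_, _, isPair_fst_snd c, rfl, ?_⟩
  by_cases h : BEx (Str.fst c + 1) fun p => Str.fst c = 2 * p
  · left
    rw [numP, numN, sel_pos h, sel_pos h]
    obtain ⟨p, hp, hp'⟩ := h
    exact ⟨(bmin_of_lt (P := fun p => Str.fst c = 2 * p) (by fun_prop) hp hp').2, rfl⟩
  · right
    rw [numP, numN, sel_neg h, sel_neg h]
    rcases Str.exists_half (Str.fst c) with h' | ⟨n, hn, hn'⟩
    · exact (h h').elim
    · exact ⟨(bmin_of_lt (P := fun n => Str.fst c + 1 = 2 * n) (by fun_prop) hn hn').2, rfl⟩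

/-- The rational numbers in the sense of the model. -/
abbrev Str.Rat (M : Str) [M.IsModel] : Type := FracField (M.D .nat)

noncomputable instance : Coe (M.D .nat) M.Rat := ⟨FracField.cast⟩

theorem den_pos (c : M.D .nat) : 0 < den c := lt_of_le_of_lt (Str.zero_le _) (Str.lt_add_one_iff.2 le_rfl)

theorem cast_den_pos (c : M.D .nat) : 0 < (den c : M.Rat) := FracField.cast_pos.2 (den_pos c)

/-- The rational number with a given code. -/
noncomputable def ratVal (c : M.D .nat) : M.Rat := (numP c - numN c : M.Rat) / den c

/-- A code of the rational number `(p - n) / d`. -/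
noncomputable def ratCode (p n d : M.D .nat) : M.D .nat :=
  sel (d = 0) (Str.pair 0 0) (sel (n ≤ p) (Str.pair (2 * (p - n)) (d - 1))
    (Str.pair (2 * (n - p) - 1) (d - 1)))

theorem Codes.ratVal_eq {c p n d : M.D .nat} (h : Codes c p n d) : ratVal c = (p - n : M.Rat) / d := by
  obtain ⟨h₁, h₂, h₃⟩ := (codes_num_den c).unique h
  rw [ratVal, h₁, h₂, h₃]

theorem ratVal_ratCode (p n d : M.D .nat) : ratVal (ratCode p n d) = (p - n : M.Rat) / d := by
  unfold ratCode
  by_cases hd : d = 0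
  · rw [sel_pos hd, hd]
    have : Codes (Str.pair 0 0 : M.D .nat) 0 0 1 :=
      ⟨0, 0, isPair_pair 0 0, (zero_add _).symm, .inl ⟨(mul_zero _).symm, rfl⟩⟩
    rw [this.ratVal_eq]; simp
  · rw [sel_neg hd]
    have hd' : d = (d - 1) + 1 := (tsub_add_cancel_of_le
      (not_lt.1 fun h => hd (Str.lt_one_iff.1 h))).symm
    rcases le_or_gt n p with h | h
    · rw [sel_pos h]
      have hc : Codes (Str.pair (2 * (p - n)) (d - 1)) (p - n) 0 d :=
        ⟨_, _, isPair_pair _ _, hd', .inl ⟨rfl, rfl⟩⟩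
      have := tsub_add_cancel_of_le h
      rw [hc.ratVal_eq]
      generalize p - n = e at *
      subst this
      simp
    · rw [sel_neg h.not_ge]
      have h1 : 1 ≤ 2 * (n - p) := by
        rw [← zero_add (1 : M.D .nat), Str.add_one_le_iff]
        exact mul_pos zero_lt_two (tsub_pos_of_lt h)
      have hc : Codes (Str.pair (2 * (n - p) - 1) (d - 1)) 0 (n - p) d :=
        ⟨_, _, isPair_pair _ _, hd', .inr ⟨tsub_add_cancel_of_le h1, rfl⟩⟩
      have := tsub_add_cancel_of_le h.le
      rw [hc.ratVal_eq]
      generalize n - p = e at *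
      subst this
      simp

theorem ratVal_surjective : Function.Surjective (ratVal : M.D .nat → M.Rat) := by
  intro q
  obtain ⟨p, n, d, -, rfl⟩ := q.exists_eq_div
  exact ⟨_, ratVal_ratCode p n d⟩

/-- Definable maps into the rationals are those given by definable codes. -/
instance : Obj M M.Rat where
  plot q := ∃ g, Plot M g ∧ ∀ ρ, q ρ = ratVal (g ρ)
  const q := by
    obtain ⟨c, rfl⟩ := ratVal_surjective q
    exact ⟨_, .const c, fun ρ => rfl⟩
  wk := fun ⟨g, hg, h⟩ => ⟨_, hg.wk _, fun ρ => h _⟩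

@[fun_prop] theorem Dfn.ratVal {f : X → M.D .nat} (hf : Dfn M f) : Dfn M fun x => ratVal (f x) :=
  ⟨fun h => ⟨_, hf.plot h, fun _ => rfl⟩⟩

/-- To prove definability of an operation on rationals, codes may be used. -/
theorem Dfn.of_code {Y : Type} [Obj M Y] {f : M.Rat → Y} (h : Dfn M fun c => f (HORM.ratVal c)) :
    Dfn M f :=
  ⟨fun {_ p} ⟨g, hg, hp⟩ => by
    have := h.plot (p := g) hg
    exact (_root_.funext fun ρ => by rw [← hp] : (fun ρ => f (HORM.ratVal (g ρ))) = fun ρ => f (p ρ)) ▸ this⟩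

theorem Dfn.of_code₂ {Y : Type} [Obj M Y] {f : M.Rat → M.Rat → Y}
    (h : Dfn M fun c : M.D .nat × M.D .nat => f (HORM.ratVal c.1) (HORM.ratVal c.2)) :
    Dfn M fun p : M.Rat × M.Rat => f p.1 p.2 :=
  ⟨fun {_ p} ⟨⟨g₁, hg₁, hp₁⟩, ⟨g₂, hg₂, hp₂⟩⟩ => by
    have := h.plot (p := fun ρ => (g₁ ρ, g₂ ρ)) ⟨hg₁, hg₂⟩
    exact (_root_.funext fun ρ => by rw [← hp₁, ← hp₂] :
      (fun ρ => f (HORM.ratVal (g₁ ρ)) (HORM.ratVal (g₂ ρ))) = fun ρ => f (p ρ).1 (p ρ).2) ▸ this⟩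

@[fun_prop] theorem Dfn.cast {f : X → M.D .nat} (hf : Dfn M f) :
    Dfn M fun x => (f x : M.Rat) := by
  have : Dfn M fun x => HORM.ratVal (ratCode (f x) 0 1) := by unfold ratCode; fun_prop
  exact this.congr fun x => by rw [ratVal_ratCode]; simp

theorem Dfn.ratVal_ratCode {p n d : X → M.D .nat} (hp : Dfn M p) (hn : Dfn M n) (hd : Dfn M d) :
    Dfn M fun x => (p x - n x : M.Rat) / d x := by
  have : Dfn M fun x => HORM.ratVal (ratCode (p x) (n x) (d x)) := by unfold ratCode; fun_prop
  exact this.congr fun x => by rw [HORM.ratVal_ratCode]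

@[fun_prop] theorem Dfn.ratAdd {f g : X → M.Rat} (hf : Dfn M f) (hg : Dfn M g) :
    Dfn M fun x => f x + g x := by
  refine (Dfn.of_code₂ (f := fun a b => a + b) ?_).comp (hf.prodMk hg)
  have := Dfn.ratVal_ratCode (M := M) (X := M.D .nat × M.D .nat)
    (p := fun c => HORM.numP c.1 * HORM.den c.2 + HORM.numP c.2 * HORM.den c.1)
    (n := fun c => HORM.numN c.1 * HORM.den c.2 + HORM.numN c.2 * HORM.den c.1)
    (d := fun c => HORM.den c.1 * HORM.den c.2) (by fun_prop) (by fun_prop) (by fun_prop)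
  refine this.congr fun c => ?_
  have h₁ := (cast_den_pos c.1).ne'
  have h₂ := (cast_den_pos c.2).ne'
  simp only [HORM.ratVal, map_add, map_mul]
  field_simp
  ring

@[fun_prop] theorem Dfn.ratMul {f g : X → M.Rat} (hf : Dfn M f) (hg : Dfn M g) :
    Dfn M fun x => f x * g x := by
  refine (Dfn.of_code₂ (f := fun a b => a * b) ?_).comp (hf.prodMk hg)
  have := Dfn.ratVal_ratCode (M := M) (X := M.D .nat × M.D .nat)
    (p := fun c => HORM.numP c.1 * HORM.numP c.2 + HORM.numN c.1 * HORM.numN c.2)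
    (n := fun c => HORM.numP c.1 * HORM.numN c.2 + HORM.numN c.1 * HORM.numP c.2)
    (d := fun c => HORM.den c.1 * HORM.den c.2) (by fun_prop) (by fun_prop) (by fun_prop)
  refine this.congr fun c => ?_
  have h₁ := (cast_den_pos c.1).ne'
  have h₂ := (cast_den_pos c.2).ne'
  simp only [HORM.ratVal, map_add, map_mul]
  field_simp
  ring

@[fun_prop] theorem Dfn.ratNeg {f : X → M.Rat} (hf : Dfn M f) : Dfn M fun x => - f x :=
  ((Dfn.const (-1)).ratMul hf).congr fun x => by ring

@[fun_prop] theorem Dfn.ratSub {f g : X → M.Rat} (hf : Dfn M f) (hg : Dfn M g) :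
    Dfn M fun x => f x - g x :=
  (hf.ratAdd hg.ratNeg).congr fun x => by ring

@[fun_prop] theorem Dfn.ratLe {f g : X → M.Rat} (hf : Dfn M f) (hg : Dfn M g) :
    Dfn M fun x => f x ≤ g x := by
  refine (Dfn.of_code₂ (f := fun a b => a ≤ b) ?_).comp (hf.prodMk hg)
  have : Dfn M fun c : M.D .nat × M.D .nat => HORM.numP c.1 * HORM.den c.2 + HORM.numN c.2 * HORM.den c.1
      ≤ HORM.numP c.2 * HORM.den c.1 + HORM.numN c.1 * HORM.den c.2 := by fun_prop
  refine this.congr fun c => propext ?_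
  rw [HORM.ratVal, HORM.ratVal, div_le_div_iff₀ (cast_den_pos _) (cast_den_pos _)]
  refine Iff.trans ?_ (FracField.cast_le (N := M.D .nat))
  simp only [map_add, map_mul]
  constructor <;> intro h <;> linarith

@[fun_prop] theorem Dfn.ratLt {f g : X → M.Rat} (hf : Dfn M f) (hg : Dfn M g) :
    Dfn M fun x => f x < g x :=
  (hg.ratLe hf).not.congr fun x => by rw [not_le]

@[fun_prop] theorem Dfn.ratEq {f g : X → M.Rat} (hf : Dfn M f) (hg : Dfn M g) :
    Dfn M fun x => f x = g x :=
  ((hf.ratLe hg).and (hg.ratLe hf)).congr fun _ => propext le_antisymm_iff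

@[fun_prop] theorem Dfn.ratSel {P : X → Prop} {f g : X → M.Rat} (hP : Dfn M P) (hf : Dfn M f)
    (hg : Dfn M g) : Dfn M fun x => HORM.sel (P x) (f x) (g x) :=
  ⟨fun {Γ p} h => by
    obtain ⟨c, hc, hc'⟩ := hf.plot h
    obtain ⟨d, hd, hd'⟩ := hg.plot h
    have : Dfn M fun x : Prop × M.D .nat × M.D .nat => HORM.ratVal (HORM.sel x.1 x.2.1 x.2.2) := by
      fun_prop
    have := this.plot (p := fun ρ => (P (p ρ), c ρ, d ρ)) ⟨hP.plot h, hc, hd⟩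
    refine (_root_.funext fun ρ => ?_ : _ = fun ρ => HORM.sel (P (p ρ)) (f (p ρ)) (g (p ρ))) ▸ this
    dsimp only
    by_cases hp : P (p ρ)
    · rw [sel_pos hp, sel_pos hp]; exact (hc' ρ).symm
    · rw [sel_neg hp, sel_neg hp]; exact (hd' ρ).symm⟩

@[fun_prop] theorem Dfn.ratMax {f g : X → M.Rat} (hf : Dfn M f) (hg : Dfn M g) :
    Dfn M fun x => max (f x) (g x) :=
  (Dfn.ratSel (hf.ratLe hg) hg hf).congr fun x => by
    by_cases h : f x ≤ g x
    · rw [sel_pos h, max_eq_right h]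
    · rw [sel_neg h, max_eq_left (not_le.1 h).le]

@[fun_prop] theorem Dfn.ratMin {f g : X → M.Rat} (hf : Dfn M f) (hg : Dfn M g) :
    Dfn M fun x => min (f x) (g x) :=
  (Dfn.ratSel (hf.ratLe hg) hf hg).congr fun x => by
    by_cases h : f x ≤ g x
    · rw [sel_pos h, min_eq_left h]
    · rw [sel_neg h, min_eq_right (not_le.1 h).le]

@[fun_prop] theorem Dfn.divCast {f : X → M.Rat} {n : X → M.D .nat} (hf : Dfn M f) (hn : Dfn M n) :
    Dfn M fun x => f x / (n x : M.Rat) := by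
  have := Dfn.ratVal_ratCode (M := M) (X := X) (p := fun _ => 1) (n := fun _ => 0)
    (Dfn.const _) (Dfn.const _) hn
  refine (hf.ratMul this).congr fun x => ?_
  simp [div_eq_mul_inv]

/-- The least code of a rational number. -/
noncomputable def codeOf (q : M.Rat) : M.D .nat :=
  bmin ((ratVal_surjective q).choose + 1) fun c => ratVal c = q

theorem ratVal_codeOf (q : M.Rat) : ratVal (codeOf q) = q :=
  (bmin_of_lt (P := fun c => ratVal c = q) (by fun_prop)
    (Str.lt_add_one_iff.2 le_rfl) (ratVal_surjective q).choose_spec).2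

theorem codeOf_le {q : M.Rat} {c : M.D .nat} (h : ratVal c = q) : codeOf q ≤ c :=
  not_lt.1 fun hlt => (bmin_spec (P := fun c => ratVal c = q) (by fun_prop) _).2.1 c hlt h

@[fun_prop] theorem Dfn.codeOf {f : X → M.Rat} (hf : Dfn M f) : Dfn M fun x => codeOf (f x) := by
  refine (Dfn.of_code (f := fun q => HORM.codeOf q) ?_).comp hf
  have : Dfn M fun c : M.D .nat => HORM.bmin (c + 1) fun c' => HORM.ratVal c' = HORM.ratVal c := by
    fun_prop
  refine this.congr fun c => ?_
  obtain ⟨h₁, h₂⟩ := bmin_of_lt (P := fun c' => HORM.ratVal c' = HORM.ratVal c) (by fun_prop)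
    (Str.lt_add_one_iff.2 le_rfl : c < c + 1) rfl
  refine (codeOf_le h₂).antisymm (not_lt.1 fun hlt => ?_)
  exact (bmin_spec (P := fun c' => HORM.ratVal c' = HORM.ratVal c) (by fun_prop) (c + 1)).2.1 _ hlt
    (ratVal_codeOf _)

/-- The sequence of codes of a definable sequence of rationals. -/
noncomputable def seqOf (g : M.D .nat → M.Rat) : M.D .one := lam fun n => codeOf (g n)

@[fun_prop] theorem Dfn.seqOf {g : X → M.D .nat → M.Rat}
    (hg : Dfn M fun p : X × M.D .nat => g p.1 p.2) : Dfn M fun x => seqOf (g x) := by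
  unfold HORM.seqOf; fun_prop

theorem ratVal_seqOf {g : M.D .nat → M.Rat} (hg : Dfn M g) (n : M.D .nat) :
    ratVal (M.app (seqOf g) n) = g n := by
  rw [seqOf, lam_app (by fun_prop), ratVal_codeOf]

/-! ### Powers of two -/

/-- The power `2^n` in the model. -/
noncomputable def Str.pow2 (n : M.D .nat) : M.D .nat := nrec (fun _ r => r + r) 1 n

@[fun_prop] theorem Dfn.pow2 {f : X → M.D .nat} (hf : Dfn M f) : Dfn M fun x => Str.pow2 (f x) := by
  unfold Str.pow2; fun_prop

@[simp] theorem Str.pow2_zero : Str.pow2 (0 : M.D .nat) = 1 := nrec_zero _ _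

theorem Str.pow2_succ (n : M.D .nat) : Str.pow2 (n + 1) = 2 * Str.pow2 n := by
  rw [Str.pow2, nrec_succ (by fun_prop), two_mul]; rfl

theorem Str.pow2_add (m n : M.D .nat) : Str.pow2 (m + n) = Str.pow2 m * Str.pow2 n := by
  refine Str.induction (P := fun n => Str.pow2 (m + n) = Str.pow2 m * Str.pow2 n) (by fun_prop)
    (by simp) (fun n hn => ?_) n
  rw [← add_assoc, Str.pow2_succ, Str.pow2_succ, hn]; ring

theorem Str.lt_pow2 (n : M.D .nat) : n < Str.pow2 n := by
  refine Str.induction (P := fun n => n < Str.pow2 n) (by fun_prop) (by simp) (fun n hn => ?_) n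
  rw [Str.pow2_succ, two_mul]
  exact add_lt_add_of_lt_of_le hn
    (by rw [← zero_add (1 : M.D .nat), Str.add_one_le_iff]; exact (Str.zero_le n).trans_lt hn)

theorem Str.pow2_pos (n : M.D .nat) : 0 < Str.pow2 n := (Str.zero_le n).trans_lt (Str.lt_pow2 n)

theorem Tm.eval_pow2 {Γ : Ctx} (t : Tm Γ .nat) (ρ : Env M.D Γ) :
    (Tm.pow2 t).eval M ρ = Str.pow2 (t.eval M ρ) := by
  have : (Tm.Lam .nat fun _ => Tm.Lam .nat fun r => r +ₕ r : Tm Γ (.arr .nat .one)).eval M ρ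
      = HORM.lam fun _ => HORM.lam fun r => r + r := by
    refine Str.funext fun k => Str.funext fun r => ?_
    rw [lam_app (by fun_prop), lam_app (by fun_prop)]
    simp
  rw [Str.pow2, nrec, ← this]; rfl

/-- The rational number `2^{-n}`. -/
noncomputable def eps (n : M.D .nat) : M.Rat := 1 / (Str.pow2 n : M.Rat)

@[fun_prop] theorem Dfn.eps {f : X → M.D .nat} (hf : Dfn M f) : Dfn M fun x => eps (f x) := by
  unfold HORM.eps; fun_prop

theorem cast_pow2_pos (n : M.D .nat) : 0 < (Str.pow2 n : M.Rat) :=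
  FracField.cast_pos.2 (Str.pow2_pos n)

theorem eps_pos (n : M.D .nat) : 0 < eps n := one_div_pos.2 (cast_pow2_pos n)

@[simp] theorem eps_zero : eps (0 : M.D .nat) = 1 := by simp [eps]

theorem eps_add (m n : M.D .nat) : eps (m + n) = eps m * eps n := by
  simp [eps, Str.pow2_add, mul_comm]

theorem eps_succ (n : M.D .nat) : eps (n + 1) = eps n / 2 := by
  simp [eps, Str.pow2_succ, div_eq_mul_inv, mul_comm, map_ofNat FracField.cast]

theorem eps_mul_pow2 (n : M.D .nat) : eps n * (Str.pow2 n : M.Rat) = 1 :=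
  one_div_mul_cancel (cast_pow2_pos n).ne'

theorem eps_le_one (n : M.D .nat) : eps n ≤ 1 := by
  refine Str.induction (P := fun n => eps n ≤ 1) (by fun_prop) (by simp) (fun n hn => ?_) n
  rw [eps_succ]; linarith [eps_pos n]

theorem eps_anti {m n : M.D .nat} (h : m ≤ n) : eps n ≤ eps m := by
  obtain ⟨k, rfl⟩ := exists_add_of_le h
  rw [eps_add]
  exact mul_le_of_le_one_right (eps_pos m).le (eps_le_one k)

theorem exists_eps_lt {q : M.Rat} (hq : 0 < q) : ∃ n, eps n < q := by
  obtain ⟨p, n, d, hd, rfl⟩ := q.exists_eq_div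
  have hd' : (0 : M.Rat) < d := FracField.cast_pos.2 hd
  refine ⟨d, ?_⟩
  have h₁ : (1 : M.Rat) ≤ p - n := by
    have : (n : M.Rat) < p := by
      by_contra h
      exact hq.not_ge (div_nonpos_of_nonpos_of_nonneg (by linarith) hd'.le)
    have := FracField.cast_le.2 (Str.add_one_le_iff.2 (FracField.cast_lt.1 this))
    simp only [map_add, map_one] at this
    linarith
  have h₂ : (d : M.Rat) < Str.pow2 d := FracField.cast_lt.2 (Str.lt_pow2 d)
  calc eps d < 1 / (d : M.Rat) := one_div_lt_one_div_of_lt hd' h₂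
    _ ≤ _ := div_le_div_of_nonneg_right h₁ hd'.le

/-! ### The meaning of the formulas about real numbers -/

/-- In the given assignment, the terms `F` stand for the rational number `q`. -/
structure Frac.Is {Γ : Ctx} (F : Frac Γ) (ρ : Env M.D Γ) (q : M.Rat) : Prop where
  pos : 0 < F.d.eval M ρ
  eq : q = (F.p.eval M ρ - F.n.eval M ρ : M.Rat) / F.d.eval M ρ

namespace Frac.Is

variable {Γ : Ctx} {F G : Frac Γ} {ρ : Env M.D Γ} {q r : M.Rat}

theorem wk (hF : F.Is ρ q) {σ : Ty} (x : M.D σ) : (F.wk σ).Is (ρ.cons x) q :=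
  ⟨by simpa [Frac.wk] using hF.pos, by simpa [Frac.wk] using hF.eq⟩

theorem add (hF : F.Is ρ q) (hG : G.Is ρ r) : (F.add G).Is ρ (q + r) := by
  have h₁ := (FracField.cast_pos.2 hF.pos).ne'
  have h₂ := (FracField.cast_pos.2 hG.pos).ne'
  refine ⟨mul_pos hF.pos hG.pos, ?_⟩
  rw [hF.eq, hG.eq]
  simp only [Frac.add, Tm.eval_add, Tm.eval_mul, map_add, map_mul]
  field_simp
  ring

theorem neg (hF : F.Is ρ q) : Frac.Is ⟨F.n, F.p, F.d⟩ ρ (-q) :=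
  ⟨hF.pos, by rw [hF.eq]; ring⟩

theorem sub (hF : F.Is ρ q) (hG : G.Is ρ r) : (F.sub G).Is ρ (q - r) := by
  rw [sub_eq_add_neg]; exact hF.add hG.neg

theorem sat_lt (hF : F.Is ρ q) (hG : G.Is ρ r) : (F.lt G).sat M ρ ↔ q < r := by
  rw [hF.eq, hG.eq, div_lt_div_iff₀ (FracField.cast_pos.2 hF.pos) (FracField.cast_pos.2 hG.pos),
    Frac.lt, Fm.sat_lt, Str.lt_def]
  refine (FracField.cast_lt (N := M.D .nat)).symm.trans ?_
  simp only [Tm.eval_add, Tm.eval_mul, map_add, map_mul]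
  constructor <;> intro h <;> linarith

theorem sat_absLt (hF : F.Is ρ q) (hG : G.Is ρ r) : (F.absLt G).sat M ρ ↔ |q| < r := by
  rw [Frac.absLt, Fm.sat_and, hF.sat_lt hG, hF.neg.sat_lt hG, abs_lt, and_comm, neg_lt]

theorem sat_absLe (hF : F.Is ρ q) (hG : G.Is ρ r) : (F.absLe G).sat M ρ ↔ |q| ≤ r := by
  rw [Frac.absLe, Fm.sat_and, Fm.sat_neg, Fm.sat_neg, hG.sat_lt hF, hG.sat_lt hF.neg, abs_le,
    and_comm, neg_le, not_lt, not_lt]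

theorem eps (n : Tm Γ .nat) (ρ : Env M.D Γ) : (Frac.eps n).Is ρ (HORM.eps (n.eval M ρ)) :=
  ⟨by simp only [Frac.eps, Tm.eval_pow2]; exact Str.pow2_pos _,
    by simp [Frac.eps, Tm.eval_pow2, HORM.eps]⟩

theorem eps2 (n : Tm Γ .nat) (ρ : Env M.D Γ) : (Frac.eps2 n).Is ρ (2 * HORM.eps (n.eval M ρ)) :=
  ⟨by simp only [Frac.eps2, Tm.eval_pow2]; exact Str.pow2_pos _,
    by simp [Frac.eps2, Tm.eval_pow2, HORM.eps, Tm.two, one_add_one_eq_two, div_eq_mul_inv,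
      map_ofNat FracField.cast]⟩

end Frac.Is

theorem sat_codes {Γ : Ctx} (q : Tm Γ .nat) (F : Frac Γ) (ρ : Env M.D Γ) :
    (codes q F).sat M ρ ↔ Codes (q.eval M ρ) (F.p.eval M ρ) (F.n.eval M ρ) (F.d.eval M ρ) := by
  simp only [codes, Codes, IsPair, Fm.sat_Ex, Fm.sat_and, Fm.sat_or, Fm.sat_eq, Tm.eval_add,
    Tm.eval_mul, Tm.eval_wk, Tm.eval_var_z, Tm.two, Tm.eval_one, Tm.eval_zero,
    one_add_one_eq_two, two_add_one_eq_three]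

theorem sat_withRat {Γ : Ctx} {q : Tm Γ .nat}
    {f : Frac (.nat :: .nat :: .nat :: Γ) → Fm (.nat :: .nat :: .nat :: Γ)} {ρ : Env M.D Γ}
    {P : Prop} {r : M.Rat} (hr : ratVal (q.eval M ρ) = r)
    (h : ∀ (p n d : M.D .nat) (F : Frac (.nat :: .nat :: .nat :: Γ)),
      F.Is (((ρ.cons p).cons n).cons d) r →
      ((f F).sat M (((ρ.cons p).cons n).cons d) ↔ P)) : (withRat q f).sat M ρ ↔ P := by
  simp only [withRat, Fm.sat_Ex, Fm.sat_and, sat_codes, Tm.eval_wk, Tm.eval_var_z]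
  have hI : ∀ p n d : M.D .nat, Codes (q.eval M ρ) p n d →
      Frac.Is ⟨.wk .nat (.wk .nat (.var .z)), .wk .nat (.var .z), .var .z⟩
        (((ρ.cons p).cons n).cons d) r := by
    intro p n d hc
    refine ⟨?_, ?_⟩
    · simp only [Tm.eval_var_z]
      rw [(hc.unique (codes_num_den _)).2.2]
      exact den_pos _
    · simp only [Tm.eval_wk, Tm.eval_var_z]
      rw [← hr, hc.ratVal_eq]
  constructor
  · rintro ⟨p, n, d, hc, hf⟩
    exact (h _ _ _ _ (hI p n d hc)).1 hf
  · exact fun hP => ⟨_, _, _, codes_num_den _, (h _ _ _ _ (hI _ _ _ (codes_num_den _))).2 hP⟩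

/-- The `n`-th rational approximation of `x`. -/
noncomputable abbrev apx (x : M.D .one) (n : M.D .nat) : M.Rat := ratVal (x n)

/-- `x` is a real number. -/
def IsReal (x : M.D .one) : Prop := ∀ n i, |apx x n - apx x (n + i)| < eps n

/-- `x =_ℝ y`. -/
def RealEq (x y : M.D .one) : Prop := ∀ n, |apx x n - apx y n| ≤ 2 * eps n

/-- `x <_ℝ y`. -/
def RealLt (x y : M.D .one) : Prop := ∃ n, apx x n + 2 * eps n < apx y n

/-- `|x - y| <_ℝ r`. -/
def DistLt (x y r : M.D .one) : Prop :=
  ∃ n, |apx x (n + 1) - apx y (n + 1)| < apx r n - 2 * eps n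

/-- The real number given by a rational. -/
noncomputable def ofRat (q : M.Rat) : M.D .one := seqOf fun _ => q

@[simp] theorem apx_ofRat (q : M.Rat) (n : M.D .nat) : apx (ofRat q) n = q :=
  ratVal_seqOf (Dfn.const q) n

section

variable {Γ : Ctx} (ρ : Env M.D Γ)

@[simp] theorem sat_isReal (x : Tm Γ .one) : (isReal x).sat M ρ ↔ IsReal (x.eval M ρ) := by
  rw [isReal, Fm.sat_All]
  refine forall_congr' fun n => ?_
  rw [Fm.sat_All]
  refine forall_congr' fun i => ?_
  refine sat_withRat (r := apx (x.eval M ρ) n) (by simp) fun p₁ n₁ d₁ F hF => ?_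
  refine sat_withRat (r := apx (x.eval M ρ) (n + i)) (by simp) fun p₂ n₂ d₂ G hG => ?_
  refine (((hF.wk _).wk _).wk _ |>.sub hG).sat_absLt (r := eps n) ?_
  convert Frac.Is.eps _ _ using 2
  simp

@[simp] theorem sat_realEq (x y : Tm Γ .one) :
    (realEq x y).sat M ρ ↔ RealEq (x.eval M ρ) (y.eval M ρ) := by
  rw [realEq, Fm.sat_All]
  refine forall_congr' fun n => ?_
  refine sat_withRat (r := apx (x.eval M ρ) n) (by simp) fun p₁ n₁ d₁ F hF => ?_
  refine sat_withRat (r := apx (y.eval M ρ) n) (by simp) fun p₂ n₂ d₂ G hG => ?_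
  refine (((hF.wk _).wk _).wk _ |>.sub hG).sat_absLe (r := 2 * eps n) ?_
  convert Frac.Is.eps2 _ _ using 3
  simp

@[simp] theorem sat_realLt (x y : Tm Γ .one) :
    (realLt x y).sat M ρ ↔ RealLt (x.eval M ρ) (y.eval M ρ) := by
  rw [realLt, Fm.sat_Ex]
  refine exists_congr fun n => ?_
  refine sat_withRat (r := apx (x.eval M ρ) n) (by simp) fun p₁ n₁ d₁ F hF => ?_
  refine sat_withRat (r := apx (y.eval M ρ) n) (by simp) fun p₂ n₂ d₂ G hG => ?_
  refine (((hF.wk _).wk _).wk _ |>.add (r := 2 * eps n) ?_).sat_lt hG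
  convert Frac.Is.eps2 _ _ using 3
  simp

@[simp] theorem sat_distLt (x y r : Tm Γ .one) :
    (distLt x y r).sat M ρ ↔ DistLt (x.eval M ρ) (y.eval M ρ) (r.eval M ρ) := by
  rw [distLt, Fm.sat_Ex]
  refine exists_congr fun n => ?_
  refine sat_withRat (r := apx (x.eval M ρ) (n + 1)) (by simp) fun p₁ n₁ d₁ F hF => ?_
  refine sat_withRat (r := apx (y.eval M ρ) (n + 1)) (by simp) fun p₂ n₂ d₂ G hG => ?_
  refine sat_withRat (r := apx (r.eval M ρ) n) (by simp) fun p₃ n₃ d₃ H hH => ?_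
  refine (((((hF.wk _).wk _).wk _).wk _).wk _ |>.wk _ |>.sub
    (((hG.wk _).wk _).wk _)).sat_absLt (hH.sub (r := 2 * eps n) ?_)
  convert Frac.Is.eps2 _ _ using 3
  simp

@[simp] theorem apx_ratReal (q : Tm Γ .nat) (n : M.D .nat) :
    apx ((ratReal q).eval M ρ) n = ratVal (q.eval M ρ) := by
  rw [apx, ratReal, Tm.eval_const]

@[simp] theorem apx_real0 (n : M.D .nat) : apx ((real0 : Tm Γ .one).eval M ρ) n = 0 := by
  rw [real0, apx_ratReal]
  have : Codes (0 : M.D .nat) 0 0 1 := ⟨0, 0, by simp [IsPair], by simp, .inl ⟨by simp, rfl⟩⟩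
  rw [Tm.eval_zero, this.ratVal_eq]; simp

@[simp] theorem apx_real1 (n : M.D .nat) : apx ((real1 : Tm Γ .one).eval M ρ) n = 1 := by
  rw [real1, apx_ratReal]
  have : Codes ((1 + 1) + (1 + 1) + 1 : M.D .nat) 1 0 1 :=
    ⟨2, 0, by unfold IsPair; ring, by simp, .inl ⟨by simp, rfl⟩⟩
  simp only [Tm.two, Tm.eval_add, Tm.eval_one]
  rw [this.ratVal_eq]; simp

@[simp] theorem sat_AllReal (f : Tm (.one :: Γ) .one → Fm (.one :: Γ)) :
    (AllReal f).sat M ρ ↔ ∀ x, IsReal x → (f (.var .z)).sat M (ρ.cons x) := by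
  simp [AllReal]

end

/-! ### The meaning of the principles -/

/-- `Φ` is a function from reals to reals. -/
structure IsRealFun (Φ : M.D (.arr .one .one)) : Prop where
  real : ∀ x, IsReal x → IsReal (Φ x)
  eq : ∀ x, IsReal x → ∀ y, IsReal y → RealEq x y → RealEq (Φ x) (Φ y)

/-- `x >_ℝ 0`. -/
def Pos (x : M.D .one) : Prop := ∃ n, 2 * eps n < apx x n

/-- `Y` represents an open set. -/
structure IsOpenSet (Y : M.D (.arr .one .one)) : Prop where
  fn : IsRealFun Y
  ball : ∀ x, IsReal x → Pos (Y x) → ∃ r : M.Rat, 0 < r ∧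
    ∀ y, IsReal y → (∃ n, |apx x (n + 1) - apx y (n + 1)| < r - 2 * eps n) → Pos (Y y)

/-- `Y` represents the complement of a closed subset of the unit interval. -/
structure ClosedInUnit (Y : M.D (.arr .one .one)) : Prop where
  isOpen : IsOpenSet Y
  sub : ∀ x, IsReal x → ¬ Pos (Y x) → ∀ n, -(2 * eps n) ≤ apx x n ∧ apx x n ≤ 1 + 2 * eps n

/-- `x ∈ (a_n, b_n)`. -/
def InInterval (a b : M.D (.arr .nat .one)) (n : M.D .nat) (x : M.D .one) : Prop :=
  RealLt (a n) x ∧ RealLt x (b n)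

/-- The semantic content of `HBC`. -/
def Str.SatHBC (M : Str) [M.IsModel] : Prop :=
  ∀ (Y : M.D (.arr .one .one)) (a b : M.D (.arr .nat .one)), ClosedInUnit Y →
    (∀ n, IsReal (a n) ∧ IsReal (b n)) →
    (∀ x, IsReal x → ¬ Pos (Y x) → ∃ n, InInterval a b n x) →
    ∃ N, ∀ x, IsReal x → ¬ Pos (Y x) → ∃ n ≤ N, InInterval a b n x

/-- The semantic content of `HBUclosed`. -/
def Str.SatHBU (M : Str) [M.IsModel] : Prop :=
  ∀ Y Ψ : M.D (.arr .one .one), ClosedInUnit Y → IsRealFun Ψ →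
    (∀ x, IsReal x → Pos (Ψ x)) →
    ∃ (y : M.D (.arr .nat .one)) (k : M.D .nat), (∀ i < k, IsReal (y i) ∧ ¬ Pos (Y (y i))) ∧
      ∀ x, IsReal x → ¬ Pos (Y x) → ∃ i < k, DistLt x (y i) (Ψ (y i))

/-- The code of the binary string of the first `n` values of `f`. -/
noncomputable def initSeg (f : M.D .one) (n : M.D .nat) : M.D .nat :=
  nrec (fun k s => s + s + f k) 1 n

@[fun_prop] theorem Dfn.initSeg {f : X → M.D .one} {n : X → M.D .nat} (hf : Dfn M f)
    (hn : Dfn M n) : Dfn M fun x => initSeg (f x) (n x) := by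
  unfold HORM.initSeg; fun_prop

@[simp] theorem initSeg_zero (f : M.D .one) : initSeg f 0 = 1 := nrec_zero _ _

theorem initSeg_succ (f : M.D .one) (n : M.D .nat) :
    initSeg f (n + 1) = 2 * initSeg f n + f n := by
  rw [initSeg, nrec_succ (by fun_prop), two_mul]; rfl

/-- `f` is a binary sequence. -/
def IsBinary (f : M.D .one) : Prop := ∀ n, f n < 2

@[simp] theorem eval_initSeg {Γ : Ctx} (f : Tm Γ .one) (n : Tm Γ .nat) (ρ : Env M.D Γ) :
    (Tm.initSeg f n).eval M ρ = initSeg (f.eval M ρ) (n.eval M ρ) := by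
  have : (Tm.Lam .nat fun k => Tm.Lam .nat fun s => s +ₕ s +ₕ .at f k :
      Tm Γ (.arr .nat .one)).eval M ρ = lam fun k => lam fun s => s + s + (f.eval M ρ) k := by
    refine Str.funext fun k => Str.funext fun r => ?_
    rw [lam_app (by fun_prop), lam_app (by fun_prop)]
    simp
  rw [initSeg, nrec, ← this]; rfl

/-- The semantic content of `WKL`. -/
def Str.SatWKL (M : Str) [M.IsModel] : Prop :=
  ∀ T : M.D .one, (∀ c, IsBinary c → ∀ n, T (initSeg c (n + 1)) = 0 → T (initSeg c n) = 0) →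
    (∀ n, ∃ c, IsBinary c ∧ T (initSeg c n) = 0) →
    ∃ f, IsBinary f ∧ ∀ n, T (initSeg f n) = 0

section

variable {Γ : Ctx} (ρ : Env M.D Γ)

@[simp] theorem sat_isRealFun (Φ : Tm Γ (.arr .one .one)) :
    (isRealFun Φ).sat M ρ ↔ IsRealFun (Φ.eval M ρ) := by
  simp only [isRealFun, Fm.sat_and, sat_AllReal, Fm.sat_imp, sat_isReal, sat_realEq, Tm.eval_app,
    Tm.eval_wk, Tm.eval_var_z]
  exact ⟨fun h => ⟨h.1, h.2⟩, fun h => ⟨h.1, h.2⟩⟩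

@[simp] theorem realLt_real0 (x : M.D .one) :
    RealLt ((real0 : Tm Γ .one).eval M ρ) x ↔ Pos x := by
  simp [RealLt, Pos]

@[simp] theorem sat_isBinary (f : Tm Γ .one) :
    (isBinary f).sat M ρ ↔ IsBinary (f.eval M ρ) := by
  simp [isBinary, IsBinary, Tm.two, one_add_one_eq_two]

@[simp] theorem pos_ratReal (q : Tm Γ .nat) :
    Pos ((ratReal q).eval M ρ) ↔ 0 < ratVal (q.eval M ρ) := by
  simp only [Pos, apx_ratReal]
  constructor
  · rintro ⟨n, hn⟩
    linarith [eps_pos n]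
  · intro h
    obtain ⟨n, hn⟩ := exists_eps_lt (half_pos h)
    exact ⟨n, by linarith⟩

@[simp] theorem sat_isOpenSet (Y : Tm Γ (.arr .one .one)) :
    (isOpenSet Y).sat M ρ ↔ IsOpenSet (Y.eval M ρ) := by
  simp only [isOpenSet, Fm.sat_and, sat_isRealFun, sat_AllReal, Fm.sat_imp, memSet, sat_realLt,
    realLt_real0, Tm.eval_app, Tm.eval_wk, Tm.eval_var_z, Fm.sat_Ex, sat_distLt, DistLt,
    apx_ratReal, pos_ratReal]
  exact ⟨fun h => ⟨h.1, fun x hx hY => (h.2 x hx hY).imp' ratVal fun r hr => hr⟩,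
    fun h => ⟨h.1, fun x hx hY => by
      obtain ⟨q, hq⟩ := h.2 x hx hY
      obtain ⟨r, rfl⟩ := ratVal_surjective q
      exact ⟨r, hq⟩⟩⟩

@[simp] theorem sat_closedInUnit (Y : Tm Γ (.arr .one .one)) :
    (closedInUnit Y).sat M ρ ↔ ClosedInUnit (Y.eval M ρ) := by
  simp only [closedInUnit, Fm.sat_and, sat_isOpenSet, sat_AllReal, Fm.sat_imp, memCompl, memSet,
    realLt_real0, Tm.eval_app, Tm.eval_wk, Tm.eval_var_z, realLe, Fm.sat_neg, sat_realLt]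
  simp only [RealLt, apx_real0, apx_real1, not_exists, not_lt, ← forall_and]
  have : ∀ q e : M.Rat, (0 ≤ q + 2 * e ∧ q ≤ 1 + 2 * e) ↔ (-(2 * e) ≤ q ∧ q ≤ 1 + 2 * e) :=
    fun q e => and_congr_left' ⟨fun h => by linarith, fun h => by linarith⟩
  simp only [this]
  exact ⟨fun h => ⟨h.1, fun x hx hY => h.2 x hx hY⟩,
    fun h => ⟨h.1, fun x hx hY => h.2 x hx hY⟩⟩

@[simp] theorem sat_inInterval (x : Tm Γ .one) (a b : Tm Γ (.arr .nat .one)) (n : Tm Γ .nat) :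
    (inInterval x a b n).sat M ρ ↔
      InInterval (a.eval M ρ) (b.eval M ρ) (n.eval M ρ) (x.eval M ρ) := by
  simp [inInterval, InInterval]

theorem sat_HBC (ρ : Env M.D []) : HBC.sat M ρ ↔ M.SatHBC := by
  simp [HBC, Str.SatHBC, memCompl, memSet, Str.lt_add_one_iff]

theorem sat_HBUclosed (ρ : Env M.D []) : HBUclosed.sat M ρ ↔ M.SatHBU := by
  simp [HBUclosed, Str.SatHBU, memCompl, memSet]

theorem sat_WKL (ρ : Env M.D []) : WKL.sat M ρ ↔ M.SatWKL := by
  simp [WKL, Str.SatWKL, isTree]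

end

/-! ### Approximations of reals -/

theorem IsReal.abs_lt {x : M.D .one} (hx : IsReal x) {m n : M.D .nat} (h : m ≤ n) :
    |apx x m - apx x n| < eps m := by
  obtain ⟨i, rfl⟩ := exists_add_of_le h
  exact hx m i

theorem IsReal.of_le {x : M.D .one}
    (h : ∀ m n, m ≤ n → |apx x m - apx x n| < eps m) : IsReal x :=
  fun _ _ => h _ _ le_self_add

theorem RealLt.eventually {x y : M.D .one} (h : RealLt x y) (hx : IsReal x) (hy : IsReal y)
    {c : M.Rat} (hc : 0 < c) : ∃ s₀, ∀ s ≥ s₀, apx x s + c * eps s < apx y s := by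
  obtain ⟨n, hn⟩ := h
  obtain ⟨k, hk⟩ := exists_eps_lt (div_pos (sub_pos.2 hn) hc)
  rw [lt_div_iff₀ hc] at hk
  refine ⟨max n k, fun s hs => ?_⟩
  have h₁ := _root_.abs_lt.1 (hx.abs_lt ((le_max_left n k).trans hs))
  have h₂ := _root_.abs_lt.1 (hy.abs_lt ((le_max_left n k).trans hs))
  have h₃ := mul_le_mul_of_nonneg_right (eps_anti ((le_max_right n k).trans hs)) hc.le
  linarith [h₁.1, h₁.2, h₂.1, h₂.2]

theorem eps_strictAnti {m n : M.D .nat} (h : m < n) : eps n < eps m := by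
  have := eps_anti (Str.add_one_le_iff.2 h)
  rw [eps_succ] at this
  linarith [eps_pos m]

theorem le_of_eps_le {m n : M.D .nat} (h : eps m ≤ eps n) : n ≤ m :=
  not_lt.1 fun hlt => (eps_strictAnti hlt).not_ge h

theorem Str.snd_le (c : M.D .nat) : Str.snd c ≤ c := (isPair_fst_snd c).le.2

/-! ### Finite maxima -/

/-- The maximum of `0, g 0, …, g (k - 1)`. -/
noncomputable def ratSup (g : M.D .nat → M.Rat) (k : M.D .nat) : M.Rat :=
  ratVal (nrec (fun n r => codeOf (max (ratVal r) (g n))) (codeOf 0) k)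

@[fun_prop] theorem Dfn.ratSup {g : X → M.D .nat → M.Rat} {k : X → M.D .nat}
    (hg : Dfn M fun p : X × M.D .nat => g p.1 p.2) (hk : Dfn M k) :
    Dfn M fun x => ratSup (g x) (k x) := by
  unfold HORM.ratSup
  have : Dfn M fun p : (X × M.D .nat) × M.D .nat => g p.1.1 p.1.2 :=
    hg.comp (f := fun p : (X × M.D .nat) × M.D .nat => p.1) (by fun_prop)
  fun_prop

theorem ratSup_zero (g : M.D .nat → M.Rat) : ratSup g 0 = 0 := by
  rw [ratSup, nrec_zero, ratVal_codeOf]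

section

variable {g : M.D .nat → M.Rat} (hg : Dfn M g)
include hg

theorem ratSup_succ (k : M.D .nat) : ratSup g (k + 1) = max (ratSup g k) (g k) := by
  rw [ratSup, nrec_succ (by fun_prop), ratVal_codeOf]; rfl

theorem ratSup_nonneg (k : M.D .nat) : 0 ≤ ratSup g k := by
  refine Str.induction (P := fun k => 0 ≤ ratSup g k) (by fun_prop) (ratSup_zero g).ge
    (fun n hn => ?_) k
  rw [ratSup_succ hg]
  exact hn.trans (le_max_left _ _)

theorem le_ratSup {n k : M.D .nat} (h : n < k) : g n ≤ ratSup g k := by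
  refine Str.induction (P := fun k => n < k → g n ≤ ratSup g k) (by fun_prop)
    (fun h => (Str.not_lt_zero _ h).elim) (fun k hk h => ?_) k h
  rw [ratSup_succ hg]
  rcases (Str.lt_add_one_iff.1 h).lt_or_eq with h | rfl
  exacts [(hk h).trans (le_max_left _ _), le_max_right _ _]

theorem ratSup_eq (k : M.D .nat) : ratSup g k = 0 ∨ ∃ n < k, ratSup g k = g n := by
  refine Str.induction (P := fun k => ratSup g k = 0 ∨ BEx k fun n => ratSup g k = g n)
    (by fun_prop) (.inl (ratSup_zero g)) (fun k hk => ?_) k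
  rw [ratSup_succ hg]
  rcases le_total (g k) (ratSup g k) with h | h
  · rw [max_eq_left h]
    exact hk.imp_right fun ⟨n, hn, e⟩ => ⟨n, hn.trans (Str.lt_add_one_iff.2 le_rfl), e⟩
  · rw [max_eq_right h]
    exact .inr ⟨k, Str.lt_add_one_iff.2 le_rfl, rfl⟩

theorem ratSup_le {k : M.D .nat} {c : M.Rat} (hc : 0 ≤ c) (h : ∀ n < k, g n ≤ c) :
    ratSup g k ≤ c := by
  rcases ratSup_eq hg k with e | ⟨n, hn, e⟩
  exacts [e ▸ hc, e ▸ h n hn]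

theorem ratSup_lt {k : M.D .nat} {c : M.Rat} (hc : 0 < c) (h : ∀ n < k, g n < c) :
    ratSup g k < c := by
  rcases ratSup_eq hg k with e | ⟨n, hn, e⟩
  exacts [e ▸ hc, e ▸ h n hn]

end

/-! ### `HBU_closed` implies `HBC` -/

/-- The distance of `u` from the complement of `(v, w)`, truncated at `1`. -/
noncomputable def tent (u v w : M.Rat) : M.Rat := max 0 (min 1 (min (u - v) (w - u)))

theorem tent_nonneg (u v w : M.Rat) : 0 ≤ tent u v w := le_max_left _ _

theorem tent_le_one (u v w : M.Rat) : tent u v w ≤ 1 := max_le zero_le_one (min_le_left _ _)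

theorem lt_tent_iff {u v w c : M.Rat} (hc : 0 ≤ c) :
    c < tent u v w ↔ c < 1 ∧ v + c < u ∧ u + c < w := by
  rw [tent, lt_max_iff, lt_min_iff, lt_min_iff, lt_sub_iff_add_lt, lt_sub_iff_add_lt,
    or_iff_right hc.not_gt, add_comm c, add_comm c]

theorem tent_le {u v w u' v' w' d e : M.Rat} (hu : |u - u'| ≤ d) (hv : |v - v'| ≤ e)
    (hw : |w - w'| ≤ e) : tent u v w ≤ tent u' v' w' + (d + e) := by
  have hd := (abs_nonneg _).trans hu
  have he := (abs_nonneg _).trans hv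
  rw [abs_le] at hu hv hw
  by_contra h
  rw [not_le, lt_tent_iff (by linarith [tent_nonneg u' v' w'])] at h
  have : tent u' v' w' < tent u' v' w' := by
    refine (lt_tent_iff (tent_nonneg _ _ _)).2 ⟨?_, ?_, ?_⟩ <;>
      linarith [h.1, h.2.1, h.2.2, hu.1, hu.2, hv.1, hv.2, hw.1, hw.2]
  exact this.false

@[fun_prop] theorem Dfn.tent {u v w : X → M.Rat} (hu : Dfn M u) (hv : Dfn M v) (hw : Dfn M w) :
    Dfn M fun x => tent (u x) (v x) (w x) := by
  unfold HORM.tent; fun_prop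

section

variable (Y : M.D (.arr .one .one)) (a b : M.D (.arr .nat .one))

/-- The `k`-th approximation of `2^{-n}` times the truncated distance of `x` from the complement
of the interval `(a_n, b_n)`. -/
noncomputable def bump (x : M.D .one) (k n : M.D .nat) : M.Rat :=
  eps n * tent (apx x (k + 1)) (apx (a n) (k + 1)) (apx (b n) (k + 1))

/-- The maximum of the functions `bump` for `n ≤ k`, at stage `k`. -/
noncomputable def bumpSup (x : M.D .one) (k : M.D .nat) : M.Rat := ratSup (bump a b x k) (k + 1)

/-- The gauge function to which `HBU_closed` is applied: the maximum of `Y` and the weighted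
distances from the complements of the intervals `(a_n, b_n)`. -/
noncomputable def gauge : M.D (.arr .one .one) :=
  lam fun x => seqOf fun k => max (apx (Y x) k) (bumpSup a b x k)

theorem bump_dfn : Dfn M fun p : (M.D .one × M.D .nat) × M.D .nat => bump a b p.1.1 p.1.2 p.2 := by
  unfold bump; fun_prop

theorem bump_dfn' (x : M.D .one) (k : M.D .nat) : Dfn M (bump a b x k) :=
  (bump_dfn a b).comp (f := fun n : M.D .nat => ((x, k), n)) (by fun_prop)

theorem apx_gauge (x : M.D .one) (k : M.D .nat) :
    apx (M.app (gauge Y a b) x) k = max (apx (Y x) k) (bumpSup a b x k) := by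
  have h : Dfn M fun p : M.D .one × M.D .nat => bumpSup a b p.1 p.2 :=
    Dfn.ratSup (bump_dfn a b) (by fun_prop)
  have h' : Dfn M fun k : M.D .nat => bumpSup a b x k :=
    h.comp (f := fun k : M.D .nat => (x, k)) (by fun_prop)
  rw [apx, gauge, lam_app (by fun_prop), ratVal_seqOf (by fun_prop)]

variable {Y a b}

theorem bump_le_eps (x : M.D .one) (k n : M.D .nat) : bump a b x k n ≤ eps n :=
  mul_le_of_le_one_right (eps_pos n).le (tent_le_one _ _ _)

theorem bump_le_tent (x : M.D .one) (k n : M.D .nat) :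
    bump a b x k n ≤ tent (apx x (k + 1)) (apx (a n) (k + 1)) (apx (b n) (k + 1)) :=
  mul_le_of_le_one_left (tent_nonneg _ _ _) (eps_le_one n)

theorem eps_mul_le {n : M.D .nat} {d : M.Rat} (hd : 0 ≤ d) : eps n * d ≤ d :=
  mul_le_of_le_one_left hd (eps_le_one n)

theorem bump_le_add {x : M.D .one} {k k' n : M.D .nat} {d e : M.Rat} {x' : M.D .one}
    (hx : |apx x (k + 1) - apx x' (k' + 1)| ≤ d)
    (ha : |apx (a n) (k + 1) - apx (a n) (k' + 1)| ≤ e)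
    (hb : |apx (b n) (k + 1) - apx (b n) (k' + 1)| ≤ e) :
    bump a b x k n ≤ bump a b x' k' n + (d + e) := by
  have h := mul_le_mul_of_nonneg_left (tent_le hx ha hb) (eps_pos n).le
  rw [mul_add] at h
  exact h.trans (add_le_add le_rfl (eps_mul_le
    (add_nonneg ((abs_nonneg _).trans hx) ((abs_nonneg _).trans ha))))

/-- A point which is close to `y ∉ Y` in the sense of the gauge lies in one of the intervals. -/
theorem exists_inInterval_of_distLt {x y : M.D .one} (hy : ¬ Pos (Y y))
    (h : DistLt x y (M.app (gauge Y a b) y)) :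
    ∃ n k, n ≤ k ∧ bumpSup a b y k ≤ eps n ∧ InInterval a b n x := by
  obtain ⟨k, hk⟩ := h
  have hyk : apx (Y y) k ≤ 2 * eps k := not_lt.1 fun h => hy ⟨k, h⟩
  have h₀ := abs_nonneg (apx x (k + 1) - apx y (k + 1))
  have hk' : |apx x (k + 1) - apx y (k + 1)| + 2 * eps k < bumpSup a b y k := by
    rw [apx_gauge, lt_sub_iff_add_lt, lt_max_iff] at hk
    exact hk.resolve_left fun h => by linarith
  have hp := eps_pos k
  rcases ratSup_eq (bump_dfn' a b y k) (k + 1) with e | ⟨n, hn, e⟩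
  · rw [bumpSup, e] at hk'
    linarith
  · have e' : bumpSup a b y k = bump a b y k n := e
    refine ⟨n, k, Str.lt_add_one_iff.1 hn, e' ▸ bump_le_eps y k n, ?_⟩
    rw [e'] at hk'
    have h₁ := hk'.trans_le (bump_le_tent y k n)
    rw [lt_tent_iff (by linarith)] at h₁
    obtain ⟨-, h₁, h₂⟩ := h₁
    have h₃ := le_abs_self (apx x (k + 1) - apx y (k + 1))
    have h₄ := neg_abs_le (apx x (k + 1) - apx y (k + 1))
    constructor <;> refine ⟨k + 1, ?_⟩ <;> rw [eps_succ] <;> linarith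

theorem bumpSup_realEq {x y : M.D .one} (h : RealEq x y) (k : M.D .nat) :
    |bumpSup a b x k - bumpSup a b y k| ≤ 2 * eps k := by
  have key : ∀ n, ∀ {x y : M.D .one}, RealEq x y → bump a b x k n ≤ bump a b y k n + 2 * eps k := by
    intro n x y h
    have h₁ := bump_le_add (a := a) (b := b) (n := n) (h (k + 1)) (e := 0)
      (by rw [sub_self, abs_zero]) (by rw [sub_self, abs_zero])
    rw [eps_succ] at h₁
    linarith [eps_pos k]
  have h' : RealEq y x := fun n => by rw [abs_sub_comm]; exact h n
  have hp := eps_pos k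
  have h₀ := ratSup_nonneg (bump_dfn' a b x k) (k + 1)
  have h₀' := ratSup_nonneg (bump_dfn' a b y k) (k + 1)
  rw [abs_sub_le_iff, sub_le_iff_le_add', sub_le_iff_le_add']
  constructor
  · refine ratSup_le (bump_dfn' _ _ _ _) ?_ fun n hn => ?_
    · unfold bumpSup; linarith
    · have := key n h
      have := le_ratSup (bump_dfn' a b y k) hn
      unfold bumpSup; linarith
  · refine ratSup_le (bump_dfn' _ _ _ _) ?_ fun n hn => ?_
    · unfold bumpSup; linarith
    · have := key n h'
      have := le_ratSup (bump_dfn' a b x k) hn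
      unfold bumpSup; linarith

variable (hab : ∀ n, IsReal (a n) ∧ IsReal (b n))
include hab

theorem bumpSup_real {x : M.D .one} (hx : IsReal x) {k k' : M.D .nat} (h : k ≤ k') :
    |bumpSup a b x k - bumpSup a b x k'| < eps k := by
  have hk : k + 1 ≤ k' + 1 := add_le_add_left h 1
  have key : ∀ n, bump a b x k n < bump a b x k' n + eps k ∧
      bump a b x k' n < bump a b x k n + eps k := by
    intro n
    have h₁ := hx.abs_lt hk
    have h₂ := max_lt ((hab n).1.abs_lt hk) ((hab n).2.abs_lt hk)
    rw [eps_succ] at h₁ h₂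
    have h₃ := bump_le_add (a := a) (b := b) (n := n) le_rfl (le_max_left _ _)
      (le_max_right _ _) (x := x) (x' := x) (k := k) (k' := k')
    have h₄ := bump_le_add (a := a) (b := b) (n := n) le_rfl (le_max_left _ _)
      (le_max_right _ _) (x := x) (x' := x) (k := k') (k' := k)
    simp only [abs_sub_comm (apx _ (k' + 1)) (apx _ (k + 1))] at h₄
    constructor <;> linarith
  have h₀ := ratSup_nonneg (bump_dfn' a b x k) (k + 1)
  have h₀' := ratSup_nonneg (bump_dfn' a b x k') (k' + 1)
  rw [abs_sub_lt_iff, sub_lt_iff_lt_add', sub_lt_iff_lt_add']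
  refine ⟨ratSup_lt (bump_dfn' _ _ _ _) (add_pos_of_nonneg_of_pos h₀' (eps_pos _)) fun n hn => ?_,
    ratSup_lt (bump_dfn' _ _ _ _) (add_pos_of_nonneg_of_pos h₀ (eps_pos _)) fun n hn => ?_⟩
  · exact (key n).1.trans_le
      (add_le_add (le_ratSup (bump_dfn' _ _ _ _) (hn.trans_le hk)) le_rfl)
  · rcases lt_or_ge n (k + 1) with h | h
    · exact (key n).2.trans_le (add_le_add (le_ratSup (bump_dfn' _ _ _ _) h) le_rfl)
    · have h₁ := (bump_le_eps (a := a) (b := b) x k' n).trans (eps_anti h)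
      rw [eps_succ] at h₁
      have := eps_pos k
      unfold bumpSup
      linarith

/-- Lower bound for `bumpSup` if `x` is well inside the interval `(a_n, b_n)`. -/
theorem le_bumpSup {x : M.D .one} (hx : IsReal x) {n s k : M.D .nat}
    (h₁ : apx (a n) s + 3 * eps s < apx x s) (h₂ : apx x s + 3 * eps s < apx (b n) s)
    (hn : n ≤ k) (hs : s ≤ k) : eps (n + s) ≤ bumpSup a b x k := by
  refine le_trans ?_ (le_ratSup (bump_dfn' a b x k) (Str.lt_add_one_iff.2 hn))
  rw [eps_add, bump]
  refine mul_le_mul_of_nonneg_left ?_ (eps_pos n).le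
  have hs' : s ≤ k + 1 := hs.trans le_self_add
  have ha := abs_lt.1 ((hab n).1.abs_lt hs')
  have hb := abs_lt.1 ((hab n).2.abs_lt hs')
  have hx := abs_lt.1 (hx.abs_lt hs')
  refine le_max_of_le_right (le_min (eps_le_one s) (le_min ?_ ?_)) <;>
    linarith [ha.1, ha.2, hb.1, hb.2, hx.1, hx.2]

theorem exists_well_inside {x : M.D .one} (hx : IsReal x) {n : M.D .nat}
    (h : InInterval a b n x) :
    ∃ s, apx (a n) s + 3 * eps s < apx x s ∧ apx x s + 3 * eps s < apx (b n) s := by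
  obtain ⟨s₁, h₁⟩ := h.1.eventually (hab n).1 hx (c := 3) (by norm_num)
  obtain ⟨s₂, h₂⟩ := h.2.eventually hx (hab n).2 (c := 3) (by norm_num)
  exact ⟨max s₁ s₂, h₁ _ (le_max_left _ _), h₂ _ (le_max_right _ _)⟩

theorem gauge_isRealFun (hY : IsRealFun Y) : IsRealFun (gauge Y a b) where
  real x hx := by
    refine IsReal.of_le fun m n h => ?_
    rw [apx_gauge, apx_gauge]
    exact (abs_max_sub_max_le_max _ _ _ _).trans_lt
      (max_lt ((hY.real x hx).abs_lt h) (bumpSup_real hab hx h))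
  eq x hx y hy h n := by
    rw [apx_gauge, apx_gauge]
    exact (abs_max_sub_max_le_max _ _ _ _).trans
      (max_le (hY.eq x hx y hy h n) (bumpSup_realEq h n))

theorem gauge_pos (hcov : ∀ x, IsReal x → ¬ Pos (Y x) → ∃ n, InInterval a b n x) {x : M.D .one}
    (hx : IsReal x) : Pos (M.app (gauge Y a b) x) := by
  by_cases h : Pos (Y x)
  · obtain ⟨n, hn⟩ := h
    exact ⟨n, by rw [apx_gauge]; exact hn.trans_le (le_max_left _ _)⟩
  · obtain ⟨n, hn⟩ := hcov x hx h
    obtain ⟨s, h₁, h₂⟩ := exists_well_inside hab hx hn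
    refine ⟨n + s + 1 + 1, ?_⟩
    have := le_bumpSup hab hx h₁ h₂ (k := n + s + 1 + 1)
      (by simp only [add_assoc]; exact le_self_add)
      (by simp only [add_assoc]; exact le_add_left le_self_add)
    rw [apx_gauge, eps_succ, eps_succ]
    refine lt_of_lt_of_le ?_ (le_max_right _ _)
    linarith [eps_pos (n + s)]

end

theorem Str.SatHBU.satHBC (h : M.SatHBU) : M.SatHBC := by
  intro Y a b hY hab hcov
  obtain ⟨y, k, hy, hcov'⟩ := h Y (gauge Y a b) hY (gauge_isRealFun hab hY.isOpen.fn)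
    fun x hx => gauge_pos hab hcov hx
  -- the points `y_i` lie well inside intervals, with a common bound for the witnesses
  obtain ⟨B, hB⟩ := Str.exists_bound (M := M) (k := k) (P := fun i v =>
    apx (a (Str.fst v)) (Str.snd v) + 3 * eps (Str.snd v) < apx (y i) (Str.snd v) ∧
    apx (y i) (Str.snd v) + 3 * eps (Str.snd v) < apx (b (Str.fst v)) (Str.snd v)) (by fun_prop)
    fun i hi => by
      obtain ⟨n, hn⟩ := hcov _ (hy i hi).1 (hy i hi).2
      obtain ⟨s, h₁, h₂⟩ := exists_well_inside hab (hy i hi).1 hn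
      exact ⟨Str.pair n s, by simpa using ⟨h₁, h₂⟩⟩
  refine ⟨B + B, fun x hx hxY => ?_⟩
  obtain ⟨i, hi, hd⟩ := hcov' x hx hxY
  obtain ⟨n, l, hnl, hl, hn⟩ := exists_inInterval_of_distLt (hy i hi).2 hd
  refine ⟨n, ?_, hn⟩
  obtain ⟨v, hv, h₁, h₂⟩ := hB i hi
  have hv₁ := (Str.fst_le v).trans hv
  have hv₂ := (Str.snd_le v).trans hv
  rcases le_total B l with hBl | hBl
  · exact (le_of_eps_le ((le_bumpSup hab (hy i hi).1 h₁ h₂ (hv₁.trans hBl)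
      (hv₂.trans hBl)).trans hl)).trans (add_le_add hv₁ hv₂)
  · exact (hnl.trans hBl).trans le_self_add

/-! ### Binary expansions -/

/-- The number with binary digits `f 0, …, f (n - 1)`. -/
noncomputable def dig (f : M.D .one) (n : M.D .nat) : M.D .nat :=
  nrec (fun k s => 2 * s + f k) 0 n

@[fun_prop] theorem Dfn.dig {f : X → M.D .one} {n : X → M.D .nat} (hf : Dfn M f)
    (hn : Dfn M n) : Dfn M fun x => dig (f x) (n x) := by
  unfold HORM.dig; fun_prop

@[simp] theorem dig_zero (f : M.D .one) : dig f 0 = 0 := nrec_zero _ _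

theorem dig_succ (f : M.D .one) (n : M.D .nat) : dig f (n + 1) = 2 * dig f n + f n := by
  rw [dig, nrec_succ (by fun_prop)]; rfl

theorem initSeg_eq (f : M.D .one) (n : M.D .nat) : initSeg f n = Str.pow2 n + dig f n := by
  refine Str.induction (P := fun n => initSeg f n = Str.pow2 n + dig f n) (by fun_prop)
    (by simp) (fun n hn => ?_) n
  rw [initSeg_succ, dig_succ, Str.pow2_succ, hn]; ring

/-- The `n`-th partial sum of `∑ f(i) 2^{-i-1}`. -/
noncomputable def bin (f : M.D .one) (n : M.D .nat) : M.Rat := dig f n * eps n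

@[fun_prop] theorem Dfn.bin {f : X → M.D .one} {n : X → M.D .nat} (hf : Dfn M f)
    (hn : Dfn M n) : Dfn M fun x => bin (f x) (n x) := by
  unfold HORM.bin; fun_prop

/-- The real number `∑ f(i) 2^{-i-1}`. -/
noncomputable def binReal (f : M.D .one) : M.D .one := seqOf fun n => bin f (n + 1)

@[fun_prop] theorem Dfn.binReal {f : X → M.D .one} (hf : Dfn M f) :
    Dfn M fun x => binReal (f x) := by
  unfold HORM.binReal; fun_prop

@[simp] theorem apx_binReal (f : M.D .one) (n : M.D .nat) : apx (binReal f) n = bin f (n + 1) :=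
  ratVal_seqOf (by fun_prop) n

@[simp] theorem bin_zero (f : M.D .one) : bin f 0 = 0 := by simp [bin]

theorem bin_succ (f : M.D .one) (n : M.D .nat) :
    bin f (n + 1) = bin f n + (f n : M.Rat) * eps (n + 1) := by
  rw [bin, bin, dig_succ, eps_succ, map_add, map_mul, map_ofNat]; ring

theorem Str.lt_two_iff {a : M.D .nat} : a < 2 ↔ a = 0 ∨ a = 1 := by
  rw [← one_add_one_eq_two, Str.lt_add_one_iff, le_iff_lt_or_eq, Str.lt_one_iff]

section

variable {f : M.D .one} (hf : IsBinary f)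
include hf

theorem IsBinary.bin_mono {m n : M.D .nat} (h : m ≤ n) :
    bin f m ≤ bin f n ∧ bin f n + eps n ≤ bin f m + eps m := by
  obtain ⟨k, rfl⟩ := exists_add_of_le h
  refine Str.induction (P := fun k => bin f m ≤ bin f (m + k) ∧
    bin f (m + k) + eps (m + k) ≤ bin f m + eps m) (by fun_prop) (by simp) (fun k hk => ?_) k
  have h₀ := eps_pos (m + k)
  rw [← add_assoc, bin_succ, eps_succ]
  rcases Str.lt_two_iff.1 (hf (m + k)) with h | h <;> rw [h] <;> simp only [map_zero, map_one] <;>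
    constructor <;> linarith

theorem IsBinary.bin_nonneg (n : M.D .nat) : 0 ≤ bin f n := by
  simpa using (hf.bin_mono (Str.zero_le n)).1

theorem IsBinary.bin_add_eps_le (n : M.D .nat) : bin f n + eps n ≤ 1 := by
  simpa using (hf.bin_mono (Str.zero_le n)).2

theorem IsBinary.dig_lt (n : M.D .nat) : dig f n < Str.pow2 n := by
  have h := hf.bin_add_eps_le n
  rw [← eps_mul_pow2 n, bin, mul_comm (eps n)] at h
  refine Str.lt_of_cast (lt_of_mul_lt_mul_right ?_ (eps_pos n).le)
  linarith [eps_pos n]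

theorem IsBinary.isReal : IsReal (binReal f) := by
  refine IsReal.of_le fun m n h => ?_
  have h₁ := hf.bin_mono (add_le_add_left h 1)
  have h₂ := eps_pos m
  have h₃ := eps_pos (n + 1)
  rw [eps_succ m] at h₁
  rw [apx_binReal, apx_binReal, _root_.abs_lt]
  constructor <;> linarith [h₁.1, h₁.2]

end

theorem lt_of_mul_eps_lt {n u v : M.D .nat} (h : (u : M.Rat) * eps n < (v : M.Rat) * eps n + eps n) :
    u < v + 1 := by
  rw [← add_one_mul, ← map_one FracField.cast, ← map_add] at h
  exact Str.lt_of_cast (lt_of_mul_lt_mul_right h (eps_pos n).le)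

/-- The digits of `f` are determined by rational bounds. -/
theorem dig_eq_of_bin {f : M.D .one} {n w : M.D .nat} (h₁ : bin f n < (w : M.Rat) * eps n + eps n)
    (h₂ : (w : M.Rat) * eps n < bin f n + eps n) : dig f n = w :=
  (Str.lt_add_one_iff.1 (lt_of_mul_eps_lt h₁)).antisymm (Str.lt_add_one_iff.1 (lt_of_mul_eps_lt h₂))

theorem dig_congr {f g : M.D .one} {n : M.D .nat} (h : ∀ j < n, f j = g j) {m : M.D .nat}
    (hm : m ≤ n) : dig f m = dig g m := by
  refine Str.induction (P := fun m => m ≤ n → dig f m = dig g m) (by fun_prop)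
    (by simp) (fun m hm h' => ?_) m hm
  rw [dig_succ, dig_succ, hm (le_self_add.trans h'), h m (Str.add_one_le_iff.1 h')]

theorem dig_injective {f g : M.D .one} (hf : IsBinary f) (hg : IsBinary g) {n : M.D .nat}
    (h : dig f n = dig g n) : ∀ j < n, f j = g j := by
  refine Str.induction (P := fun n => dig f n = dig g n → BAll n fun j => f j = g j)
    (by fun_prop) (fun _ j hj => (Str.not_lt_zero j hj).elim) (fun n hn h j hj => ?_) n h
  rw [dig_succ, dig_succ] at h
  have : dig f n = dig g n ∧ f n = g n := by
    rcases Str.lt_two_iff.1 (hf n) with h₁ | h₁ <;> rcases Str.lt_two_iff.1 (hg n) with h₂ | h₂ <;>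
      rw [h₁, h₂] at h ⊢
    · exact ⟨Str.two_mul_inj (by simpa using h), rfl⟩
    · exact (Str.two_mul_ne (h.symm.trans (add_zero _))).elim
    · exact (Str.two_mul_ne (h.trans (add_zero _))).elim
    · exact ⟨Str.two_mul_inj (add_right_cancel h), rfl⟩
  rcases (Str.lt_add_one_iff.1 hj).lt_or_eq with h' | rfl
  exacts [hn this.1 j h', this.2]

/-- A decidable lower Dedekind cut on the dyadic rationals `w / 2^n` has a binary expansion. -/
theorem exists_expansion {L : M.D .nat → M.D .nat → Prop}
    (hL : Dfn M fun p : M.D .nat × M.D .nat => L p.1 p.2) (h0 : L 0 0) (h1 : ¬ L 0 1)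
    (hs : ∀ n w, L (n + 1) (2 * w) ↔ L n w) :
    ∃ f : M.D .one, IsBinary f ∧ ∀ n, L n (dig f n) ∧ ¬ L n (dig f n + 1) := by
  let d : M.D .nat → M.D .nat := nrec (fun n r => sel (L (n + 1) (2 * r + 1)) (2 * r + 1) (2 * r)) 0
  have hL' : Dfn M fun p : M.D .nat × M.D .nat => L (p.1 + 1) (2 * p.2 + 1) :=
    hL.comp (f := fun p : M.D .nat × M.D .nat => (p.1 + 1, 2 * p.2 + 1)) (by fun_prop)
  have hd' : Dfn M fun p : M.D .nat × M.D .nat =>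
    sel (L (p.1 + 1) (2 * p.2 + 1)) (2 * p.2 + 1) (2 * p.2) := by fun_prop
  have hd : Dfn M d := Dfn.nrec (hd'.comp (f := fun p : (M.D .nat × M.D .nat) × M.D .nat =>
    (p.1.2, p.2)) (by fun_prop)) (by fun_prop) (by fun_prop)
  have hLd : Dfn M fun n => L (n + 1) (2 * d n + 1) :=
    hL.comp (f := fun n : M.D .nat => (n + 1, 2 * d n + 1)) (by fun_prop)
  have hds : ∀ n, d (n + 1) = sel (L (n + 1) (2 * d n + 1)) (2 * d n + 1) (2 * d n) :=
    nrec_succ hd' 0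
  let f : M.D .one := lam fun n => sel (L (n + 1) (2 * d n + 1)) 1 0
  have hf : ∀ n, f n = sel (L (n + 1) (2 * d n + 1)) 1 0 := lam_app (by fun_prop)
  have hdig : ∀ n, dig f n = d n := by
    refine Str.induction (by fun_prop) ((dig_zero f).trans (nrec_zero _ _).symm) fun n hn => ?_
    rw [dig_succ, hds, hf, hn]
    by_cases h : L (n + 1) (2 * d n + 1)
    · rw [sel_pos h, sel_pos h]
    · rw [sel_neg h, sel_neg h, add_zero]
  refine ⟨f, fun n => ?_, fun n => ?_⟩
  · rw [hf]
    by_cases h : L (n + 1) (2 * d n + 1)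
    · rw [sel_pos h]; exact one_lt_two
    · rw [sel_neg h]; exact two_pos
  · rw [hdig]
    have h₁ : Dfn M fun n => L n (d n) :=
      hL.comp (f := fun n : M.D .nat => (n, d n)) (by fun_prop)
    have h₂ : Dfn M fun n => L n (d n + 1) :=
      hL.comp (f := fun n : M.D .nat => (n, d n + 1)) (by fun_prop)
    refine Str.induction (P := fun n => L n (d n) ∧ ¬ L n (d n + 1)) (by fun_prop) ?_ ?_ n
    · rw [show d 0 = 0 from nrec_zero _ _, zero_add]; exact ⟨h0, h1⟩
    · rintro n ⟨hn₁, hn₂⟩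
      rw [hds]
      by_cases h : L (n + 1) (2 * d n + 1)
      · rw [sel_pos h, add_assoc, one_add_one_eq_two, ← mul_add_one, hs]
        exact ⟨h, hn₂⟩
      · rw [sel_neg h, hs]
        exact ⟨hn₁, h⟩

theorem cast_mul_eps_succ (n w : M.D .nat) :
    ((2 * w : M.D .nat) : M.Rat) * eps (n + 1) = (w : M.Rat) * eps n := by
  rw [eps_succ, map_mul, map_ofNat]; ring

/-- The expansion of a rational number in `[0, 1)` whose digits are not eventually `1`. -/
theorem exists_expansion_le {q : M.Rat} (h0 : 0 ≤ q) (h1 : q < 1) :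
    ∃ f : M.D .one, IsBinary f ∧ ∀ n, bin f n ≤ q ∧ q < bin f n + eps n := by
  obtain ⟨f, hf, h⟩ := exists_expansion (M := M) (L := fun n w => (w : M.Rat) * eps n ≤ q)
    (by fun_prop) (by simpa using h0) (fun h => h1.not_ge (by simpa using h)) fun n w => by
      rw [cast_mul_eps_succ]
  refine ⟨f, hf, fun n => ⟨(h n).1, ?_⟩⟩
  have := (h n).2
  rwa [map_add, map_one, add_mul, one_mul, not_le] at this

/-- The expansion of a rational number in `(0, 1]` whose digits are not eventually `0`. -/
theorem exists_expansion_lt {q : M.Rat} (h0 : 0 < q) (h1 : q ≤ 1) :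
    ∃ f : M.D .one, IsBinary f ∧ ∀ n, bin f n < q ∧ q ≤ bin f n + eps n := by
  obtain ⟨f, hf, h⟩ := exists_expansion (M := M) (L := fun n w => (w : M.Rat) * eps n < q)
    (by fun_prop) (by simpa using h0) (fun h => h1.not_gt (by simpa using h)) fun n w => by
      rw [cast_mul_eps_succ]
  refine ⟨f, hf, fun n => ⟨(h n).1, ?_⟩⟩
  have := (h n).2
  rwa [map_add, map_one, add_mul, one_mul, not_lt] at this

/-- `x <_ℝ q` for a rational number `q`. -/
def LtRat (x : M.D .one) (q : M.Rat) : Prop := ∃ k, apx x k + 2 * eps k < q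

/-- `q <_ℝ x` for a rational number `q`. -/
def RatLt (q : M.Rat) (x : M.D .one) : Prop := ∃ k, q + 2 * eps k < apx x k

theorem IsReal.sub_lt {x : M.D .one} (hx : IsReal x) (m n : M.D .nat) :
    apx x m < apx x n + eps m + eps n := by
  have h₁ := eps_pos m
  have h₂ := eps_pos n
  rcases le_total m n with h | h
  · linarith [(_root_.abs_lt.1 (hx.abs_lt h)).2]
  · linarith [(_root_.abs_lt.1 (hx.abs_lt h)).1]

theorem RatLt.lt_apx {x : M.D .one} {q : M.Rat} (h : RatLt q x) (hx : IsReal x) (n : M.D .nat) :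
    q < apx x n + eps n := by
  obtain ⟨k, hk⟩ := h
  linarith [hx.sub_lt k n, eps_pos k]

theorem RatLt.not_ltRat {x : M.D .one} {q : M.Rat} (h : RatLt q x) (hx : IsReal x) :
    ¬ LtRat x q := by
  rintro ⟨n, hn⟩
  linarith [h.lt_apx hx n, eps_pos n]

/-- A real number which differs from all dyadic rationals has a binary expansion. -/
theorem IsReal.exists_expansion {x : M.D .one} (hx : IsReal x)
    (h : ∀ n w : M.D .nat, LtRat x ((w : M.Rat) * eps n) ∨ RatLt ((w : M.Rat) * eps n) x)
    (h0 : RatLt 0 x) (h1 : LtRat x 1) :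
    ∃ f : M.D .one, IsBinary f ∧ ∀ n, RatLt (bin f n) x ∧ LtRat x (bin f n + eps n) := by
  obtain ⟨k, hk, hk'⟩ := Str.choice_nat₂ (M := M) (P := fun n w k =>
    apx x k + 2 * eps k < (w : M.Rat) * eps n ∨ (w : M.Rat) * eps n + 2 * eps k < apx x k)
    (by fun_prop) fun n w => by
      rcases h n w with ⟨k, hk⟩ | ⟨k, hk⟩
      exacts [⟨k, .inl hk⟩, ⟨k, .inr hk⟩]
  have key : ∀ n w : M.D .nat, (w : M.Rat) * eps n + 2 * eps (k n w) < apx x (k n w) ↔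
      RatLt ((w : M.Rat) * eps n) x := fun n w =>
    ⟨fun h => ⟨_, h⟩, fun h => (hk' n w).resolve_left fun h' => h.not_ltRat hx ⟨_, h'⟩⟩
  obtain ⟨f, hf, h'⟩ := HORM.exists_expansion (M := M)
    (L := fun n w => (w : M.Rat) * eps n + 2 * eps (k n w) < apx x (k n w)) (by fun_prop)
    ((key _ _).2 (by simpa using h0))
    (fun h => ((key _ _).1 h).not_ltRat hx (by simpa using h1))
    fun n w => by rw [key, key, cast_mul_eps_succ]
  refine ⟨f, hf, fun n => ⟨(key _ _).1 (h' n).1, ?_⟩⟩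
  have := (h n (dig f n + 1)).resolve_right fun h => (h' n).2 ((key _ _).2 h)
  rwa [map_add, map_one, add_mul, one_mul] at this

theorem IsReal.apx_le {x : M.D .one} (hx : IsReal x) {q : M.Rat} (h : ¬ RatLt q x)
    (n : M.D .nat) : apx x n ≤ q + eps n := by
  simp only [RatLt, not_exists, not_lt] at h
  by_contra! hn
  obtain ⟨k, hk⟩ := exists_eps_lt (div_pos (sub_pos.2 hn) (zero_lt_three (α := M.Rat)))
  linarith [hx.sub_lt n k, h k]

theorem IsReal.le_apx {x : M.D .one} (hx : IsReal x) {q : M.Rat} (h : ¬ LtRat x q)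
    (n : M.D .nat) : q ≤ apx x n + eps n := by
  simp only [LtRat, not_exists, not_lt] at h
  by_contra! hn
  obtain ⟨k, hk⟩ := exists_eps_lt (div_pos (sub_pos.2 hn) (zero_lt_three (α := M.Rat)))
  linarith [hx.sub_lt k n, h k]

/-- A real number in the unit interval equals a dyadic rational number in the unit interval, or
differs from all of them. -/
theorem IsReal.dyadic_or {x : M.D .one} (hx : IsReal x)
    (h : ∀ n, -(2 * eps n) ≤ apx x n ∧ apx x n ≤ 1 + 2 * eps n) :
    (∃ n w : M.D .nat, (w : M.Rat) * eps n ≤ 1 ∧ ¬ LtRat x ((w : M.Rat) * eps n) ∧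
      ¬ RatLt ((w : M.Rat) * eps n) x) ∨
    ∃ f : M.D .one, IsBinary f ∧ ∀ n, RatLt (bin f n) x ∧ LtRat x (bin f n + eps n) := by
  refine or_iff_not_imp_left.2 fun hd => ?_
  have h1 : ¬ RatLt 1 x := fun ⟨n, hn⟩ => by linarith [(h n).2]
  have h0 : ¬ LtRat x 0 := fun ⟨n, hn⟩ => by linarith [(h n).1]
  have hle : ∀ n w : M.D .nat, ¬ LtRat x ((w : M.Rat) * eps n) → (w : M.Rat) * eps n ≤ 1 := by
    intro n w hw
    by_contra! hc
    obtain ⟨k, hk⟩ := exists_eps_lt (half_pos (sub_pos.2 hc))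
    linarith [hx.le_apx hw k, hx.apx_le h1 k]
  have hd' : ∀ n w : M.D .nat, LtRat x ((w : M.Rat) * eps n) ∨ RatLt ((w : M.Rat) * eps n) x := by
    intro n w
    by_contra! hc
    exact hd ⟨n, w, hle n w hc.1, hc⟩
  have h0' := hd' 0 0
  have h1' := hd' 0 1
  simp only [map_zero, map_one, zero_mul, one_mul, eps_zero] at h0' h1'
  exact hx.exists_expansion hd' (h0'.resolve_left h0) (h1'.resolve_right h1)

/-- Every real number in the unit interval has a binary expansion. -/
theorem IsReal.exists_binReal {x : M.D .one} (hx : IsReal x)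
    (h : ∀ n, -(2 * eps n) ≤ apx x n ∧ apx x n ≤ 1 + 2 * eps n) :
    ∃ f : M.D .one, IsBinary f ∧ RealEq x (binReal f) := by
  suffices ∃ f : M.D .one, IsBinary f ∧
      ∀ n, ¬ LtRat x (bin f n) ∧ ¬ RatLt (bin f n + eps n) x by
    obtain ⟨f, hf, h'⟩ := this
    refine ⟨f, hf, fun n => ?_⟩
    have h₁ := hx.le_apx (h' (n + 1)).1 n
    have h₂ := hx.apx_le (h' (n + 1)).2 n
    rw [eps_succ] at h₂
    rw [apx_binReal, abs_le]
    constructor <;> linarith [eps_pos n]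
  rcases hx.dyadic_or h with ⟨m, w, hw, h₁, h₂⟩ | ⟨f, hf, h'⟩
  · have hw0 : 0 ≤ (w : M.Rat) * eps m := mul_nonneg (FracField.cast_nonneg w) (eps_pos m).le
    have mono₁ : ∀ {q : M.Rat}, q ≤ (w : M.Rat) * eps m → ¬ LtRat x q := fun hq ⟨k, hk⟩ =>
      h₁ ⟨k, hk.trans_le hq⟩
    have mono₂ : ∀ {q : M.Rat}, (w : M.Rat) * eps m ≤ q → ¬ RatLt q x := fun hq ⟨k, hk⟩ =>
      h₂ ⟨k, (add_le_add hq le_rfl).trans_lt hk⟩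
    rcases hw.lt_or_eq with hlt | heq
    · obtain ⟨f, hf, h'⟩ := exists_expansion_le hw0 hlt
      exact ⟨f, hf, fun n => ⟨mono₁ (h' n).1, mono₂ (h' n).2.le⟩⟩
    · obtain ⟨f, hf, h'⟩ := exists_expansion_lt (heq ▸ zero_lt_one) hw
      exact ⟨f, hf, fun n => ⟨mono₁ (h' n).1.le, mono₂ (h' n).2⟩⟩
  · exact ⟨f, hf, fun n => ⟨(h' n).1.not_ltRat hx, fun h'' => h''.not_ltRat hx (h' n).2⟩⟩

/-! ### `HBC` implies `WKL` -/

theorem isReal_ofRat (q : M.Rat) : IsReal (ofRat q) := fun n i => by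
  simpa using eps_pos n

@[fun_prop] theorem Dfn.ofRat {f : X → M.Rat} (hf : Dfn M f) : Dfn M fun x => ofRat (f x) := by
  unfold HORM.ofRat; fun_prop

theorem realLt_ofRat_left {q : M.Rat} {x : M.D .one} : RealLt (ofRat q) x ↔ RatLt q x := by
  simp [RealLt, RatLt]

theorem realLt_ofRat_right {q : M.Rat} {x : M.D .one} : RealLt x (ofRat q) ↔ LtRat x q := by
  simp [RealLt, LtRat]

/-- The signed distance from the unit interval, which represents its complement. -/
noncomputable def unitDist : M.D (.arr .one .one) :=
  lam fun x => seqOf fun k => max (-apx x k) (apx x k - 1)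

theorem apx_unitDist (x : M.D .one) (k : M.D .nat) :
    apx (M.app unitDist x) k = max (-apx x k) (apx x k - 1) := by
  rw [apx, unitDist, lam_app (by fun_prop), ratVal_seqOf (by fun_prop)]

theorem abs_unitDist_sub_le (x y : M.D .one) (m n : M.D .nat) :
    |apx (M.app unitDist x) m - apx (M.app unitDist y) n| ≤ |apx x m - apx y n| := by
  rw [apx_unitDist, apx_unitDist]
  refine (abs_max_sub_max_le_max _ _ _ _).trans (max_le (le_of_eq ?_) (le_of_eq ?_))
  · rw [neg_sub_neg, abs_sub_comm]
  · rw [sub_sub_sub_cancel_right]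

theorem unitDist_isRealFun : IsRealFun (unitDist : M.D (.arr .one .one)) where
  real _ hx := IsReal.of_le fun m n h => (abs_unitDist_sub_le _ _ m n).trans_lt (hx.abs_lt h)
  eq _ _ _ _ h n := (abs_unitDist_sub_le _ _ n n).trans (h n)

theorem not_pos_unitDist {x : M.D .one} : ¬ Pos (M.app unitDist x) ↔
    ∀ n, -(2 * eps n) ≤ apx x n ∧ apx x n ≤ 1 + 2 * eps n := by
  simp only [Pos, not_exists, not_lt, apx_unitDist, max_le_iff]
  exact forall_congr' fun n => and_congr ⟨fun h => by linarith, fun h => by linarith⟩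
    ⟨fun h => by linarith, fun h => by linarith⟩

theorem unitDist_closedInUnit : ClosedInUnit (unitDist : M.D (.arr .one .one)) where
  isOpen.fn := unitDist_isRealFun
  isOpen.ball x hx := by
    rintro ⟨n, hn⟩
    refine ⟨_, sub_pos.2 hn, ?_⟩
    rintro y hy ⟨m, hm⟩
    refine ⟨m + 1, ?_⟩
    have h₁ := (unitDist_isRealFun.real x hx).sub_lt n (m + 1)
    have h₂ := (le_abs_self _).trans (abs_unitDist_sub_le x y (m + 1) (m + 1))
    rw [eps_succ] at h₁ ⊢
    linarith [eps_pos n, eps_pos m]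
  sub _ _ := not_pos_unitDist.1

/-- Every number below `2^n` codes the first `n` values of a binary sequence. -/
theorem exists_dig_eq {n w : M.D .nat} (h : w < Str.pow2 n) :
    ∃ f : M.D .one, IsBinary f ∧ dig f n = w := by
  have hw : (w : M.Rat) * eps n < 1 := by
    rw [← eps_mul_pow2 n, mul_comm (eps n)]
    exact mul_lt_mul_of_pos_right (FracField.cast_lt.2 h) (eps_pos n)
  obtain ⟨f, hf, h'⟩ := exists_expansion_le
    (mul_nonneg (FracField.cast_nonneg w) (eps_pos n).le) hw
  have := eps_pos n
  exact ⟨f, hf, dig_eq_of_bin (by linarith [(h' n).1]) (h' n).2⟩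

section

variable (T : M.D .one)

/-- For `i = ⟨n, ⟨u, v⟩⟩`: none of the strings of length `n` with numbers `w`,
`u - 1 ≤ w < v - 1`, belongs to the tree `T`. -/
def OffTree (i : M.D .nat) : Prop :=
  BAll (Str.snd (Str.snd i)) fun w => Str.fst (Str.snd i) ≤ w + 1 → w + 1 < Str.snd (Str.snd i) →
    w < Str.pow2 (Str.fst i) → T (Str.pow2 (Str.fst i) + w) ≠ 0

@[fun_prop] theorem Dfn.offTree {i : X → M.D .nat} (hi : Dfn M i) :
    Dfn M fun x => OffTree T (i x) := by
  unfold OffTree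
  have : Dfn M fun p : X × M.D .nat => i p.1 := by fun_prop
  fun_prop

/-- The left end point `(u - 1) / 2^n` of the `i`-th interval, `i = ⟨n, ⟨u, v⟩⟩`. -/
noncomputable def leftEnd (i : M.D .nat) : M.Rat :=
  sel (OffTree T i) (((Str.fst (Str.snd i) : M.Rat) - 1) * eps (Str.fst i)) 0

/-- The right end point `(v - 1) / 2^n` of the `i`-th interval, `i = ⟨n, ⟨u, v⟩⟩`. -/
noncomputable def rightEnd (i : M.D .nat) : M.Rat :=
  sel (OffTree T i) (((Str.snd (Str.snd i) : M.Rat) - 1) * eps (Str.fst i)) 0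

variable {T}

/-- The intervals of the covering which is defined from the tree. -/
theorem inInterval_iff {i : M.D .nat} {x : M.D .one} :
    InInterval (lam fun i => ofRat (leftEnd T i)) (lam fun i => ofRat (rightEnd T i)) i x ↔
      RatLt (leftEnd T i) x ∧ LtRat x (rightEnd T i) := by
  have h₁ : Dfn M fun i => ofRat (leftEnd T i) := by unfold leftEnd; fun_prop
  have h₂ : Dfn M fun i => ofRat (rightEnd T i) := by unfold rightEnd; fun_prop
  rw [InInterval, lam_app h₁, lam_app h₂, realLt_ofRat_left, realLt_ofRat_right]

theorem inInterval_pair {n u v : M.D .nat} {x : M.D .one}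
    (h : ∀ w < Str.pow2 n, u ≤ w + 1 → w + 1 < v → T (Str.pow2 n + w) ≠ 0)
    (h₁ : RatLt (((u : M.Rat) - 1) * eps n) x) (h₂ : LtRat x (((v : M.Rat) - 1) * eps n)) :
    InInterval (lam fun i => ofRat (leftEnd T i)) (lam fun i => ofRat (rightEnd T i))
      (Str.pair n (Str.pair u v)) x := by
  have hQ : OffTree T (Str.pair n (Str.pair u v)) := by
    intro w _
    simp only [Str.fst_pair, Str.snd_pair]
    exact fun h₁ h₂ h₃ => h w h₃ h₁ h₂
  rw [inInterval_iff, leftEnd, rightEnd, sel_pos hQ, sel_pos hQ]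
  simp only [Str.fst_pair, Str.snd_pair]
  exact ⟨h₁, h₂⟩

variable (hT : ∀ c, IsBinary c → ∀ n, T (initSeg c (n + 1)) = 0 → T (initSeg c n) = 0)
include hT

theorem tree_of_le {c : M.D .one} (hc : IsBinary c) {m n : M.D .nat} (h : m ≤ n)
    (hn : T (initSeg c n) = 0) : T (initSeg c m) = 0 := by
  obtain ⟨k, rfl⟩ := exists_add_of_le h
  exact Str.induction (P := fun k => T (initSeg c (m + k)) = 0 → T (initSeg c m) = 0) (by fun_prop)
    (by simp) (fun k hk h => hk (hT c hc _ (by rwa [← add_assoc] at h))) k hn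

variable (hpath : ∀ f, IsBinary f → ∃ n, T (initSeg f n) ≠ 0)
include hpath

/-- The strings around a rational number lie off the tree, from some length on. -/
theorem exists_off_tree (q : M.Rat) (h0 : 0 ≤ q) (h1 : q ≤ 1) :
    ∃ n₀, ∀ n ≥ n₀, ∀ w < Str.pow2 n,
      ((w : M.Rat) * eps n ≤ q ∧ q < (w : M.Rat) * eps n + eps n ∨
        (w : M.Rat) * eps n < q ∧ q ≤ (w : M.Rat) * eps n + eps n) → T (Str.pow2 n + w) ≠ 0 := by
  have hle : ∃ n₀, ∀ n ≥ n₀, ∀ w < Str.pow2 n,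
      (w : M.Rat) * eps n ≤ q ∧ q < (w : M.Rat) * eps n + eps n → T (Str.pow2 n + w) ≠ 0 := by
    rcases h1.lt_or_eq with h | rfl
    · obtain ⟨f, hf, hfq⟩ := exists_expansion_le h0 h
      obtain ⟨n₀, hn₀⟩ := hpath f hf
      refine ⟨n₀, fun n hn w _ hw h => hn₀ (tree_of_le hT hf hn ?_)⟩
      rwa [initSeg_eq, dig_eq_of_bin (w := w) ((hfq n).1.trans_lt hw.2) (hw.1.trans_lt (hfq n).2)]
    · refine ⟨0, fun n _ w hw h => ?_⟩
      obtain ⟨f, hf, rfl⟩ := exists_dig_eq hw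
      exact (h.2.not_ge (hf.bin_add_eps_le n)).elim
  have hlt : ∃ n₀, ∀ n ≥ n₀, ∀ w < Str.pow2 n,
      (w : M.Rat) * eps n < q ∧ q ≤ (w : M.Rat) * eps n + eps n → T (Str.pow2 n + w) ≠ 0 := by
    rcases h0.lt_or_eq with h | rfl
    · obtain ⟨f, hf, hfq⟩ := exists_expansion_lt h h1
      obtain ⟨n₀, hn₀⟩ := hpath f hf
      refine ⟨n₀, fun n hn w _ hw h => hn₀ (tree_of_le hT hf hn ?_)⟩
      rwa [initSeg_eq, dig_eq_of_bin (w := w) ((hfq n).1.trans_le hw.2) (hw.1.trans_le (hfq n).2)]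
    · exact ⟨0, fun n _ w _ h => (h.1.not_ge
        (mul_nonneg (FracField.cast_nonneg w) (eps_pos n).le)).elim⟩
  obtain ⟨n₁, h₁⟩ := hle
  obtain ⟨n₂, h₂⟩ := hlt
  exact ⟨max n₁ n₂, fun n hn w hw h => h.elim (h₁ n ((le_max_left _ _).trans hn) w hw)
    (h₂ n ((le_max_right _ _).trans hn) w hw)⟩

theorem exists_inInterval {x : M.D .one} (hx : IsReal x)
    (h : ∀ n, -(2 * eps n) ≤ apx x n ∧ apx x n ≤ 1 + 2 * eps n) :
    ∃ i, InInterval (lam fun i => ofRat (leftEnd T i)) (lam fun i => ofRat (rightEnd T i)) i x := by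
  rcases hx.dyadic_or h with ⟨m, w₀, hle, h₁, h₂⟩ | ⟨f, hf, hfx⟩
  · have hq0 : 0 ≤ (w₀ : M.Rat) * eps m := mul_nonneg (FracField.cast_nonneg _) (eps_pos m).le
    obtain ⟨n₀, hn₀⟩ := exists_off_tree hT hpath _ hq0 hle
    obtain ⟨k, hk⟩ := exists_add_of_le (le_max_left m n₀)
    set n := max m n₀
    have hw : ((w₀ * Str.pow2 k : M.D .nat) : M.Rat) * eps n = (w₀ : M.Rat) * eps m := by
      rw [hk, eps_add, map_mul]
      linear_combination (w₀ : M.Rat) * eps m * eps_mul_pow2 k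
    set w := w₀ * Str.pow2 k
    rw [← hw] at h₁ h₂ hn₀
    obtain ⟨l, hl⟩ := exists_eps_lt (div_pos (eps_pos n) (zero_lt_three (α := M.Rat)))
    refine ⟨_, inInterval_pair (n := n) (u := w) (v := w + 2) (fun w' hw' hu hv => ?_)
      ⟨l, ?_⟩ ⟨l, ?_⟩⟩
    · refine hn₀ n (le_max_right _ _) w' hw' ?_
      have hp := eps_pos n
      rcases hu.lt_or_eq with hu | hu
      · have : w = w' := (Str.lt_add_one_iff.1 hu).antisymm (Str.lt_add_one_iff.1
          (lt_of_add_lt_add_right (a := 1) (by rwa [add_assoc, one_add_one_eq_two])))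
        subst this
        exact .inl ⟨le_rfl, by linarith⟩
      · right
        rw [hu, map_add, map_one, add_mul, one_mul]
        exact ⟨by linarith, le_rfl⟩
    · linarith [hx.le_apx h₁ l]
    · rw [map_add, map_ofNat]
      linarith [hx.apx_le h₂ l]
  · obtain ⟨n, hn⟩ := hpath f hf
    refine ⟨_, inInterval_pair (n := n) (u := dig f n + 1) (v := dig f n + 2)
      (fun w _ hu hv => ?_) ?_ ?_⟩
    · have : w = dig f n := le_antisymm (Str.lt_add_one_iff.1
        (lt_of_add_lt_add_right (a := 1) (by rwa [add_assoc, one_add_one_eq_two])))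
        (le_of_add_le_add_right hu)
      rwa [this, ← initSeg_eq]
    · rw [map_add, map_one, add_sub_cancel_right]; exact (hfx n).1
    · convert (hfx n).2 using 1
      rw [map_add, map_ofNat, bin]; ring

end

theorem Str.SatHBC.satWKL (h : M.SatHBC) : M.SatWKL := by
  intro T hT hlong
  by_contra! hpath
  have hpath' : ∀ f, IsBinary f → ∃ n, T (initSeg f n) ≠ 0 := hpath
  have h₁ : Dfn M fun i => ofRat (leftEnd T i) := by unfold leftEnd; fun_prop
  have h₂ : Dfn M fun i => ofRat (rightEnd T i) := by unfold rightEnd; fun_prop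
  obtain ⟨N, hN⟩ := h unitDist (lam fun i => ofRat (leftEnd T i))
    (lam fun i => ofRat (rightEnd T i)) unitDist_closedInUnit
    (fun i => by rw [lam_app h₁, lam_app h₂]; exact ⟨isReal_ofRat _, isReal_ofRat _⟩)
    fun x hx hxC => exists_inInterval hT hpath' hx (not_pos_unitDist.1 hxC)
  obtain ⟨c, hc, hcN⟩ := hlong N
  have hc0 := hc.bin_nonneg N
  have hc1 := hc.bin_add_eps_le N
  have hpN := eps_pos N
  obtain ⟨i, hi, hi'⟩ := hN (ofRat (bin c N)) (isReal_ofRat _) (not_pos_unitDist.2 fun n => by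
    have := eps_pos n
    rw [apx_ofRat]
    constructor <;> linarith)
  rw [inInterval_iff] at hi'
  obtain ⟨⟨k, hk⟩, ⟨l, hl⟩⟩ := hi'
  rw [apx_ofRat] at hk hl
  have hpk := eps_pos k
  have hpl := eps_pos l
  by_cases hQ : OffTree T i
  · rw [leftEnd, sel_pos hQ] at hk
    rw [rightEnd, sel_pos hQ] at hl
    set n := Str.fst i
    set u := Str.fst (Str.snd i) with hu
    set v := Str.snd (Str.snd i) with hv
    have hn : n ≤ N := (Str.fst_le i).trans hi
    have hb := hc.bin_mono hn
    have hu' : u ≤ dig c n + 1 := by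
      refine Str.lt_add_one_iff.1 (lt_of_mul_eps_lt (n := n) ?_)
      rw [map_add, map_one, add_mul]
      rw [bin] at hb
      linarith
    have hv' : dig c n + 1 < v := by
      refine Str.lt_of_cast (lt_of_mul_lt_mul_right ?_ (eps_pos n).le)
      rw [map_add, map_one, add_mul]
      rw [bin] at hb
      linarith
    refine hQ (dig c n) ((Str.lt_add_one_iff.2 le_rfl).trans hv') hu' hv' (hc.dig_lt n) ?_
    rw [← initSeg_eq]
    exact tree_of_le hT hc hn hcN
  · rw [leftEnd, sel_neg hQ] at hk
    rw [rightEnd, sel_neg hQ] at hl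
    linarith

/-! ### Weak König's lemma and countable choice in a model -/

/-- The semantic content of `QF-AC^{0,1}`. -/
def Str.SatAC (M : Str) [M.IsModel] : Prop :=
  ∀ P : M.D .nat → M.D .one → Prop, (Dfn M fun p : M.D .nat × M.D .one => P p.1 p.2) →
    (∀ n, ∃ f, P n f) → ∃ F : M.D (.arr .nat .one), ∀ n, P n (F n)

/-- The binary sequence with the same zeros. -/
noncomputable def toBinary (f : M.D .one) : M.D .one := lam fun n => sel (f n = 0) 0 1

@[fun_prop] theorem Dfn.toBinary {f : X → M.D .one} (hf : Dfn M f) :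
    Dfn M fun x => toBinary (f x) := by
  unfold HORM.toBinary; fun_prop

theorem toBinary_app (f : M.D .one) (n : M.D .nat) : M.app (toBinary f) n = sel (f n = 0) 0 1 :=
  lam_app (by fun_prop) n

theorem isBinary_toBinary (f : M.D .one) : IsBinary (toBinary f) := fun n => by
  rw [toBinary_app]
  by_cases h : f n = 0
  · rw [sel_pos h]; exact two_pos
  · rw [sel_neg h]; exact one_lt_two

theorem IsBinary.toBinary_eq {f : M.D .one} (hf : IsBinary f) : toBinary f = f :=
  Str.funext fun n => by
    rw [toBinary_app]
    rcases Str.lt_two_iff.1 (hf n) with h | h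
    · rw [sel_pos h, h]
    · rw [sel_neg (by rw [h]; exact one_ne_zero), h]

/-- Choice of a sequence of binary sequences. -/
theorem Str.SatAC.binary (h : M.SatAC) {P : M.D .nat → M.D .one → Prop}
    (hP : Dfn M fun p : M.D .nat × M.D .one => P p.1 p.2)
    (hex : ∀ n, ∃ f, IsBinary f ∧ P n f) :
    ∃ F : M.D (.arr .nat .one), ∀ n, IsBinary (F n) ∧ P n (F n) := by
  obtain ⟨F, hF⟩ := h (fun n f => P n (toBinary f))
    (hP.comp (f := fun p : M.D .nat × M.D .one => (p.1, toBinary p.2)) (by fun_prop))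
    fun n => by
      obtain ⟨f, hf, hP⟩ := hex n
      exact ⟨f, by rwa [hf.toBinary_eq]⟩
  refine ⟨lam fun n => toBinary (F n), fun n => ?_⟩
  rw [lam_app (by fun_prop)]
  exact ⟨isBinary_toBinary _, hF n⟩

/-- The length of the binary string with code `s`. -/
noncomputable def strLen (s : M.D .nat) : M.D .nat := bmin (s + 1) fun m => s < Str.pow2 (m + 1)

/-- The number of the initial segment of length `j` of the binary string with code `s`. -/
noncomputable def strDig (s j : M.D .nat) : M.D .nat :=
  bmin (Str.pow2 j) fun u =>
    ((s - Str.pow2 (strLen s) : M.D .nat) : M.Rat) * eps (strLen s) < (u : M.Rat) * eps j + eps j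

/-- A sequence which starts with the binary string with code `s`. -/
noncomputable def strFun (s : M.D .nat) : M.D .one :=
  lam fun j => sel (strDig s (j + 1) = 2 * strDig s j) 0 1

@[fun_prop] theorem Dfn.strLen {s : X → M.D .nat} (hs : Dfn M s) :
    Dfn M fun x => strLen (s x) := by
  unfold HORM.strLen; fun_prop

@[fun_prop] theorem Dfn.strDig {s j : X → M.D .nat} (hs : Dfn M s) (hj : Dfn M j) :
    Dfn M fun x => strDig (s x) (j x) := by
  unfold HORM.strDig; fun_prop

@[fun_prop] theorem Dfn.strFun {s : X → M.D .nat} (hs : Dfn M s) :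
    Dfn M fun x => strFun (s x) := by
  unfold HORM.strFun; fun_prop

section

variable {c : M.D .one} (hc : IsBinary c)
include hc

theorem IsBinary.strLen_initSeg (n : M.D .nat) : strLen (initSeg c n) = n := by
  have h₁ : ∀ k, initSeg c n < Str.pow2 (k + 1) ↔ n ≤ k := by
    intro k
    rw [initSeg_eq]
    constructor
    · intro h
      by_contra! hk
      have := eps_anti (Str.add_one_le_iff.2 hk)
      have h' := (one_div_le_one_div (cast_pow2_pos n) (cast_pow2_pos (k + 1))).1 this
      exact (le_self_add.trans_lt h).not_ge (FracField.cast_le.1 h')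
    · intro h
      obtain ⟨l, rfl⟩ := exists_add_of_le h
      rw [add_right_comm, Str.pow2_add, Str.pow2_succ, two_mul]
      refine (add_lt_add_right (hc.dig_lt n) _).trans_le ?_
      refine le_mul_of_one_le_right (Str.zero_le _) ?_
      rw [← zero_add (1 : M.D .nat), Str.add_one_le_iff]
      exact Str.pow2_pos l
  have hn : n < initSeg c n + 1 := Str.lt_add_one_iff.2
    ((Str.lt_pow2 n).le.trans (by rw [initSeg_eq]; exact le_self_add))
  obtain ⟨h₂, h₃⟩ := bmin_of_lt (P := fun m => initSeg c n < Str.pow2 (m + 1)) (by fun_prop) hn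
    ((h₁ n).2 le_rfl)
  exact h₂.antisymm ((h₁ _).1 h₃)

theorem IsBinary.strDig_initSeg {j n : M.D .nat} (h : j ≤ n) :
    strDig (initSeg c n) j = dig c j := by
  have hb := hc.bin_mono h
  have hp := eps_pos n
  rw [strDig, hc.strLen_initSeg, initSeg_eq, add_tsub_cancel_left]
  change bmin (Str.pow2 j) (fun u => bin c n < (u : M.Rat) * eps j + eps j) = _
  obtain ⟨h₂, h₃⟩ := bmin_of_lt (P := fun u => bin c n < (u : M.Rat) * eps j + eps j)
    (by fun_prop) (hc.dig_lt j) (by change bin c n < bin c j + eps j; linarith)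
  exact h₂.antisymm (Str.lt_add_one_iff.1 (lt_of_mul_eps_lt (hb.1.trans_lt h₃)))

theorem IsBinary.strFun_initSeg {j n : M.D .nat} (h : j < n) :
    M.app (strFun (initSeg c n)) j = c j := by
  rw [strFun, lam_app (by fun_prop), hc.strDig_initSeg h.le,
    hc.strDig_initSeg (Str.add_one_le_iff.2 h), dig_succ]
  rcases Str.lt_two_iff.1 (hc j) with h' | h' <;> rw [h']
  · rw [sel_pos (add_zero _)]
  · exact sel_neg Str.two_mul_ne _ _

end

/-- Weak König's lemma for decidable conditions on initial segments, without closure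
conditions. -/
theorem Str.SatWKL.exists_path (h : M.SatWKL) {C : M.D .one → M.D .nat → Prop}
    (hC : Dfn M fun p : M.D .one × M.D .nat => C p.1 p.2)
    (hloc : ∀ f g m, (∀ j < m, f j = g j) → C f m → C g m)
    (hex : ∀ m, ∃ f, IsBinary f ∧ ∀ k ≤ m, C f k) : ∃ f, IsBinary f ∧ ∀ m, C f m := by
  have hd : Dfn M fun s => sel (BAll (strLen s + 1) fun k => C (strFun s) k) (0 : M.D .nat) 1 := by
    fun_prop
  have key : ∀ c, IsBinary c → ∀ n, M.app (lam fun s =>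
      sel (BAll (strLen s + 1) fun k => C (strFun s) k) (0 : M.D .nat) 1) (initSeg c n) = 0 ↔
      ∀ k ≤ n, C c k := by
    intro c hc n
    rw [lam_app hd, hc.strLen_initSeg]
    have : (BAll (n + 1) fun k => C (strFun (initSeg c n)) k) ↔ ∀ k ≤ n, C c k := by
      refine forall_congr' fun k => ?_
      rw [Str.lt_add_one_iff]
      exact forall_congr' fun hk =>
        ⟨hloc _ _ _ fun j hj => hc.strFun_initSeg (hj.trans_le hk),
          hloc _ _ _ fun j hj => (hc.strFun_initSeg (hj.trans_le hk)).symm⟩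
    by_cases hb : BAll (n + 1) fun k => C (strFun (initSeg c n)) k
    · rw [sel_pos hb]
      exact iff_of_true rfl (this.1 hb)
    · rw [sel_neg hb]
      exact iff_of_false one_ne_zero fun h => hb (this.2 h)
  obtain ⟨f, hf, hf'⟩ := h (lam fun s => sel (BAll (strLen s + 1) fun k => C (strFun s) k) 0 1)
    (fun c hc n h => (key c hc n).2 fun k hk => (key c hc _).1 h k (hk.trans le_self_add))
    fun n => by
      obtain ⟨c, hc, hc'⟩ := hex n
      exact ⟨c, hc, (key c hc n).2 hc'⟩
  exact ⟨f, hf, fun m => (key f hf m).1 (hf' m) m le_rfl⟩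

/-! ### From an effective discontinuity to arithmetical comprehension -/

/-- The sequence `g` of binary sequences witnesses that the property `∃ m, D f m` of sequences `f`
is discontinuous: the sequences in the tree of initial segments given by `G` have this property,
longer and longer parts of the `g s` lie in the tree, but the `m`-th approximation to the property
fails for `g s` if `m ≤ s`. -/
structure Discontinuity (G D : M.D .one → M.D .nat → Prop) (g : M.D (.arr .nat .one)) : Prop where
  dfn_tree : Dfn M fun p : M.D .one × M.D .nat => G p.1 p.2
  dfn_prop : Dfn M fun p : M.D .one × M.D .nat => D p.1 p.2
  binary : ∀ s, IsBinary (g s)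
  congr : ∀ f f' l, (∀ j < l, f j = f' j) → G f l → G f' l
  tree : ∀ s, ∀ l ≤ s, G (g s) l
  of_tree : ∀ f, IsBinary f → (∀ l, G f l) → ∃ m, D f m
  not_prop : ∀ s, ∀ m ≤ s, ¬ D (g s) m

/-- The `n`-th row of a double sequence. -/
noncomputable def row (σ : M.D .one) (n : M.D .nat) : M.D .one := lam fun j => σ (Str.pair n j)

@[fun_prop] theorem Dfn.row {σ : X → M.D .one} {n : X → M.D .nat} (hσ : Dfn M σ) (hn : Dfn M n) :
    Dfn M fun x => row (σ x) (n x) := by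
  unfold HORM.row; fun_prop

theorem row_app (σ : M.D .one) (n j : M.D .nat) : M.app (row σ n) j = σ (Str.pair n j) :=
  lam_app (by fun_prop) j

theorem exists_pair_lt (n l : M.D .nat) : ∃ b, ∀ j < l, Str.pair n j < b := by
  obtain ⟨b, hb⟩ := Str.exists_bound (M := M) (P := fun j y => Str.pair n j < y) (by fun_prop) l
    fun j _ => ⟨_, Str.lt_add_one_iff.2 le_rfl⟩
  exact ⟨b, fun j hj => by
    obtain ⟨y, hy, h⟩ := hb j hj
    exact h.trans_le hy⟩

/-- With weak König's lemma, a discontinuity allows to decide all `Σ₁` properties: sequences `x_n`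
in the tree are chosen simultaneously, such that `x_n = g s` if `s` is the first witness of the
`n`-th property. -/
theorem Discontinuity.dfn_exists (hW : M.SatWKL) {G D : M.D .one → M.D .nat → Prop}
    {g : M.D (.arr .nat .one)} (h : Discontinuity G D g) {R : M.D .nat → M.D .nat → Prop}
    (hR : Dfn M fun p : M.D .nat × M.D .nat => R p.1 p.2) : Dfn M fun n => ∃ s, R n s := by
  have hG := h.dfn_tree
  have hD := h.dfn_prop
  have hRn : ∀ n, Dfn M (R n) := fun n =>
    hR.comp (f := fun s : M.D .nat => (n, s)) (by fun_prop)
  obtain ⟨σ, hσ, hσ'⟩ : ∃ σ, IsBinary σ ∧ ∀ m, BAll m fun n => BAll (m + 1) fun l =>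
      (BAll l fun j => Str.pair n j < m) → ((¬ BEx m fun s => R n s) → G (row σ n) l) ∧
        BAll m fun s => R n s → (BAll s fun t => ¬ R n t) → BAll l fun j => row σ n j = g s j := by
    refine hW.exists_path (by fun_prop) ?_ ?_
    · -- the condition depends on an initial segment only
      intro f f' m hf hC n hn l hl hj
      have e : ∀ j < l, row f n j = row f' n j := fun j hjl => by
        rw [row_app, row_app]; exact hf _ (hj j hjl)
      obtain ⟨h₁, h₂⟩ := hC n hn l hl hj
      exact ⟨fun h' => h.congr _ _ _ e (h₁ h'), fun s hs hR hR' j hjl =>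
        (e j hjl).symm.trans (h₂ s hs hR hR' j hjl)⟩
    · -- strings of every length satisfy the condition
      intro m
      let σ : M.D .one := lam fun q => g (bmin m fun s => R (Str.fst q) s) (Str.snd q)
      have hσ : ∀ q, σ q = g (bmin m fun s => R (Str.fst q) s) (Str.snd q) :=
        lam_app (f := fun q => g (bmin m fun s => R (Str.fst q) s) (Str.snd q)) (by fun_prop)
      have hrow : ∀ n, row σ n = g (bmin m fun s => R n s) := fun n => Str.funext fun j => by
        rw [row_app, hσ, Str.fst_pair, Str.snd_pair]
      refine ⟨σ, fun q => by rw [hσ]; exact h.binary _ _, ?_⟩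
      intro k hk n hn l hl hj
      rw [hrow]
      obtain ⟨h₁, h₂, h₃⟩ := bmin_spec (hRn n) m
      refine ⟨fun hn => h.tree _ _ ?_, fun s hs hR hR' j hj => ?_⟩
      · refine (Str.lt_add_one_iff.1 hl).trans (not_lt.1 fun hlt => hn ⟨_, hlt, ?_⟩)
        exact h₃ (hlt.trans_le hk)
      · obtain ⟨h₄, h₅⟩ := bmin_of_lt (hRn n) (hs.trans_le hk) hR
        rw [h₄.antisymm (not_lt.1 fun hlt => hR' _ hlt h₅)]
  -- the rows of the path
  have hrow : ∀ n, IsBinary (row σ n) := fun n j => by rw [row_app]; exact hσ _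
  have hrow₁ : ∀ n, (∀ s, ¬ R n s) → ∀ l, G (row σ n) l := by
    intro n hn l
    obtain ⟨b, hb⟩ := exists_pair_lt n l
    have h₁ : n < max (n + 1) (max l b) := (Str.lt_add_one_iff.2 le_rfl).trans_le (le_max_left _ _)
    have h₂ : l ≤ max (n + 1) (max l b) := (le_max_left _ _).trans (le_max_right _ _)
    have h₃ : b ≤ max (n + 1) (max l b) := (le_max_right _ _).trans (le_max_right _ _)
    exact (hσ' _ n h₁ l (Str.lt_add_one_iff.2 h₂) fun j hj => (hb j hj).trans_le h₃).1
      fun ⟨s, _, hs⟩ => hn s hs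
  have hrow₂ : ∀ n s, R n s → (∀ t < s, ¬ R n t) → row σ n = g s := by
    intro n s hs hs'
    refine Str.funext fun j => ?_
    obtain ⟨b, hb⟩ := exists_pair_lt n (j + 1)
    have h₁ : n < max (max (n + 1) (s + 1)) (max (j + 1) b) :=
      (Str.lt_add_one_iff.2 le_rfl).trans_le ((le_max_left _ _).trans (le_max_left _ _))
    have h₁' : s < max (max (n + 1) (s + 1)) (max (j + 1) b) :=
      (Str.lt_add_one_iff.2 le_rfl).trans_le ((le_max_right _ _).trans (le_max_left _ _))
    have h₂ : j + 1 ≤ max (max (n + 1) (s + 1)) (max (j + 1) b) :=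
      (le_max_left _ _).trans (le_max_right _ _)
    have h₃ : b ≤ max (max (n + 1) (s + 1)) (max (j + 1) b) :=
      (le_max_right _ _).trans (le_max_right _ _)
    exact (hσ' _ n h₁ (j + 1) (Str.lt_add_one_iff.2 h₂) fun j hj => (hb j hj).trans_le h₃).2
      s h₁' hs hs' j (Str.lt_add_one_iff.2 le_rfl)
  obtain ⟨μ, hμ⟩ := Str.choice_nat (M := M) (P := fun n m => (BEx m fun s => R n s) ∨
    D (row σ n) m) (by fun_prop) fun n => by
      by_cases hn : ∃ s, R n s
      · obtain ⟨s, hs⟩ := hn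
        exact ⟨s + 1, .inl ⟨s, Str.lt_add_one_iff.2 le_rfl, hs⟩⟩
      · push Not at hn
        exact (h.of_tree _ (hrow n) (hrow₁ n hn)).imp fun m hm => .inr hm
  have hd : Dfn M fun n => BEx (μ n) fun s => R n s := by fun_prop
  refine hd.congr fun n => propext ⟨fun ⟨s, hs⟩ => ?_, fun ⟨s, _, hs⟩ => ⟨s, hs⟩⟩
  obtain ⟨t, -, ht, ht'⟩ := Str.exists_least (hRn n) hs
  rcases lt_or_ge t (μ n) with h' | h'
  · exact ⟨t, h', ht⟩
  · refine (hμ n).resolve_right fun hDn => ?_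
    rw [hrow₂ n t ht ht'] at hDn
    exact h.not_prop t _ h' hDn

/-- The Bolzano–Weierstraß theorem in Cantor space, by arithmetical comprehension: every sequence
of binary sequences has an accumulation point. -/
theorem exists_accumulation
    (hJ : ∀ R : M.D .nat → M.D .nat → Prop, (Dfn M fun p : M.D .nat × M.D .nat => R p.1 p.2) →
      Dfn M fun n => ∃ s, R n s)
    {g : M.D (.arr .nat .one)} (hg : ∀ s, IsBinary (g s)) :
    ∃ z t : M.D .one, IsBinary z ∧ ∀ k, k ≤ t k ∧ ∀ j < k, M.app (g (t k)) j = z j := by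
  let I : M.D .nat → M.D .nat → Prop := fun u k => ∀ t, ∃ s, t ≤ s ∧ dig (g s) k = u
  have hI : Dfn M fun p : M.D .nat × M.D .nat => I p.1 p.2 := by
    have h₁ := hJ (fun v s => Str.fst v ≤ s ∧ dig (g s) (Str.snd (Str.snd v)) = Str.fst (Str.snd v))
      (by fun_prop)
    have h₂ := hJ (fun v t => ¬ ∃ s, Str.fst (Str.pair t v) ≤ s ∧
      dig (g s) (Str.snd (Str.snd (Str.pair t v))) = Str.fst (Str.snd (Str.pair t v)))
      (h₁.comp (f := fun p : M.D .nat × M.D .nat => Str.pair p.2 p.1) (by fun_prop)).not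
    have h₃ := (h₂.comp (f := fun p : M.D .nat × M.D .nat => Str.pair p.1 p.2) (by fun_prop)).not
    refine h₃.congr fun p => ?_
    simp [I]
  -- one of the two successors of a string with infinitely many occurrences has this property
  have hstep : ∀ u k, I u k → ¬ I (2 * u) (k + 1) → I (2 * u + 1) (k + 1) := by
    intro u k hu hn t
    simp only [I, not_forall, not_exists, not_and] at hn
    obtain ⟨t', ht'⟩ := hn
    obtain ⟨s, hs, hsu⟩ := hu (max t t')
    refine ⟨s, (le_max_left _ _).trans hs, ?_⟩
    have h₁ := ht' s ((le_max_right _ _).trans hs)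
    rw [dig_succ, hsu] at h₁ ⊢
    rcases Str.lt_two_iff.1 (hg s k) with h | h <;> rw [h] at h₁ ⊢
    exact (h₁ (add_zero _)).elim
  have hI' : Dfn M fun p : M.D .nat × M.D .nat => I (2 * p.2) (p.1 + 1) :=
    hI.comp (f := fun p : M.D .nat × M.D .nat => (2 * p.2, p.1 + 1)) (by fun_prop)
  let d : M.D .nat → M.D .nat := nrec (fun k u => sel (I (2 * u) (k + 1)) (2 * u) (2 * u + 1)) 0
  have hd : Dfn M d := by
    have : Dfn M fun p : (M.D .nat × M.D .nat) × M.D .nat => I (2 * p.2) (p.1.2 + 1) :=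
      hI'.comp (f := fun p : (M.D .nat × M.D .nat) × M.D .nat => (p.1.2, p.2)) (by fun_prop)
    exact Dfn.nrec (by fun_prop) (by fun_prop) (by fun_prop)
  have hds : ∀ k, d (k + 1) = sel (I (2 * d k) (k + 1)) (2 * d k) (2 * d k + 1) :=
    nrec_succ (by fun_prop) 0
  have hId : Dfn M fun k => I (d k) k :=
    hI.comp (f := fun k : M.D .nat => (d k, k)) (by fun_prop)
  have hId' : Dfn M fun k => I (2 * d k) (k + 1) :=
    hI.comp (f := fun k : M.D .nat => (2 * d k, k + 1)) (by fun_prop)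
  have hinf : ∀ k, I (d k) k := by
    refine Str.induction hId (fun t => ⟨t, le_rfl, ?_⟩) fun k hk => ?_
    · rw [dig_zero]; exact (nrec_zero _ _).symm
    · rw [hds]
      by_cases h : I (2 * d k) (k + 1)
      · rwa [sel_pos h]
      · rw [sel_neg h]; exact hstep _ _ hk h
  let z : M.D .one := lam fun k => sel (I (2 * d k) (k + 1)) 0 1
  have hz : ∀ k, z k = sel (I (2 * d k) (k + 1)) 0 1 := lam_app (by fun_prop)
  have hzb : IsBinary z := fun k => by
    rw [hz]
    by_cases h : I (2 * d k) (k + 1)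
    · rw [sel_pos h]; exact two_pos
    · rw [sel_neg h]; exact one_lt_two
  have hdz : ∀ k, dig z k = d k := by
    refine Str.induction (by fun_prop) ((dig_zero z).trans (nrec_zero _ _).symm) fun k hk => ?_
    rw [dig_succ, hds, hz, hk]
    by_cases h : I (2 * d k) (k + 1)
    · rw [sel_pos h, sel_pos h, add_zero]
    · rw [sel_neg h, sel_neg h]
  obtain ⟨t, ht⟩ := Str.choice_nat (M := M) (P := fun k s => k ≤ s ∧ dig (g s) k = dig z k)
    (by fun_prop) fun k => by rw [hdz]; exact hinf k k
  exact ⟨z, t, hzb, fun k => ⟨(ht k).1, dig_injective (hg _) hzb (ht k).2⟩⟩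

/-- Grilliot's trick: the discontinuity of a property along a converging sequence gives a
functional which decides whether a sequence is constantly `0`. -/
theorem Discontinuity.dfn_forall_eq_zero {G D : M.D .one → M.D .nat → Prop}
    {g : M.D (.arr .nat .one)} (h : Discontinuity G D g) {z t : M.D .one} (hz : IsBinary z)
    (ht : ∀ k, k ≤ t k ∧ ∀ j < k, M.app (g (t k)) j = z j) :
    Dfn M fun f : M.D .one => ∀ i, f i = 0 := by
  have hD := h.dfn_prop
  obtain ⟨m, hm⟩ := h.of_tree z hz fun l =>
    h.congr _ _ _ (ht l).2 (h.tree _ _ (ht l).1)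
  -- the sequence `w f` is `z` if `f` is constantly `0`, and a member of `g` otherwise
  let w : M.D .one → M.D .one := fun f => lam fun j =>
    sel (BAll (j + 1) fun i => f i = 0) (z j) (M.app (g (t (bmin (j + 1) fun i => f i ≠ 0))) j)
  have hw : ∀ f j, M.app (w f) j = sel (BAll (j + 1) fun i => f i = 0) (z j)
      (M.app (g (t (bmin (j + 1) fun i => f i ≠ 0))) j) := fun f => lam_app (by fun_prop)
  have hwd : Dfn M fun f => w f := by fun_prop
  have hd : Dfn M fun f : M.D .one => (BAll m fun i => f i = 0) ∧ D (w f) m := by fun_prop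
  refine hd.congr fun f => propext ⟨fun hf => ⟨fun i _ => hf i, ?_⟩, ?_⟩
  · have : w f = z := Str.funext fun j => (hw f j).trans (sel_pos (fun i _ => hf i) _ _)
    rwa [this]
  · rintro ⟨h₁, h₂⟩
    by_contra! hf
    obtain ⟨i, hi⟩ := hf
    obtain ⟨k, -, hk, hk'⟩ := Str.exists_least (P := fun i => f i ≠ 0) (by fun_prop) hi
    have hmk : m ≤ k := not_lt.1 fun hlt => hk (h₁ k hlt)
    have : w f = g (t k) := Str.funext fun j => by
      rw [hw]
      rcases lt_or_ge j k with hj | hj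
      · exact (sel_pos (fun i hi => not_not.1 (hk' i ((Str.lt_add_one_iff.1 hi).trans_lt hj)))
          _ _).trans ((ht k).2 j hj).symm
      · have hkj := Str.lt_add_one_iff.2 hj
        rw [sel_neg fun h => hk (h k hkj)]
        obtain ⟨h₃, h₄⟩ := bmin_of_lt (P := fun i => f i ≠ 0) (by fun_prop) hkj hk
        rw [h₃.antisymm (not_lt.1 fun hlt => hk' _ hlt h₄)]
    rw [this] at h₂
    exact h.not_prop _ _ (hmk.trans (ht k).1) h₂

/-- Arithmetical comprehension, uniformly in parameters of all types. -/
theorem Dfn.exists_nat (hE : Dfn M fun f : M.D .one => ∀ i, f i = 0) {R : X → M.D .nat → Prop}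
    (hR : Dfn M fun p : X × M.D .nat => R p.1 p.2) : Dfn M fun x => ∃ n, R x n := by
  have hd : Dfn M fun x => (HORM.lam fun n => HORM.sel (R x n) 1 0 : M.D .one) := by fun_prop
  refine (hE.comp hd).not.congr fun x => propext ?_
  have hx : Dfn M fun n => R x n := hR.comp (f := fun n : M.D .nat => (x, n)) (by fun_prop)
  rw [not_forall]
  refine exists_congr fun n => ?_
  rw [lam_app (by fun_prop)]
  by_cases h : R x n
  · rw [sel_pos h]; exact iff_of_true h one_ne_zero
  · rw [sel_neg h]; exact iff_of_false h fun h => h rfl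

/-! ### `WKL` and `QF-AC^{0,1}` imply `HBC` -/

theorem RealEq.symm {x y : M.D .one} (h : RealEq x y) : RealEq y x := fun n => by
  rw [abs_sub_comm]; exact h n

theorem RealLt.congr_right {x y z : M.D .one} (h : RealLt x y) (hx : IsReal x) (hy : IsReal y)
    (hyz : RealEq y z) : RealLt x z := by
  obtain ⟨s, hs⟩ := h.eventually hx hy (c := 4) (by norm_num)
  exact ⟨s, by linarith [hs s le_rfl, (abs_le.1 (hyz s)).2]⟩

theorem RealLt.congr_left {x y z : M.D .one} (h : RealLt x y) (hx : IsReal x) (hy : IsReal y)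
    (hxz : RealEq x z) : RealLt z y := by
  obtain ⟨s, hs⟩ := h.eventually hx hy (c := 4) (by norm_num)
  exact ⟨s, by linarith [hs s le_rfl, (abs_le.1 (hxz s)).1]⟩

theorem pos_iff_realLt {x : M.D .one} : Pos x ↔ RealLt (ofRat 0) x := by
  simp [Pos, RealLt]

theorem Pos.congr {x y : M.D .one} (h : Pos x) (hx : IsReal x) (hxy : RealEq x y) : Pos y :=
  pos_iff_realLt.2 ((pos_iff_realLt.1 h).congr_right (isReal_ofRat 0) hx hxy)

/-- Up to level `l`, no approximation of `∑ f(i) 2^{-i-1}` shows that it lies in one of the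
intervals `(a_i, b_i)`. -/
def Uncovered (a b : M.D (.arr .nat .one)) (f : M.D .one) (l : M.D .nat) : Prop :=
  BAll l fun k => ¬ BEx (k + 1) fun i => apx (a i) k + 2 * eps k < apx (binReal f) k ∧
    apx (binReal f) k + 2 * eps k < apx (b i) k

@[fun_prop] theorem Dfn.uncovered (a b : M.D (.arr .nat .one)) {f : X → M.D .one}
    {l : X → M.D .nat} (hf : Dfn M f) (hl : Dfn M l) : Dfn M fun x => Uncovered a b (f x) (l x) := by
  unfold Uncovered
  have : Dfn M fun p : (X × M.D .nat) × M.D .nat => f p.1.1 := by fun_prop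
  fun_prop

section

variable {a b : M.D (.arr .nat .one)}

theorem Uncovered.mono {f : M.D .one} {l m : M.D .nat} (h : Uncovered a b f m) (hl : l ≤ m) :
    Uncovered a b f l := fun k hk => h k (hk.trans_le hl)

theorem Uncovered.congr {f g : M.D .one} {l : M.D .nat} (h : ∀ j < l, f j = g j)
    (hf : Uncovered a b f l) : Uncovered a b g l := fun k hk => by
  have := hf k hk
  dsimp only at this ⊢
  rw [apx_binReal, bin, dig_congr h (Str.add_one_le_iff.2 hk)] at this
  rwa [apx_binReal, bin]

theorem uncovered_of_not_inInterval {f : M.D .one} {l : M.D .nat}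
    (h : ∀ n ≤ l, ¬ InInterval a b n (binReal f)) : Uncovered a b f l :=
  fun k hk ⟨n, hn, h₁, h₂⟩ => h n ((Str.lt_add_one_iff.1 hn).trans hk.le) ⟨⟨k, h₁⟩, ⟨k, h₂⟩⟩

theorem not_inInterval_of_uncovered (hab : ∀ n, IsReal (a n) ∧ IsReal (b n)) {f : M.D .one}
    (hf : IsBinary f) (h : ∀ l, Uncovered a b f l) (n : M.D .nat) :
    ¬ InInterval a b n (binReal f) := by
  rintro ⟨h₁, h₂⟩
  obtain ⟨s₁, hs₁⟩ := h₁.eventually (hab n).1 hf.isReal (c := 2) two_pos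
  obtain ⟨s₂, hs₂⟩ := h₂.eventually hf.isReal (hab n).2 (c := 2) two_pos
  exact h _ (max n (max s₁ s₂)) (Str.lt_add_one_iff.2 le_rfl)
    ⟨n, Str.lt_add_one_iff.2 (le_max_left _ _),
      hs₁ _ ((le_max_left _ _).trans (le_max_right _ _)),
      hs₂ _ ((le_max_right _ _).trans (le_max_right _ _))⟩

end

theorem Str.SatWKL.satHBC (hW : M.SatWKL) (hAC : M.SatAC) : M.SatHBC := by
  intro Y a b hY hab hcov
  by_contra! hno
  have hYr := hY.isOpen.fn.real
  have hpos : ∀ f, IsBinary f → (∀ l, Uncovered a b f l) → Pos (Y (binReal f)) := by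
    intro f hf h
    by_contra hn
    obtain ⟨n, hn⟩ := hcov _ hf.isReal hn
    exact not_inInterval_of_uncovered hab hf h n hn
  -- binary expansions of points of the closed set outside the first intervals
  have hbin : ∀ l, ∃ f, IsBinary f ∧ ¬ Pos (Y (binReal f)) ∧ Uncovered a b f l := by
    intro l
    obtain ⟨x, hx, hxY, hxn⟩ := hno l
    obtain ⟨f, hf, hfx⟩ := hx.exists_binReal (hY.sub x hx hxY)
    refine ⟨f, hf, fun h => hxY (h.congr (hYr _ hf.isReal)
      (hY.isOpen.fn.eq _ hf.isReal _ hx hfx.symm)), uncovered_of_not_inInterval fun n hn h => ?_⟩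
    exact hxn n hn ⟨h.1.congr_right (hab n).1 hf.isReal hfx.symm,
      h.2.congr_left hf.isReal (hab n).2 hfx.symm⟩
  -- approximations of such points are chosen by quantifier-free choice
  obtain ⟨g, hg⟩ := hAC.binary (P := fun n f => apx (Y (binReal f)) n ≤ 2 * eps n ∧
    Uncovered a b f n) (by fun_prop) fun n => by
      obtain ⟨f, hf, hfY, hfn⟩ := hbin n
      exact ⟨f, hf, not_lt.1 fun h => hfY ⟨n, h⟩, hfn⟩
  have hdisc : Discontinuity (Uncovered a b) (fun f m => 3 * eps m < apx (Y (binReal f)) m) g :=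
    { dfn_tree := by fun_prop
      dfn_prop := by fun_prop
      binary := fun s => (hg s).1
      congr := fun f f' l h => Uncovered.congr h
      tree := fun s l hl => (hg s).2.2.mono hl
      of_tree := fun f hf h => by
        obtain ⟨s, hs⟩ := (pos_iff_realLt.1 (hpos f hf h)).eventually (isReal_ofRat 0)
          (hYr _ hf.isReal) (c := 3) (by norm_num)
        exact ⟨s, by simpa using hs s le_rfl⟩
      not_prop := fun s m hm => by
        have h₁ := abs_lt.1 ((hYr _ (hg s).1.isReal).abs_lt hm)
        have h₂ := eps_anti hm
        rw [not_lt]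
        linarith [h₁.1, h₁.2, (hg s).2.1] }
  have hJ : ∀ R : M.D .nat → M.D .nat → Prop, (Dfn M fun p : M.D .nat × M.D .nat => R p.1 p.2) →
    Dfn M fun n => ∃ s, R n s := fun R hR => hdisc.dfn_exists hW hR
  obtain ⟨z, t, hz, ht⟩ := exists_accumulation hJ hdisc.binary
  have hE := hdisc.dfn_forall_eq_zero hz ht
  -- now membership in the closed set is decidable, and points of the set can be chosen
  have hPos : Dfn M fun f : M.D .one => Pos (Y (binReal f)) :=
    Dfn.exists_nat hE (R := fun f n => 2 * eps n < apx (Y (binReal f)) n) (by fun_prop)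
  obtain ⟨g', hg'⟩ := hAC.binary (P := fun n f => ¬ Pos (Y (binReal f)) ∧ Uncovered a b f n)
    ((hPos.comp (f := fun p : M.D .nat × M.D .one => p.2) (by fun_prop)).not.and (by fun_prop)) hbin
  obtain ⟨z', t', hz', ht'⟩ := exists_accumulation hJ fun s => (hg' s).1
  have hz'Y := hpos z' hz' fun l =>
    ((hg' _).2.2.mono (ht' l).1).congr (ht' l).2
  obtain ⟨r, hr, hball⟩ := hY.isOpen.ball _ hz'.isReal hz'Y
  obtain ⟨n, hn⟩ := exists_eps_lt (half_pos hr)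
  refine (hg' (t' (n + 1 + 1))).2.1 (hball _ (hg' _).1.isReal ⟨n, ?_⟩)
  rw [apx_binReal, apx_binReal, bin, bin, dig_congr (ht' (n + 1 + 1)).2 le_rfl, sub_self, abs_zero]
  linarith

end

end HORM

open HORM in
theorem corollary3p4 :
    Proves (RCA0w ⊔ QFAC .nat .one) [] (WKL.iff HBC) ∧
    Proves (RCA0w ⊔ QFAC .nat .one) [WKL] HBC ∧
    Proves RCA0w [HBUclosed] HBC := by
  have hcl : (RCA0w ⊔ QFAC .nat .one).Closed := RCA0w_closed.sup (QFAC_closed _ _)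
  have hAC : ∀ M : Str, M.Models (RCA0w ⊔ QFAC .nat .one) → ∀ [M.IsModel], M.SatAC := by
    intro M hM _ P hP hex
    refine Str.choice_of_sat (funext fun ρ => eq_true ?_) hP hex
    exact hM _ _ (.inr ⟨_, by simp [Fm.QF], rfl⟩) ρ
  have hmod : ∀ M : Str, M.Extensional → M.Models (RCA0w ⊔ QFAC .nat .one) → M.IsModel :=
    fun M hext hM => ⟨hext, fun Γ φ hφ => hM Γ φ (.inl hφ)⟩
  refine ⟨derives_of_sat hcl le_sup_left fun M hext hM _ => ?_,
    derives_of_sat hcl le_sup_left fun M hext hM hS => ?_,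
    derives_of_sat RCA0w_closed le_rfl fun M hext hM hS => ?_⟩
  · have := hmod M hext hM
    rw [Fm.sat_iff, sat_WKL, sat_HBC]
    exact ⟨fun h => h.satHBC (hAC M hM), fun h => h.satWKL⟩
  · have := hmod M hext hM
    have h := hS WKL (by simp)
    rw [sat_WKL] at h
    rw [sat_HBC]
    exact h.satHBC (hAC M hM)
  · have : M.IsModel := ⟨hext, hM⟩
    have h := hS HBUclosed (by simp)
    rw [sat_HBUclosed] at h
    rw [sat_HBC]
    exact h.satHBC
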